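/- Let $M$ be a connected Riemann surface and let $y:M\to\mathbb S^3\subset\mathbb R^4$ be a Willmore surface without umbilic points: $y$ is a smooth conformal immersion whose second fundamental form is nowhere a multiple of the first, and $y$ is a critical point, under compactly supported smooth variations, of the Willmore functional $W=\int_M (H^2-k_1k_2)\,dA=\int_M\frac14(k_1-k_2)^2\,dA$, where $k_1,k_2$ are the principal curvatures in $\mathbb S^3$, $H=\frac12(k_1+k_2)$ and $dA$ is the induced area element. Invariants. On $\mathbb R^{4,1}\otimes\mathbb C$ let $\langle A,B\rangle=-A_0B_0+A_1B_1+\dots+A_4B_4$ (complex bilinear). In a local holomorphic coordinate $z=u+iv$ of $M$ let $Y=|y_u|^{-1}(1,y)$ (the lift of $y$ to the light cone with $|dY|^2=|dz|^2$), let $V=\mathrm{span}\{Y,\mathrm{Re}\,Y_z,\mathrm{Im}\,Y_z,Y_{z\bar z}\}$, let $\kappa$ be the component of $Y_{zz}$ in $V^\perp\otimes\mathbb C$ with respect to $\mathbb R^{4,1}=V\oplus V^\perp$, and let $D$ be the normal connection of the line bundle $V^\perp$ (the $V^\perp$-component of the derivative). Then $\langle\kappa,\bar\kappa\rangle>0$,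 and there is a unique function $\mu$ with $D_{\bar z}\kappa+\frac{\bar\mu}{2}\kappa=0$. Put $$\rho=\bar\mu_z-2\langle\kappa,\bar\kappa\rangle,\qquad \mathcal P=\frac{\rho}{\langle\kappa,\bar\kappa\rangle},\qquad e^{2\omega}=4\langle\kappa,\bar\kappa\rangle,\qquad \mathcal K=-4e^{-2\omega}\omega_{z\bar z}.$$ The functions $\mathcal P:M\to\mathbb C$ and $\mathcal K:M\to\mathbb R$ do not depend on the coordinate; $g=e^{2\omega}|dz|^2$ is the Möbius metric of $y$, whose area is $W$, and $\mathcal K$ is its Gaussian curvature. Then the following three conditions are equivalent: 1. $\mathcal P\equiv 0$ on $M$; 2. $\mathcal K\equiv 1$ on $M$; 3. $y$ is the image of a minimal surface in $\mathbb R^3$ under the inverse of a stereographic projection: there are a point $v\in\mathbb S^3$ and a smooth immersion $x:M\to\mathbb R^3$ of vanishing mean curvature such that $y=\sigma_v^{-1}\circ x$, where $\sigma_v:\mathbb S^3\setminus\{v\}\to\mathbb R^3$ is the stereographic projection from $v$. -/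

import Mathlib

open Set MeasureTheory Complex
open scoped Manifold ContDiff

noncomputable section

namespace MobiusSurface

/-! ### Surfaces in a local coordinate `w = u + i v`

A parametrised surface is a map `f : ℂ → EuclideanSpace ℝ (Fin n)`; only its values on the open
set on which the coordinate lives are used. -/

/-- The partial derivative `∂f/∂u`. -/
def pu {E : Type*} [NormedAddCommGroup E] [NormedSpace ℝ E] (f : ℂ → E) (w : ℂ) : E :=
  fderiv ℝ f w 1

/-- The partial derivative `∂f/∂v`. -/
def pv {E : Type*} [NormedAddCommGroup E] [NormedSpace ℝ E] (f : ℂ → E) (w : ℂ) : E :=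
  fderiv ℝ f w I

/-- Coefficient `E = ⟨f_u, f_u⟩` of the first fundamental form. -/
def coeffE {n : ℕ} (f : ℂ → EuclideanSpace ℝ (Fin n)) (w : ℂ) : ℝ := inner ℝ (pu f w) (pu f w)

/-- Coefficient `F = ⟨f_u, f_v⟩` of the first fundamental form. -/
def coeffF {n : ℕ} (f : ℂ → EuclideanSpace ℝ (Fin n)) (w : ℂ) : ℝ := inner ℝ (pu f w) (pv f w)

/-- Coefficient `G = ⟨f_v, f_v⟩` of the first fundamental form. -/
def coeffG {n : ℕ} (f : ℂ → EuclideanSpace ℝ (Fin n)) (w : ℂ) : ℝ := inner ℝ (pv f w) (pv f w)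

/-- The area density `√(E G - F²)`. -/
def areaDensity {n : ℕ} (f : ℂ → EuclideanSpace ℝ (Fin n)) (w : ℂ) : ℝ :=
  Real.sqrt (coeffE f w * coeffG f w - coeffF f w ^ 2)

/-- For a surface `f` in the unit sphere of `ℝ⁴`, the pairing of a vector `a` with the unit normal
of `f` inside the sphere, i.e. `det (f, f_u, f_v, a) / √(E G - F²)`. -/
def pairNormalS3 (f : ℂ → EuclideanSpace ℝ (Fin 4)) (w : ℂ) (a : EuclideanSpace ℝ (Fin 4)) : ℝ :=
  Matrix.det (fun i j : Fin 4 => (![f w, pu f w, pv f w, a] i) j) / areaDensity f w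

/-- For a surface `f` in `ℝ³`, the pairing of a vector `a` with the unit normal of `f`,
i.e. `det (f_u, f_v, a) / √(E G - F²)`. -/
def pairNormalR3 (f : ℂ → EuclideanSpace ℝ (Fin 3)) (w : ℂ) (a : EuclideanSpace ℝ (Fin 3)) : ℝ :=
  Matrix.det (fun i j : Fin 3 => (![pu f w, pv f w, a] i) j) / areaDensity f w

/-- Coefficient `L = ⟨f_uu, n⟩` of the second fundamental form of a surface in the 3-sphere. -/
def coeffLS3 (f : ℂ → EuclideanSpace ℝ (Fin 4)) (w : ℂ) : ℝ := pairNormalS3 f w (pu (pu f) w)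

/-- Coefficient `M = ⟨f_uv, n⟩` of the second fundamental form. -/
def coeffMS3 (f : ℂ → EuclideanSpace ℝ (Fin 4)) (w : ℂ) : ℝ := pairNormalS3 f w (pv (pu f) w)

/-- Coefficient `N = ⟨f_vv, n⟩` of the second fundamental form. -/
def coeffNS3 (f : ℂ → EuclideanSpace ℝ (Fin 4)) (w : ℂ) : ℝ := pairNormalS3 f w (pv (pv f) w)

/-- The mean curvature of a surface in the unit 3-sphere. -/
def meanCurvatureS3 (f : ℂ → EuclideanSpace ℝ (Fin 4)) (w : ℂ) : ℝ :=
  (coeffE f w * coeffNS3 f w - 2 * coeffF f w * coeffMS3 f w + coeffG f w * coeffLS3 f w) /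
    (2 * (coeffE f w * coeffG f w - coeffF f w ^ 2))

/-- The product of the principal curvatures of a surface in the unit 3-sphere. -/
def extrinsicCurvatureS3 (f : ℂ → EuclideanSpace ℝ (Fin 4)) (w : ℂ) : ℝ :=
  (coeffLS3 f w * coeffNS3 f w - coeffMS3 f w ^ 2) /
    (coeffE f w * coeffG f w - coeffF f w ^ 2)

/-- A point is umbilic when the second fundamental form is a multiple of the first one. -/
def IsUmbilicS3 (f : ℂ → EuclideanSpace ℝ (Fin 4)) (w : ℂ) : Prop :=
  ∃ h : ℝ, coeffLS3 f w = h * coeffE f w ∧ coeffMS3 f w = h * coeffF f w ∧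
    coeffNS3 f w = h * coeffG f w

/-- The area density of the Möbius metric of an immersion into the unit 3-sphere, in an arbitrary
(not necessarily conformal) coordinate: `(H² - k₁k₂) dA = ¼ (k₁ - k₂)² dA`.
In a conformal coordinate it is `4 ⟨κ, κ̄⟩ du dv`. -/
def willmoreDensity (f : ℂ → EuclideanSpace ℝ (Fin 4)) (w : ℂ) : ℝ :=
  (meanCurvatureS3 f w ^ 2 - extrinsicCurvatureS3 f w) * areaDensity f w

/-- The mean curvature of a surface in `ℝ³`. -/
def meanCurvatureR3 (f : ℂ → EuclideanSpace ℝ (Fin 3)) (w : ℂ) : ℝ :=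
  (coeffE f w * pairNormalR3 f w (pv (pv f) w) - 2 * coeffF f w * pairNormalR3 f w (pv (pu f) w)
      + coeffG f w * pairNormalR3 f w (pu (pu f) w)) /
    (2 * (coeffE f w * coeffG f w - coeffF f w ^ 2))

/-! ### Möbius geometry in a local conformal coordinate -/

/-- The complexification of Minkowski space `ℝ^{4,1}`; the coordinate `0` is the time-like one. -/
abbrev Mink : Type := Fin 5 → ℂ

/-- The complex bilinear extension of the Lorentz product `-A₀B₀ + A₁B₁ + ⋯ + A₄B₄`. -/
def lor (A B : Mink) : ℂ := -(A 0 * B 0) + ∑ i : Fin 4, A i.succ * B i.succ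

/-- Complex conjugation on `ℝ^{4,1} ⊗ ℂ`. -/
def conjM (A : Mink) : Mink := fun i => (starRingEnd ℂ) (A i)

/-- `∂_z = ½ (∂_u - i ∂_v)`. -/
def dz {E : Type*} [NormedAddCommGroup E] [NormedSpace ℂ E] (F : ℂ → E) (w : ℂ) : E :=
  (1 / 2 : ℂ) • (fderiv ℝ F w 1 - I • fderiv ℝ F w I)

/-- `∂_z̄ = ½ (∂_u + i ∂_v)`. -/
def dzbar {E : Type*} [NormedAddCommGroup E] [NormedSpace ℂ E] (F : ℂ → E) (w : ℂ) : E :=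
  (1 / 2 : ℂ) • (fderiv ℝ F w 1 + I • fderiv ℝ F w I)

/-- The canonical lift `Y = |f_u|⁻¹ (1, f)` of a conformal surface `f` in the 3-sphere to the light
cone: the one with `|dY|² = |dz|²`. -/
def lift (f : ℂ → EuclideanSpace ℝ (Fin 4)) (w : ℂ) : Mink :=
  (((Real.sqrt (coeffE f w))⁻¹ : ℝ) : ℂ) •
    (Fin.cons (1 : ℂ) (fun i : Fin 4 => ((f w i : ℝ) : ℂ)) : Mink)

/-- The frame vector `N`: the null vector of `V = span {Y, Re Y_z, Im Y_z, Y_{z z̄}}` with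
`⟨N, Y⟩ = -1` and `⟨N, Y_z⟩ = 0`. Since `⟨Y_{z z̄}, Y⟩ = -½`, it is
`2 Y_{z z̄} + 2 ⟨Y_{z z̄}, Y_{z z̄}⟩ Y`. -/
def frameN (f : ℂ → EuclideanSpace ℝ (Fin 4)) (w : ℂ) : Mink :=
  (2 : ℂ) • dzbar (dz (lift f)) w
    + (2 * lor (dzbar (dz (lift f)) w) (dzbar (dz (lift f)) w)) • lift f w

/-- The orthogonal projection `ℝ^{4,1} ⊗ ℂ → V^⊥ ⊗ ℂ` along the mean curvature sphere `V`, in the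
frame `Y, Y_z, Y_z̄, N`, whose only non-zero products are `⟨Y_z, Y_z̄⟩ = ½` and `⟨Y, N⟩ = -1`. -/
def normalProj (f : ℂ → EuclideanSpace ℝ (Fin 4)) (w : ℂ) (A : Mink) : Mink :=
  A + lor A (frameN f w) • lift f w + lor A (lift f w) • frameN f w
    - (2 * lor A (dzbar (lift f) w)) • dz (lift f) w
    - (2 * lor A (dz (lift f) w)) • dzbar (lift f) w

/-- The Hopfian `κ`, the normal part of `Y_zz`, a section of `V^⊥ ⊗ ℂ`. -/
def kappa (f : ℂ → EuclideanSpace ℝ (Fin 4)) (w : ℂ) : Mink :=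
  normalProj f w (dz (dz (lift f)) w)

/-- `D_z̄ κ`, where `D` is the normal connection. -/
def Dkappa (f : ℂ → EuclideanSpace ℝ (Fin 4)) (w : ℂ) : Mink :=
  normalProj f w (dzbar (kappa f) w)

/-- The real function `⟨κ, κ̄⟩`. -/
def kappaSq (f : ℂ → EuclideanSpace ℝ (Fin 4)) (w : ℂ) : ℝ := (lor (kappa f w) (conjM (kappa f w))).re

/-- The function `μ̄` with `D_z̄ κ + (μ̄ / 2) κ = 0`. As `V^⊥` is a line bundle, it is found by
pairing with `κ̄`. -/
def muBar (f : ℂ → EuclideanSpace ℝ (Fin 4)) (w : ℂ) : ℂ :=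
  -2 * lor (Dkappa f w) (conjM (kappa f w)) / (kappaSq f w : ℂ)

/-- `ρ = μ̄_z - 2 ⟨κ, κ̄⟩`. -/
def rho (f : ℂ → EuclideanSpace ℝ (Fin 4)) (w : ℂ) : ℂ := dz (muBar f) w - 2 * (kappaSq f w : ℂ)

/-- The invariant `𝒫 = ρ / ⟨κ, κ̄⟩`. -/
def invP (f : ℂ → EuclideanSpace ℝ (Fin 4)) (w : ℂ) : ℂ := rho f w / (kappaSq f w : ℂ)

/-- The function `ω` such that the Möbius metric is `e^{2ω} |dz|² = 4 ⟨κ, κ̄⟩ |dz|²`. -/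
def omega (f : ℂ → EuclideanSpace ℝ (Fin 4)) (w : ℂ) : ℝ := Real.log (4 * kappaSq f w) / 2

/-- The Möbius curvature `𝒦 = -4 e^{-2ω} ω_{z z̄}`, the Gaussian curvature of the Möbius metric. -/
def mobiusK (f : ℂ → EuclideanSpace ℝ (Fin 4)) (w : ℂ) : ℝ :=
  -4 * Real.exp (-2 * omega f w) * (dzbar (dz (fun w' => (omega f w' : ℂ))) w).re

/-! ### Surfaces defined on a Riemann surface `M` -/

section Global

variable {M : Type*} [TopologicalSpace M] [ChartedSpace ℂ M]

/-- The local holomorphic coordinates of a Riemann surface. -/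
def coords (M : Type*) [TopologicalSpace M] [ChartedSpace ℂ M] : Set (OpenPartialHomeomorph M ℂ) :=
  IsManifold.maximalAtlas 𝓘(ℂ) ω M

/-- The expression of `y : M → S³ ⊆ ℝ⁴` in a local coordinate `φ`. -/
def inCoord (y : M → Metric.sphere (0 : EuclideanSpace ℝ (Fin 4)) 1)
    (φ : OpenPartialHomeomorph M ℂ) (w : ℂ) : EuclideanSpace ℝ (Fin 4) := (y (φ.symm w)).1

/-- `y : M → S³` is a smooth conformal immersion. -/
def IsConformalImmersion (y : M → Metric.sphere (0 : EuclideanSpace ℝ (Fin 4)) 1) : Prop :=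
  ContMDiff 𝓘(ℝ, ℂ) 𝓘(ℝ, EuclideanSpace ℝ (Fin 4)) ∞
    (fun p => (y p : EuclideanSpace ℝ (Fin 4))) ∧
  ∀ φ ∈ coords M, ∀ w ∈ φ.target,
    0 < coeffE (inCoord y φ) w ∧ coeffE (inCoord y φ) w = coeffG (inCoord y φ) w ∧
      coeffF (inCoord y φ) w = 0

/-- `F` is a smooth variation of the surface patch `f : U → S³` that is fixed outside the compact
set `C ⊆ U`. (For small `|t|` the map `F t` is then an immersion on `C` whenever `f` is one.) -/
structure IsVariation (f : ℂ → EuclideanSpace ℝ (Fin 4)) (U C : Set ℂ)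
    (F : ℝ → ℂ → EuclideanSpace ℝ (Fin 4)) : Prop where
  smooth : ContDiffOn ℝ ∞ (fun q : ℝ × ℂ => F q.1 q.2) (univ ×ˢ U)
  mem_sphere : ∀ t, ∀ w ∈ U, ‖F t w‖ = 1
  start : ∀ w ∈ U, F 0 w = f w
  isCompact : IsCompact C
  subset : C ⊆ U
  fixed : ∀ t, ∀ w ∈ U \ C, F t w = f w

/-- `y : M → S³` is a Willmore surface: a conformal immersion which is a critical point of the
Willmore functional, the area with respect to the Möbius metric, under all compactly supported
smooth variations (through immersions that need not be conformal). As the first variation is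
additive and local, the supports are taken inside coordinate domains. -/
def IsWillmore (y : M → Metric.sphere (0 : EuclideanSpace ℝ (Fin 4)) 1) : Prop :=
  IsConformalImmersion y ∧
  ∀ φ ∈ coords M, ∀ (C : Set ℂ) (F : ℝ → ℂ → EuclideanSpace ℝ (Fin 4)),
    IsVariation (inCoord y φ) φ.target C F →
      HasDerivAt (fun t : ℝ => ∫ w in C, willmoreDensity (F t) w) 0 0

/-- `y : M → S³` has no umbilic points. -/
def UmbilicFree (y : M → Metric.sphere (0 : EuclideanSpace ℝ (Fin 4)) 1) : Prop :=
  ∀ φ ∈ coords M, ∀ w ∈ φ.target, ¬ IsUmbilicS3 (inCoord y φ) w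

/-- `x : M → ℝ³` is a minimal surface: a smooth immersion with vanishing mean curvature. -/
def IsMinimal (x : M → EuclideanSpace ℝ (Fin 3)) : Prop :=
  ContMDiff 𝓘(ℝ, ℂ) 𝓘(ℝ, EuclideanSpace ℝ (Fin 3)) ∞ x ∧
  ∀ φ ∈ coords M, ∀ w ∈ φ.target,
    Function.Injective (fderiv ℝ (fun w' => x (φ.symm w')) w) ∧
      meanCurvatureR3 (fun w' => x (φ.symm w')) w = 0

end Global

/-- The inverse `ℝ³ → S³` of the stereographic projection from the point `v ∈ S³`. -/
def invStereo (v : Metric.sphere (0 : EuclideanSpace ℝ (Fin 4)) 1) (a : EuclideanSpace ℝ (Fin 3)) :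
    Metric.sphere (0 : EuclideanSpace ℝ (Fin 4)) 1 :=
  haveI : Fact (Module.finrank ℝ (EuclideanSpace ℝ (Fin 4)) = 3 + 1) := ⟨by simp⟩
  (stereographic' 3 v).symm a

end MobiusSurface

end

/-! Let Y be the canonical lift of y to the light cone and E the real unit normal of its mean
curvature sphere, so that κ = kE with k = ⟨Y_zz, E⟩, and k has no zeros because there are no
umbilics. The products of the frame Y, Y_z, Y_z̄, N, E are constant. Differentiating them gives the
structure equations Y_zz = -(s/2)Y + kE, Y_zz̄ = -|k|²Y + ½N, E_z = 2k_z̄ Y - 2k Y_z̄ and a formula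
for N_z. Their integrability conditions are the Gauss equation s_z̄ = 6k k̄_z + 2k̄ k_z
(`ConfFrame.gauss`) and the Codazzi equation, that k_z̄z̄ + (s̄/2)k is real (`ConfFrame.codazzi`).

The first variation of the Willmore density in a normal direction is 8 Re(k̄(φ_zz + (s/2)φ))
(`hasDerivAt_willmoreDensity`). Integration by parts yields the real part of k_z̄z̄ + (s̄/2)k = 0,
and Codazzi supplies the imaginary part (`ConfPatch.willmore_equation`). With μ̄ = -2k_z̄/k this
equation reads s = μ_z - ½μ². Its z̄-derivative, compared with Gauss, is ρ̄_z = μρ̄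
(`ConfFrame.dz_conj_rho`).

Conditions 1 and 2: from e^{2ω} = 4|k|² one finds 𝒦 = 1 + ½ Re 𝒫, so 𝒫 = 0 gives 𝒦 = 1, and 𝒦 = 1
says that ρ is imaginary. In that case ρ_z = μρ and ρ_z̄ = μ̄ρ, and equality of the mixed
derivatives forces ρ² = 0 (`ConfFrame.rho_eq_zero_of_imaginary`).

Conditions 1 and 3: under stereographic projection from v, mean curvature spheres through v become
planes, so the projected surface is minimal precisely when (1, v) is orthogonal to every E
(`StereoPatch.lor_pole_sphereNormal_iff`). If a constant real null vector c is orthogonal to every E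
and ⟨c, Y⟩ is nonzero, then c is a multiple of the dual surface Ŷ = ½|μ|²Y + μ̄Y_z + μY_z̄ + N, and
two evaluations of ⟨c, Y_zz̄⟩ give ρ = 0. Conversely the Willmore equation and ρ = 0 give Ŷ_z = ½μŶ
(`ConfFrame.dz_dualSurface`), so the null line of Ŷ is locally constant and defines a pole v. Poles
are unique and independent of the coordinate, so on a connected M the local ones are a single point
(`exists_pole`). -/

noncomputable section

namespace MobiusSurface

/-! ### Calculus of the Wirtinger derivatives -/

section Calculus

variable {E F G : Type*} [NormedAddCommGroup E] [NormedSpace ℂ E] [NormedAddCommGroup F]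
  [NormedSpace ℂ F] [NormedAddCommGroup G] [NormedSpace ℂ G]

/-- The operator `½ (∂_u + ε ∂_v)`, which is `∂_z` for `ε = -i` and `∂_z̄` for `ε = i`. -/
def wirt (ε : ℂ) (f : ℂ → E) (w : ℂ) : E :=
  (1 / 2 : ℂ) • (fderiv ℝ f w 1 + ε • fderiv ℝ f w I)

theorem dz_eq_wirt : (dz : (ℂ → E) → ℂ → E) = wirt (-I) := by
  funext f w
  simp [dz, wirt, sub_eq_add_neg]

theorem dzbar_eq_wirt : (dzbar : (ℂ → E) → ℂ → E) = wirt I := rfl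

theorem _root_.ContDiffOn.differentiableAt_of_isOpen {E' F' : Type*} [NormedAddCommGroup E']
    [NormedSpace ℝ E'] [NormedAddCommGroup F'] [NormedSpace ℝ F'] {U : Set E'} {f : E' → F'}
    (hf : ContDiffOn ℝ ∞ f U) (hU : IsOpen U) {w : E'} (hw : w ∈ U) : DifferentiableAt ℝ f w :=
  (hf.contDiffAt (hU.mem_nhds hw)).differentiableAt (by simp)

theorem _root_.ContDiffOn.fderiv_apply_const {E' F' : Type*} [NormedAddCommGroup E']
    [NormedSpace ℝ E'] [NormedAddCommGroup F'] [NormedSpace ℝ F'] {U : Set E'} {f : E' → F'}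
    (hf : ContDiffOn ℝ ∞ f U) (hU : IsOpen U) (v : E') :
    ContDiffOn ℝ ∞ (fun w => fderiv ℝ f w v) U :=
  (hf.fderiv_of_isOpen hU (by simp)).clm_apply contDiffOn_const

theorem fderiv_congr_of_isOpen {E' F' : Type*} [NormedAddCommGroup E']
    [NormedSpace ℝ E'] [NormedAddCommGroup F'] [NormedSpace ℝ F'] {U : Set E'} {f g : E' → F'}
    (hU : IsOpen U) (h : EqOn f g U) {w : E'} (hw : w ∈ U) : fderiv ℝ f w = fderiv ℝ g w :=
  Filter.EventuallyEq.fderiv_eq (Filter.eventuallyEq_of_mem (hU.mem_nhds hw) h)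

theorem fderiv_fderiv_apply {E' F' : Type*} [NormedAddCommGroup E']
    [NormedSpace ℝ E'] [NormedAddCommGroup F'] [NormedSpace ℝ F'] {U : Set E'} {f : E' → F'}
    (hf : ContDiffOn ℝ ∞ f U) (hU : IsOpen U) {w : E'} (hw : w ∈ U) (a b : E') :
    fderiv ℝ (fun x => fderiv ℝ f x a) w b = fderiv ℝ (fderiv ℝ f) w b a := by
  have h := ContDiffOn.differentiableAt_of_isOpen
    (hf.fderiv_of_isOpen (m := ∞) hU (by simp)) hU hw
  rw [fderiv_clm_apply h (differentiableAt_const a)]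
  simp

theorem fderiv_comm_of_isOpen {E' F' : Type*} [NormedAddCommGroup E']
    [NormedSpace ℝ E'] [NormedAddCommGroup F'] [NormedSpace ℝ F'] {U : Set E'} {f : E' → F'}
    (hf : ContDiffOn ℝ ∞ f U) (hU : IsOpen U) {w : E'} (hw : w ∈ U) (a b : E') :
    fderiv ℝ (fun x => fderiv ℝ f x a) w b = fderiv ℝ (fun x => fderiv ℝ f x b) w a := by
  rw [fderiv_fderiv_apply hf hU hw, fderiv_fderiv_apply hf hU hw]
  exact ((hf.contDiffAt (hU.mem_nhds hw)).isSymmSndFDerivAt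
    (by simpa using WithTop.coe_le_coe.2 (le_top (a := (2 : ℕ∞))))) b a

variable {U : Set ℂ} {w : ℂ}

theorem wirt_congr (ε : ℂ) {f g : ℂ → E} (hU : IsOpen U) (h : EqOn f g U) (hw : w ∈ U) :
    wirt ε f w = wirt ε g w := by
  simp only [wirt, fderiv_congr_of_isOpen hU h hw]

theorem dz_congr {f g : ℂ → E} (hU : IsOpen U) (h : EqOn f g U) (hw : w ∈ U) :
    dz f w = dz g w := by
  simpa only [dz_eq_wirt] using wirt_congr _ hU h hw

theorem dzbar_congr {f g : ℂ → E} (hU : IsOpen U) (h : EqOn f g U) (hw : w ∈ U) :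
    dzbar f w = dzbar g w :=
  wirt_congr _ hU h hw

theorem contDiffOn_wirt (ε : ℂ) {f : ℂ → E} (hf : ContDiffOn ℝ ∞ f U) (hU : IsOpen U) :
    ContDiffOn ℝ ∞ (wirt ε f) U :=
  ((ContDiffOn.fderiv_apply_const hf hU 1).add
    ((ContDiffOn.fderiv_apply_const hf hU I).const_smul ε)).const_smul (1 / 2 : ℂ)

theorem contDiffOn_dz {f : ℂ → E} (hf : ContDiffOn ℝ ∞ f U) (hU : IsOpen U) :
    ContDiffOn ℝ ∞ (dz f) U := by
  rw [dz_eq_wirt]; exact contDiffOn_wirt _ hf hU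

theorem contDiffOn_dzbar {f : ℂ → E} (hf : ContDiffOn ℝ ∞ f U) (hU : IsOpen U) :
    ContDiffOn ℝ ∞ (dzbar f) U := by
  rw [dzbar_eq_wirt]; exact contDiffOn_wirt _ hf hU

theorem wirt_const (ε : ℂ) (c : E) : wirt ε (fun _ => c) w = 0 := by
  simp [wirt]

theorem dz_const (c : E) : dz (fun _ : ℂ => c) w = 0 := by
  rw [dz_eq_wirt]; exact wirt_const _ _

theorem dzbar_const (c : E) : dzbar (fun _ : ℂ => c) w = 0 := wirt_const _ _

theorem wirt_add (ε : ℂ) {f g : ℂ → E} (hf : DifferentiableAt ℝ f w)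
    (hg : DifferentiableAt ℝ g w) :
    wirt ε (fun x => f x + g x) w = wirt ε f w + wirt ε g w := by
  simp only [wirt, fderiv_fun_add hf hg, add_apply]
  module

theorem dz_add {f g : ℂ → E} (hf : DifferentiableAt ℝ f w) (hg : DifferentiableAt ℝ g w) :
    dz (fun x => f x + g x) w = dz f w + dz g w := by
  simpa only [dz_eq_wirt] using wirt_add _ hf hg

theorem dzbar_add {f g : ℂ → E} (hf : DifferentiableAt ℝ f w) (hg : DifferentiableAt ℝ g w) :
    dzbar (fun x => f x + g x) w = dzbar f w + dzbar g w :=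
  wirt_add _ hf hg

theorem wirt_bilin (ε : ℂ) (B : E →L[ℂ] F →L[ℂ] G) {f : ℂ → E} {g : ℂ → F}
    (hf : DifferentiableAt ℝ f w) (hg : DifferentiableAt ℝ g w) :
    wirt ε (fun x => B (f x) (g x)) w = B (wirt ε f w) (g w) + B (f w) (wirt ε g w) := by
  have h := (B.bilinearRestrictScalars ℝ).fderiv_of_bilinear hf hg
  have h' : (fun x => B (f x) (g x)) = fun x => (B.bilinearRestrictScalars ℝ) (f x) (g x) := rfl
  simp only [wirt, h', h]
  simp only [add_apply, ContinuousLinearMap.precompR_apply,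
    ContinuousLinearMap.precompL_apply, ContinuousLinearMap.compL_apply,
    ContinuousLinearMap.comp_apply, ContinuousLinearMap.bilinearRestrictScalars_apply_apply,
    map_add, map_smul, smul_apply, smul_add]
  module

theorem contDiffOn_bilin {X : Type*} [NormedAddCommGroup X] [NormedSpace ℝ X] {S : Set X}
    (B : E →L[ℂ] F →L[ℂ] G) {f : X → E} {g : X → F}
    (hf : ContDiffOn ℝ ∞ f S) (hg : ContDiffOn ℝ ∞ g S) :
    ContDiffOn ℝ ∞ (fun x => B (f x) (g x)) S :=
  (B.bilinearRestrictScalars ℝ).isBoundedBilinearMap.contDiff.comp_contDiffOn (hf.prodMk hg)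

theorem wirt_clm (ε : ℂ) (B : E →L[ℂ] F) {f : ℂ → E} (hf : DifferentiableAt ℝ f w) :
    wirt ε (fun x => B (f x)) w = B (wirt ε f w) := by
  have h : fderiv ℝ (fun x => B (f x)) w = (B.restrictScalars ℝ).comp (fderiv ℝ f w) :=
    ((B.restrictScalars ℝ).hasFDerivAt.comp w hf.hasFDerivAt).fderiv
  simp [wirt, h]

theorem dz_mul {f g : ℂ → ℂ} (hf : DifferentiableAt ℝ f w) (hg : DifferentiableAt ℝ g w) :
    dz (fun x => f x * g x) w = dz f w * g w + f w * dz g w := by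
  simpa only [dz_eq_wirt, ContinuousLinearMap.mul_apply'] using
    wirt_bilin (-I) (ContinuousLinearMap.mul ℂ ℂ) hf hg

theorem dzbar_mul {f g : ℂ → ℂ} (hf : DifferentiableAt ℝ f w) (hg : DifferentiableAt ℝ g w) :
    dzbar (fun x => f x * g x) w = dzbar f w * g w + f w * dzbar g w := by
  simpa only [dzbar_eq_wirt, ContinuousLinearMap.mul_apply'] using
    wirt_bilin I (ContinuousLinearMap.mul ℂ ℂ) hf hg

theorem dz_smul {f : ℂ → ℂ} {g : ℂ → E} (hf : DifferentiableAt ℝ f w)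
    (hg : DifferentiableAt ℝ g w) :
    dz (fun x => f x • g x) w = dz f w • g w + f w • dz g w := by
  simpa only [dz_eq_wirt, ContinuousLinearMap.lsmul_apply] using
    wirt_bilin (-I) (ContinuousLinearMap.lsmul ℂ ℂ : ℂ →L[ℂ] E →L[ℂ] E) hf hg

theorem dzbar_smul {f : ℂ → ℂ} {g : ℂ → E} (hf : DifferentiableAt ℝ f w)
    (hg : DifferentiableAt ℝ g w) :
    dzbar (fun x => f x • g x) w = dzbar f w • g w + f w • dzbar g w := by
  simpa only [dzbar_eq_wirt, ContinuousLinearMap.lsmul_apply] using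
    wirt_bilin I (ContinuousLinearMap.lsmul ℂ ℂ : ℂ →L[ℂ] E →L[ℂ] E) hf hg

theorem dz_const_smul (c : ℂ) {g : ℂ → E} (hg : DifferentiableAt ℝ g w) :
    dz (fun x => c • g x) w = c • dz g w := by
  rw [dz_smul (differentiableAt_const c) hg, dz_const]; simp

theorem dzbar_const_smul (c : ℂ) {g : ℂ → E} (hg : DifferentiableAt ℝ g w) :
    dzbar (fun x => c • g x) w = c • dzbar g w := by
  rw [dzbar_smul (differentiableAt_const c) hg, dzbar_const]; simp

theorem dz_const_mul (c : ℂ) {g : ℂ → ℂ} (hg : DifferentiableAt ℝ g w) :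
    dz (fun x => c * g x) w = c * dz g w := dz_const_smul c hg

theorem dzbar_const_mul (c : ℂ) {g : ℂ → ℂ} (hg : DifferentiableAt ℝ g w) :
    dzbar (fun x => c * g x) w = c * dzbar g w := dzbar_const_smul c hg

theorem dzbar_dz_comm {f : ℂ → E} (hf : ContDiffOn ℝ ∞ f U) (hU : IsOpen U) (hw : w ∈ U) :
    dzbar (dz f) w = dz (dzbar f) w := by
  have h1 := ContDiffOn.differentiableAt_of_isOpen (ContDiffOn.fderiv_apply_const hf hU 1) hU hw
  have h2 := ContDiffOn.differentiableAt_of_isOpen (ContDiffOn.fderiv_apply_const hf hU I) hU hw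
  have hc := fderiv_comm_of_isOpen hf hU hw 1 I
  have key : ∀ ε δ : ℂ, wirt ε (wirt δ f) w = (1 / 4 : ℂ) •
      (fderiv ℝ (fun x => fderiv ℝ f x 1) w 1 + δ • fderiv ℝ (fun x => fderiv ℝ f x I) w 1
        + ε • fderiv ℝ (fun x => fderiv ℝ f x I) w 1
        + (ε * δ) • fderiv ℝ (fun x => fderiv ℝ f x I) w I) := by
    intro ε δ
    have : fderiv ℝ (wirt δ f) w = (1 / 2 : ℂ) • (fderiv ℝ (fun x => fderiv ℝ f x 1) w
        + δ • fderiv ℝ (fun x => fderiv ℝ f x I) w) :=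
      ((h1.hasFDerivAt.add (h2.hasFDerivAt.const_smul δ)).const_smul (1 / 2 : ℂ)).fderiv
    simp only [wirt] at this ⊢
    rw [this]
    simp only [smul_apply, add_apply, hc]
    module
  rw [dz_eq_wirt, dzbar_eq_wirt, key, key]
  module

end Calculus

/-! ### The Lorentz product -/

/-- `lor` as a continuous bilinear map. -/
def lorL : Mink →L[ℂ] Mink →L[ℂ] ℂ :=
  LinearMap.mkContinuous₂ (LinearMap.mk₂ ℂ lor
    (fun a b c => by simp [lor, add_mul, Finset.sum_add_distrib]; ring)
    (fun a b c => by simp [lor, mul_add, Finset.mul_sum, mul_assoc])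
    (fun a b c => by simp [lor, mul_add, Finset.sum_add_distrib]; ring)
    (fun a b c => by simp [lor, mul_add, Finset.mul_sum, mul_left_comm])) 5 (by
    intro A B
    have hb : ∀ i, ‖A i * B i‖ ≤ ‖A‖ * ‖B‖ := fun i => by
      rw [norm_mul]; gcongr <;> exact norm_le_pi_norm _ i
    calc ‖lor A B‖ ≤ ‖-(A 0 * B 0)‖ + ‖∑ i : Fin 4, A i.succ * B i.succ‖ := norm_add_le _ _
      _ ≤ ‖A‖ * ‖B‖ + ∑ i : Fin 4, ‖A i.succ * B i.succ‖ := by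
        gcongr
        · rw [norm_neg]; exact hb 0
        · exact norm_sum_le _ _
      _ ≤ ‖A‖ * ‖B‖ + ∑ i : Fin 4, ‖A‖ * ‖B‖ := by gcongr; exact hb _
      _ = 5 * ‖A‖ * ‖B‖ := by simp; ring)

theorem lorL_apply (A B : Mink) : lorL A B = lor A B := rfl

theorem lor_comm (A B : Mink) : lor A B = lor B A := by
  simp [lor, mul_comm]

theorem lor_add_left (A B C : Mink) : lor (A + B) C = lor A C + lor B C := by
  simp only [← lorL_apply, map_add, add_apply]

theorem lor_add_right (A B C : Mink) : lor C (A + B) = lor C A + lor C B := by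
  simp only [← lorL_apply, map_add]

theorem lor_sub_left (A B C : Mink) : lor (A - B) C = lor A C - lor B C := by
  simp only [← lorL_apply, map_sub, sub_apply]

theorem lor_sub_right (A B C : Mink) : lor C (A - B) = lor C A - lor C B := by
  simp only [← lorL_apply, map_sub]

theorem lor_smul_left (c : ℂ) (A B : Mink) : lor (c • A) B = c * lor A B := by
  simp only [← lorL_apply, map_smul, smul_apply, smul_eq_mul]

theorem lor_smul_right (c : ℂ) (A B : Mink) : lor A (c • B) = c * lor A B := by
  simp only [← lorL_apply, map_smul, smul_eq_mul]

theorem lor_zero_left (A : Mink) : lor 0 A = 0 := by simp [lor]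

theorem lor_zero_right (A : Mink) : lor A 0 = 0 := by simp [lor]

theorem conjM_conjM (A : Mink) : conjM (conjM A) = A := by
  funext i; simp [conjM]

theorem conjM_add (A B : Mink) : conjM (A + B) = conjM A + conjM B := by
  funext i; simp [conjM]

theorem conjM_smul (c : ℂ) (A : Mink) : conjM (c • A) = (starRingEnd ℂ) c • conjM A := by
  funext i; simp [conjM]

theorem lor_conjM (A B : Mink) : lor (conjM A) (conjM B) = (starRingEnd ℂ) (lor A B) := by
  simp [lor, conjM]

/-! ### Wirtinger derivatives of Lorentz products and of conjugates. -/

section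

variable {U : Set ℂ} {w : ℂ}

theorem dz_lor {A B : ℂ → Mink} (hA : DifferentiableAt ℝ A w) (hB : DifferentiableAt ℝ B w) :
    dz (fun x => lor (A x) (B x)) w = lor (dz A w) (B w) + lor (A w) (dz B w) := by
  rw [dz_eq_wirt, dz_eq_wirt]; exact wirt_bilin _ lorL hA hB

theorem dzbar_lor {A B : ℂ → Mink} (hA : DifferentiableAt ℝ A w) (hB : DifferentiableAt ℝ B w) :
    dzbar (fun x => lor (A x) (B x)) w = lor (dzbar A w) (B w) + lor (A w) (dzbar B w) :=
  wirt_bilin _ lorL hA hB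

theorem contDiffOn_lor {X : Type*} [NormedAddCommGroup X] [NormedSpace ℝ X] {S : Set X}
    {A B : X → Mink} (hA : ContDiffOn ℝ ∞ A S) (hB : ContDiffOn ℝ ∞ B S) :
    ContDiffOn ℝ ∞ (fun x => lor (A x) (B x)) S :=
  contDiffOn_bilin lorL hA hB

theorem fderiv_conj_apply {f : ℂ → ℂ} (hf : DifferentiableAt ℝ f w) (v : ℂ) :
    fderiv ℝ (fun x => (starRingEnd ℂ) (f x)) w v = (starRingEnd ℂ) (fderiv ℝ f w v) := by
  have h : HasFDerivAt (fun x => (starRingEnd ℂ) (f x))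
      ((conjCLE : ℂ →L[ℝ] ℂ).comp (fderiv ℝ f w)) w :=
    (conjCLE : ℂ →L[ℝ] ℂ).hasFDerivAt.comp w hf.hasFDerivAt
  rw [h.fderiv]; simp

theorem dz_conj {f : ℂ → ℂ} (hf : DifferentiableAt ℝ f w) :
    dz (fun x => (starRingEnd ℂ) (f x)) w = (starRingEnd ℂ) (dzbar f w) := by
  simp only [dz, dzbar, fderiv_conj_apply hf, smul_eq_mul, map_mul, map_add, conj_I,
    map_div₀, map_one, map_ofNat]
  ring

theorem dzbar_conj {f : ℂ → ℂ} (hf : DifferentiableAt ℝ f w) :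
    dzbar (fun x => (starRingEnd ℂ) (f x)) w = (starRingEnd ℂ) (dz f w) := by
  simp only [dz, dzbar, fderiv_conj_apply hf, smul_eq_mul, map_mul, map_sub, conj_I,
    map_div₀, map_one, map_ofNat]
  ring

theorem contDiffOn_conj {X : Type*} [NormedAddCommGroup X] [NormedSpace ℝ X] {S : Set X}
    {f : X → ℂ} (hf : ContDiffOn ℝ ∞ f S) :
    ContDiffOn ℝ ∞ (fun x => (starRingEnd ℂ) (f x)) S :=
  (conjCLE : ℂ →L[ℝ] ℂ).contDiff.comp_contDiffOn hf

theorem dz_apply {A : ℂ → Mink} (hA : DifferentiableAt ℝ A w) (i : Fin 5) :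
    dz A w i = dz (fun x => A x i) w := by
  rw [dz_eq_wirt, dz_eq_wirt]
  exact (wirt_clm _ (ContinuousLinearMap.proj (R := ℂ) (φ := fun _ : Fin 5 => ℂ) i) hA).symm

theorem dzbar_apply {A : ℂ → Mink} (hA : DifferentiableAt ℝ A w) (i : Fin 5) :
    dzbar A w i = dzbar (fun x => A x i) w :=
  (wirt_clm _ (ContinuousLinearMap.proj (R := ℂ) (φ := fun _ : Fin 5 => ℂ) i) hA).symm

theorem dz_conjM {A : ℂ → Mink} (hA : DifferentiableAt ℝ A w) :
    dz (fun x => conjM (A x)) w = conjM (dzbar A w) := by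
  have hi : ∀ i, DifferentiableAt ℝ (fun x => A x i) w := fun i => differentiableAt_pi.1 hA i
  have hc : DifferentiableAt ℝ (fun x => conjM (A x)) w :=
    differentiableAt_pi.2 fun i => (conjCLE : ℂ →L[ℝ] ℂ).differentiableAt.comp w (hi i)
  funext i
  rw [dz_apply hc i]
  exact (dz_conj (hi i)).trans (by rw [conjM, dzbar_apply hA])

theorem dzbar_conjM {A : ℂ → Mink} (hA : DifferentiableAt ℝ A w) :
    dzbar (fun x => conjM (A x)) w = conjM (dz A w) := by
  have hi : ∀ i, DifferentiableAt ℝ (fun x => A x i) w := fun i => differentiableAt_pi.1 hA i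
  have hc : DifferentiableAt ℝ (fun x => conjM (A x)) w :=
    differentiableAt_pi.2 fun i => (conjCLE : ℂ →L[ℝ] ℂ).differentiableAt.comp w (hi i)
  funext i
  rw [dzbar_apply hc i]
  exact (dzbar_conj (hi i)).trans (by rw [conjM, dz_apply hA])

end


/-! ### Moving frames along a conformal surface in the light cone -/

/-- Five vectors with the products of a frame `Y, Y_z, Y_z̄, N, E` span `ℝ^{4,1} ⊗ ℂ`. -/
theorem eq_zero_of_frame {Y A₁ A₂ N E X : Mink} (hYY : lor Y Y = 0) (hY1 : lor Y A₁ = 0)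
    (hY2 : lor Y A₂ = 0) (hYN : lor Y N = -1) (hYE : lor Y E = 0) (h11 : lor A₁ A₁ = 0)
    (h12 : lor A₁ A₂ = 1 / 2) (h1N : lor A₁ N = 0) (h1E : lor A₁ E = 0) (h22 : lor A₂ A₂ = 0)
    (h2N : lor A₂ N = 0) (h2E : lor A₂ E = 0) (hNN : lor N N = 0) (hNE : lor N E = 0)
    (hEE : lor E E = 1) (xY : lor X Y = 0) (x1 : lor X A₁ = 0) (x2 : lor X A₂ = 0)
    (xN : lor X N = 0) (xE : lor X E = 0) : X = 0 := by
  set b : Fin 5 → Mink := ![Y, A₁, A₂, N, E] with hb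
  -- The frame has a dual frame inside itself: pairing a linear relation with `N`, `A₂`, `A₁`, `Y`,
  -- `E` isolates, up to a nonzero factor, the coefficient of `Y`, `A₁`, `A₂`, `N`, `E`.
  have hli : LinearIndependent ℂ b := by
    rw [Fintype.linearIndependent_iff]
    intro c hc
    have hp : ∀ B : Mink, c 0 * lor Y B + c 1 * lor A₁ B + c 2 * lor A₂ B + c 3 * lor N B
        + c 4 * lor E B = 0 := by
      intro B
      have := congrArg (fun v => lor v B) hc
      simpa [hb, Fin.sum_univ_succ, lor_add_left, lor_smul_left, lor_zero_left, add_assoc]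
        using this
    have e0 := hp N
    have e1 := hp A₂
    have e2 := hp A₁
    have e3 := hp Y
    have e4 := hp E
    rw [hYN, h1N, h2N, hNN, lor_comm E N, hNE] at e0
    rw [hY2, h12, h22, lor_comm N A₂, h2N, lor_comm E A₂, h2E] at e1
    rw [hY1, h11, lor_comm A₂ A₁, h12, lor_comm N A₁, h1N, lor_comm E A₁, h1E] at e2
    rw [hYY, lor_comm A₁ Y, hY1, lor_comm A₂ Y, hY2, lor_comm N Y, hYN, lor_comm E Y, hYE] at e3
    rw [hYE, h1E, h2E, hNE, hEE] at e4
    intro i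
    fin_cases i
    · change c 0 = 0; linear_combination -e0
    · change c 1 = 0; linear_combination 2 * e1
    · change c 2 = 0; linear_combination 2 * e2
    · change c 3 = 0; linear_combination -e3
    · change c 4 = 0; linear_combination e4
  have hspan := hli.span_eq_top_of_card_eq_finrank (by simp)
  -- Orthogonality to a basis gives orthogonality to the standard basis, which reads off the
  -- coordinates of `X` up to sign.
  have hperp : ∀ B : Mink, lor X B = 0 := by
    intro B
    have hB : B ∈ Submodule.span ℂ (range b) := by rw [hspan]; trivial
    induction hB using Submodule.span_induction with
    | mem x hx =>
      obtain ⟨i, rfl⟩ := hx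
      fin_cases i <;> simp [hb, xY, x1, x2, xN, xE]
    | zero => exact lor_zero_right _
    | add x y _ _ hx hy => rw [lor_add_right, hx, hy, add_zero]
    | smul a x _ hx => rw [lor_smul_right, hx, mul_zero]
  funext i
  have := hperp (Pi.single i 1)
  refine Fin.cases ?_ (fun j => ?_) i
  · have := hperp (Pi.single 0 1)
    simpa [lor] using this
  · have := hperp (Pi.single j.succ 1)
    simpa [lor, Pi.single_apply, Fin.succ_ne_zero] using this

/-- A lift `Y` of a conformal surface to the light cone with `|dY|² = |dz|²`, together with a unit
normal field `E` of its mean curvature spheres. -/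
structure ConfFrame (U : Set ℂ) (Y E : ℂ → Mink) : Prop where
  isOpen : IsOpen U
  smooth : ContDiffOn ℝ ∞ Y U
  smooth_normal : ContDiffOn ℝ ∞ E U
  real : ∀ w ∈ U, conjM (Y w) = Y w
  real_normal : ∀ w ∈ U, conjM (E w) = E w
  lor_self : ∀ w ∈ U, lor (Y w) (Y w) = 0
  lor_dz_dz : ∀ w ∈ U, lor (dz Y w) (dz Y w) = 0
  lor_dz_dzbar : ∀ w ∈ U, lor (dz Y w) (dzbar Y w) = 1 / 2
  normal_normal : ∀ w ∈ U, lor (E w) (E w) = 1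
  normal_self : ∀ w ∈ U, lor (E w) (Y w) = 0
  normal_dz : ∀ w ∈ U, lor (E w) (dz Y w) = 0
  normal_dzbar_dz : ∀ w ∈ U, lor (E w) (dzbar (dz Y) w) = 0

/-- The Hopf coefficient `k = ⟨Y_zz, E⟩`, so that `κ = k E`. -/
def hopf (Y E : ℂ → Mink) (w : ℂ) : ℂ := lor (dz (dz Y) w) (E w)

/-- The null frame vector `N` of a lift `Y`. -/
def nullN (Y : ℂ → Mink) (w : ℂ) : Mink :=
  (2 : ℂ) • dzbar (dz Y) w + (2 * lor (dzbar (dz Y) w) (dzbar (dz Y) w)) • Y w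

/-- The Schwarzian `s`, with `Y_zz + (s / 2) Y = κ`. -/
def schwarz (Y : ℂ → Mink) (w : ℂ) : ℂ := 2 * lor (dz (dz Y) w) (nullN Y w)

/-- Product rule for a constant product. Nearly every entry of the structure equations comes from
differentiating a relation between frame vectors once more. -/
theorem lor_dz_of_const {U : Set ℂ} (hU : IsOpen U) {A B : ℂ → Mink} (hA : ContDiffOn ℝ ∞ A U)
    (hB : ContDiffOn ℝ ∞ B U) {c : ℂ} (h : ∀ w ∈ U, lor (A w) (B w) = c) {w : ℂ} (hw : w ∈ U) :
    lor (dz A w) (B w) + lor (A w) (dz B w) = 0 := by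
  rw [← dz_lor (hA.differentiableAt_of_isOpen hU hw) (hB.differentiableAt_of_isOpen hU hw),
    dz_congr (g := fun _ => c) hU h hw, dz_const]

theorem lor_dzbar_of_const {U : Set ℂ} (hU : IsOpen U) {A B : ℂ → Mink}
    (hA : ContDiffOn ℝ ∞ A U) (hB : ContDiffOn ℝ ∞ B U) {c : ℂ}
    (h : ∀ w ∈ U, lor (A w) (B w) = c) {w : ℂ} (hw : w ∈ U) :
    lor (dzbar A w) (B w) + lor (A w) (dzbar B w) = 0 := by
  rw [← dzbar_lor (hA.differentiableAt_of_isOpen hU hw) (hB.differentiableAt_of_isOpen hU hw),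
    dzbar_congr (g := fun _ => c) hU h hw, dzbar_const]

theorem conjM_dz {U : Set ℂ} (hU : IsOpen U) {A : ℂ → Mink} (hA : ContDiffOn ℝ ∞ A U)
    (h : ∀ w ∈ U, conjM (A w) = A w) {w : ℂ} (hw : w ∈ U) : conjM (dz A w) = dzbar A w := by
  rw [← dzbar_conjM (hA.differentiableAt_of_isOpen hU hw), dzbar_congr hU h hw]

theorem conjM_dzbar {U : Set ℂ} (hU : IsOpen U) {A : ℂ → Mink} (hA : ContDiffOn ℝ ∞ A U)
    (h : ∀ w ∈ U, conjM (A w) = A w) {w : ℂ} (hw : w ∈ U) : conjM (dzbar A w) = dz A w := by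
  rw [← conjM_dz hU hA h hw, conjM_conjM]

namespace ConfFrame

variable {U : Set ℂ} {Y E : ℂ → Mink} (h : ConfFrame U Y E)

include h

theorem smooth_dz : ContDiffOn ℝ ∞ (dz Y) U := contDiffOn_dz h.smooth h.isOpen

theorem smooth_dzbar : ContDiffOn ℝ ∞ (dzbar Y) U := contDiffOn_dzbar h.smooth h.isOpen

theorem smooth_dz_dz : ContDiffOn ℝ ∞ (dz (dz Y)) U := contDiffOn_dz h.smooth_dz h.isOpen

theorem smooth_dzbar_dz : ContDiffOn ℝ ∞ (dzbar (dz Y)) U := contDiffOn_dzbar h.smooth_dz h.isOpen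

theorem smooth_hopf : ContDiffOn ℝ ∞ (hopf Y E) U := contDiffOn_lor h.smooth_dz_dz h.smooth_normal

theorem smooth_nullN : ContDiffOn ℝ ∞ (nullN Y) U :=
  (h.smooth_dzbar_dz.const_smul (2 : ℂ)).add
    ((contDiffOn_const.mul (contDiffOn_lor h.smooth_dzbar_dz h.smooth_dzbar_dz)).smul h.smooth)

theorem smooth_schwarz : ContDiffOn ℝ ∞ (schwarz Y) U :=
  contDiffOn_const.mul (contDiffOn_lor h.smooth_dz_dz h.smooth_nullN)

variable {w : ℂ} (hw : w ∈ U)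

include hw

theorem diff {V : Type*} [NormedAddCommGroup V] [NormedSpace ℝ V] {g : ℂ → V}
    (hg : ContDiffOn ℝ ∞ g U) : DifferentiableAt ℝ g w := hg.differentiableAt_of_isOpen h.isOpen hw

theorem conj_dz : conjM (dz Y w) = dzbar Y w := conjM_dz h.isOpen h.smooth h.real hw

theorem conj_dzbar : conjM (dzbar Y w) = dz Y w := conjM_dzbar h.isOpen h.smooth h.real hw

theorem conj_dz_dz : conjM (dz (dz Y) w) = dzbar (dzbar Y) w := by
  rw [← dzbar_conjM (h.diff hw h.smooth_dz)]
  exact dzbar_congr h.isOpen (fun x hx => h.conj_dz hx) hw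

theorem conj_dzbar_dz : conjM (dzbar (dz Y) w) = dzbar (dz Y) w := by
  rw [← dz_conjM (h.diff hw h.smooth_dz), dzbar_dz_comm h.smooth h.isOpen hw]
  exact dz_congr h.isOpen (fun x hx => h.conj_dz hx) hw

theorem self_dz : lor (Y w) (dz Y w) = 0 := by
  have := lor_dz_of_const h.isOpen h.smooth h.smooth h.lor_self hw
  rw [lor_comm] at this
  linear_combination this / 2

theorem self_dzbar : lor (Y w) (dzbar Y w) = 0 := by
  have := lor_dzbar_of_const h.isOpen h.smooth h.smooth h.lor_self hw
  rw [lor_comm] at this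
  linear_combination this / 2

theorem dzbar_dzbar : lor (dzbar Y w) (dzbar Y w) = 0 := by
  rw [← h.conj_dz hw, lor_conjM, h.lor_dz_dz w hw, map_zero]

theorem self_dz_dz : lor (Y w) (dz (dz Y) w) = 0 := by
  have := lor_dz_of_const h.isOpen h.smooth h.smooth_dz (fun x hx => h.self_dz hx) hw
  rw [h.lor_dz_dz w hw] at this
  linear_combination this

theorem self_dzbar_dz : lor (Y w) (dzbar (dz Y) w) = -(1 / 2) := by
  have := lor_dzbar_of_const h.isOpen h.smooth h.smooth_dz (fun x hx => h.self_dz hx) hw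
  rw [lor_comm, h.lor_dz_dzbar w hw] at this
  linear_combination this

theorem dz_dz_dz : lor (dz (dz Y) w) (dz Y w) = 0 := by
  have := lor_dz_of_const h.isOpen h.smooth_dz h.smooth_dz h.lor_dz_dz hw
  rw [lor_comm (dz Y w)] at this
  linear_combination this / 2

theorem dzbar_dz_dz : lor (dzbar (dz Y) w) (dz Y w) = 0 := by
  have := lor_dzbar_of_const h.isOpen h.smooth_dz h.smooth_dz h.lor_dz_dz hw
  rw [lor_comm (dz Y w)] at this
  linear_combination this / 2

theorem dzbar_dz_dzbar : lor (dzbar (dz Y) w) (dzbar Y w) = 0 := by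
  rw [← h.conj_dzbar_dz hw, ← h.conj_dz hw, lor_conjM, h.dzbar_dz_dz hw, map_zero]

theorem dz_dz_dzbar : lor (dz (dz Y) w) (dzbar Y w) = 0 := by
  have := lor_dz_of_const h.isOpen h.smooth_dz h.smooth_dzbar h.lor_dz_dzbar hw
  rw [← dzbar_dz_comm h.smooth h.isOpen hw, lor_comm (dz Y w), h.dzbar_dz_dz hw] at this
  linear_combination this

theorem normal_dzbar : lor (E w) (dzbar Y w) = 0 := by
  rw [← h.real_normal w hw, ← h.conj_dz hw, lor_conjM, h.normal_dz w hw, map_zero]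

theorem conj_hopf : (starRingEnd ℂ) (hopf Y E w) = lor (dzbar (dzbar Y) w) (E w) := by
  rw [hopf, ← lor_conjM, h.conj_dz_dz hw, h.real_normal w hw]

/-! The products of the null vector `N`. -/

theorem self_nullN : lor (Y w) (nullN Y w) = -1 := by
  rw [nullN, lor_add_right, lor_smul_right, lor_smul_right, h.self_dzbar_dz hw, h.lor_self w hw]
  ring

theorem dz_nullN : lor (dz Y w) (nullN Y w) = 0 := by
  rw [nullN, lor_add_right, lor_smul_right, lor_smul_right, lor_comm, h.dzbar_dz_dz hw,
    lor_comm (dz Y w), h.self_dz hw]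
  ring

theorem dzbar_nullN : lor (dzbar Y w) (nullN Y w) = 0 := by
  rw [nullN, lor_add_right, lor_smul_right, lor_smul_right, lor_comm, h.dzbar_dz_dzbar hw,
    lor_comm (dzbar Y w), h.self_dzbar hw]
  ring

theorem normal_nullN : lor (E w) (nullN Y w) = 0 := by
  rw [nullN, lor_add_right, lor_smul_right, lor_smul_right, h.normal_dzbar_dz w hw,
    h.normal_self w hw]
  ring

/-- The multiple of `Y` in `nullN` is chosen for this: with A = Y_zz̄ the product is 4⟨A, A⟩ + 8⟨A,
A⟩⟨A, Y⟩, and ⟨A, Y⟩ = -½. -/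
theorem nullN_nullN : lor (nullN Y w) (nullN Y w) = 0 := by
  simp only [nullN, lor_add_right, lor_add_left, lor_smul_right, lor_smul_left, h.lor_self w hw,
    h.self_dzbar_dz hw, lor_comm (dzbar (dz Y) w) (Y w)]
  ring

theorem conj_nullN : conjM (nullN Y w) = nullN Y w := by
  simp only [nullN, conjM_add, conjM_smul, h.conj_dzbar_dz hw, h.real w hw, map_mul, map_ofNat,
    ← lor_conjM]

/-- The expansion of a vector in the frame `Y, Y_z, Y_z̄, N, E`. -/
theorem expand (A : Mink) : A = (-lor A (nullN Y w)) • Y w + (-lor A (Y w)) • nullN Y w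
    + (2 * lor A (dzbar Y w)) • dz Y w + (2 * lor A (dz Y w)) • dzbar Y w
    + lor A (E w) • E w := by
  have hYE : lor (Y w) (E w) = 0 := by rw [lor_comm]; exact h.normal_self w hw
  have h1E : lor (dz Y w) (E w) = 0 := by rw [lor_comm]; exact h.normal_dz w hw
  have h2E : lor (dzbar Y w) (E w) = 0 := by rw [lor_comm]; exact h.normal_dzbar hw
  have hNE : lor (nullN Y w) (E w) = 0 := by rw [lor_comm]; exact h.normal_nullN hw
  have h1Y : lor (dz Y w) (Y w) = 0 := by rw [lor_comm]; exact h.self_dz hw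
  have h2Y : lor (dzbar Y w) (Y w) = 0 := by rw [lor_comm]; exact h.self_dzbar hw
  have h21 : lor (dzbar Y w) (dz Y w) = 1 / 2 := by rw [lor_comm]; exact h.lor_dz_dzbar w hw
  have hNY : lor (nullN Y w) (Y w) = -1 := by rw [lor_comm]; exact h.self_nullN hw
  have hN1 : lor (nullN Y w) (dz Y w) = 0 := by rw [lor_comm]; exact h.dz_nullN hw
  have hN2 : lor (nullN Y w) (dzbar Y w) = 0 := by rw [lor_comm]; exact h.dzbar_nullN hw
  -- The difference of the two sides is orthogonal to every frame vector. The factors 2 and -1 are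
  -- the inverses of ⟨Y_z, Y_z̄⟩ = ½ and ⟨Y, N⟩ = -1.
  refine sub_eq_zero.1 (eq_zero_of_frame (h.lor_self w hw) (h.self_dz hw) (h.self_dzbar hw)
    (h.self_nullN hw) hYE (h.lor_dz_dz w hw) (h.lor_dz_dzbar w hw) (h.dz_nullN hw) h1E
    (h.dzbar_dzbar hw) (h.dzbar_nullN hw) h2E (h.nullN_nullN hw) hNE (h.normal_normal w hw)
    ?_ ?_ ?_ ?_ ?_) <;>
  simp only [lor_sub_left, lor_add_left, lor_smul_left, hYE, h1E, h2E, hNE, h1Y, h2Y, h21, hNY,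
    hN1, hN2, h.lor_self w hw, h.self_dz hw, h.self_dzbar hw, h.self_nullN hw, h.lor_dz_dz w hw,
    h.lor_dz_dzbar w hw, h.dz_nullN hw, h.dzbar_dzbar hw, h.dzbar_nullN hw, h.nullN_nullN hw,
    h.normal_normal w hw, h.normal_self w hw, h.normal_dz w hw, h.normal_dzbar hw,
    h.normal_nullN hw] <;>
  ring

/-! The structure equations. -/

theorem dz_dz_eq : dz (dz Y) w = (-(schwarz Y w / 2)) • Y w + hopf Y E w • E w := by
  conv_lhs => rw [h.expand hw (dz (dz Y) w)]
  rw [lor_comm _ (Y w), h.self_dz_dz hw, h.dz_dz_dz hw, h.dz_dz_dzbar hw, schwarz, hopf]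
  module

/-- Differentiate ⟨Y_zz, Y_z̄⟩ = 0 in z̄ and ⟨Y_zz̄, Y_z̄⟩ = 0 in z. The third-order terms agree, so
⟨Y_zz̄, Y_zz̄⟩ = ⟨Y_zz, Y_z̄z̄⟩, and only the E-components contribute to the latter. -/
theorem gauss_metric : lor (dzbar (dz Y) w) (dzbar (dz Y) w)
    = hopf Y E w * (starRingEnd ℂ) (hopf Y E w) := by
  have h1 := lor_dzbar_of_const h.isOpen h.smooth_dz_dz h.smooth_dzbar
    (fun x hx => h.dz_dz_dzbar hx) hw
  have h2 := lor_dz_of_const h.isOpen h.smooth_dzbar_dz h.smooth_dzbar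
    (fun x hx => h.dzbar_dz_dzbar hx) hw
  rw [dzbar_dz_comm h.smooth_dz h.isOpen hw] at h1
  rw [← dzbar_dz_comm h.smooth h.isOpen hw] at h2
  have h3 : lor (dz (dz Y) w) (dzbar (dzbar Y) w)
      = hopf Y E w * (starRingEnd ℂ) (hopf Y E w) := by
    rw [h.conj_hopf hw, h.dz_dz_eq hw, lor_add_left, lor_smul_left, lor_smul_left,
      lor_comm (E w), ← h.conj_dz_dz hw]
    conv_lhs => enter [1, 2]; rw [← h.real w hw]
    rw [lor_conjM, h.self_dz_dz hw, map_zero]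
    ring
  linear_combination h2 - h1 + h3

theorem dzbar_dz_eq : dzbar (dz Y) w
    = (-(hopf Y E w * (starRingEnd ℂ) (hopf Y E w))) • Y w + (1 / 2 : ℂ) • nullN Y w := by
  rw [nullN, h.gauss_metric hw]
  module

theorem normal_dz_normal : lor (dz E w) (E w) = 0 := by
  have := lor_dz_of_const h.isOpen h.smooth_normal h.smooth_normal h.normal_normal hw
  rw [lor_comm (E w)] at this
  linear_combination this / 2

theorem normal_dzbar_normal : lor (dzbar E w) (E w) = 0 := by
  have := lor_dzbar_of_const h.isOpen h.smooth_normal h.smooth_normal h.normal_normal hw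
  rw [lor_comm (E w)] at this
  linear_combination this / 2

theorem dz_normal_self : lor (dz E w) (Y w) = 0 := by
  have := lor_dz_of_const h.isOpen h.smooth_normal h.smooth h.normal_self hw
  rw [h.normal_dz w hw] at this
  linear_combination this

theorem dz_normal_dz : lor (dz E w) (dz Y w) = -hopf Y E w := by
  have := lor_dz_of_const h.isOpen h.smooth_normal h.smooth_dz h.normal_dz hw
  rw [hopf, lor_comm (dz (dz Y) w)]
  linear_combination this

theorem dz_normal_dzbar : lor (dz E w) (dzbar Y w) = 0 := by
  have := lor_dz_of_const h.isOpen h.smooth_normal h.smooth_dzbar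
    (fun x hx => h.normal_dzbar hx) hw
  rw [← dzbar_dz_comm h.smooth h.isOpen hw, h.normal_dzbar_dz w hw] at this
  linear_combination this

theorem conj_dz_normal : conjM (dz E w) = dzbar E w :=
  conjM_dz h.isOpen h.smooth_normal h.real_normal hw

theorem dz_dz_dzbar_normal : lor (dz (dz Y) w) (dzbar E w) = 0 := by
  have e : lor (Y w) (dzbar E w) = 0 := by
    rw [← h.real w hw, ← h.conj_dz_normal hw, lor_conjM, lor_comm, h.dz_normal_self hw, map_zero]
  rw [h.dz_dz_eq hw, lor_add_left, lor_smul_left, lor_smul_left, e, lor_comm,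
    h.normal_dzbar_normal hw]
  ring

theorem dzbar_hopf : dzbar (hopf Y E) w = lor (dz (dzbar (dz Y)) w) (E w) := by
  have : dzbar (hopf Y E) w = _ :=
    dzbar_lor (h.diff hw h.smooth_dz_dz) (h.diff hw h.smooth_normal)
  rw [this, h.dz_dz_dzbar_normal hw, dzbar_dz_comm h.smooth_dz h.isOpen hw, add_zero]

theorem dz_nullN_eq_aux : dz (nullN Y) w = (2 : ℂ) • dz (dzbar (dz Y)) w
    + ((2 * dz (fun x => lor (dzbar (dz Y) x) (dzbar (dz Y) x)) w) • Y w
      + (2 * lor (dzbar (dz Y) w) (dzbar (dz Y) w)) • dz Y w) := by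
  have s := contDiffOn_lor h.smooth_dzbar_dz h.smooth_dzbar_dz
  have : dz (nullN Y) w = _ := dz_add ((h.diff hw h.smooth_dzbar_dz).fun_const_smul (2 : ℂ))
    (((h.diff hw s).const_mul (2 : ℂ)).fun_smul (h.diff hw h.smooth))
  rw [this, dz_smul ((h.diff hw s).const_mul (2 : ℂ)) (h.diff hw h.smooth),
    dz_const_mul _ (h.diff hw s), dz_const_smul _ (h.diff hw h.smooth_dzbar_dz)]

theorem dz_nullN_normal : lor (dz (nullN Y) w) (E w) = 2 * dzbar (hopf Y E) w := by
  rw [h.dz_nullN_eq_aux hw, h.dzbar_hopf hw]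
  simp only [lor_add_left, lor_smul_left, lor_comm (Y w) (E w), lor_comm (dz Y w) (E w),
    h.normal_self w hw, h.normal_dz w hw]
  ring

/-- The Y_z-component is 2⟨E_z, Y_z̄⟩ = -2⟨E, Y_zz̄⟩, which vanishes because E is normal to the mean
curvature sphere and not merely to some tangent sphere. The Y-component comes from ⟨E_z, N⟩ = -⟨E,
N_z⟩ = -2k_z̄. -/
theorem dz_normal_eq : dz E w = (2 * dzbar (hopf Y E) w) • Y w
    + (-(2 * hopf Y E w)) • dzbar Y w := by
  have hN : lor (dz E w) (nullN Y w) = -(2 * dzbar (hopf Y E) w) := by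
    have := lor_dz_of_const h.isOpen h.smooth_normal h.smooth_nullN
      (fun x hx => h.normal_nullN hx) hw
    rw [lor_comm (E w), h.dz_nullN_normal hw] at this
    linear_combination this
  conv_lhs => rw [h.expand hw (dz E w)]
  rw [hN, h.dz_normal_self hw, h.dz_normal_dz hw, h.dz_normal_dzbar hw, h.normal_dz_normal hw]
  module

/-- The products of N_z with Y, Y_z, Y_z̄ are traded for known products of N with derivatives of
these vectors; the E-component is `dz_nullN_normal`. -/
theorem dz_nullN_eq : dz (nullN Y) w
    = (-(2 * (hopf Y E w * (starRingEnd ℂ) (hopf Y E w)))) • dz Y w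
      + (-schwarz Y w) • dzbar Y w + (2 * dzbar (hopf Y E) w) • E w := by
  have hNN := lor_dz_of_const h.isOpen h.smooth_nullN h.smooth_nullN
    (fun x hx => h.nullN_nullN hx) hw
  have hYN := lor_dz_of_const h.isOpen h.smooth h.smooth_nullN (fun x hx => h.self_nullN hx) hw
  have h1N := lor_dz_of_const h.isOpen h.smooth_dz h.smooth_nullN (fun x hx => h.dz_nullN hx) hw
  have h2N := lor_dz_of_const h.isOpen h.smooth_dzbar h.smooth_nullN
    (fun x hx => h.dzbar_nullN hx) hw
  rw [lor_comm (nullN Y w)] at hNN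
  rw [h.dz_nullN hw, lor_comm (Y w)] at hYN
  rw [lor_comm (dz Y w)] at h1N
  rw [← dzbar_dz_comm h.smooth h.isOpen hw, h.dzbar_dz_eq hw, lor_comm (dzbar Y w), lor_add_left,
    lor_smul_left, lor_smul_left, h.self_nullN hw, h.nullN_nullN hw] at h2N
  conv_lhs => rw [h.expand hw (dz (nullN Y) w)]
  rw [show lor (dz (nullN Y) w) (nullN Y w) = 0 by linear_combination hNN / 2,
    show lor (dz (nullN Y) w) (Y w) = 0 by linear_combination hYN,
    show lor (dz (nullN Y) w) (dz Y w) = -(schwarz Y w / 2) by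
      rw [schwarz]; linear_combination h1N,
    show lor (dz (nullN Y) w) (dzbar Y w) = -(hopf Y E w * (starRingEnd ℂ) (hopf Y E w)) by
      linear_combination h2N, h.dz_nullN_normal hw]
  module

theorem dzbar_normal_eq : dzbar E w = (2 * (starRingEnd ℂ) (dzbar (hopf Y E) w)) • Y w
    + (-(2 * (starRingEnd ℂ) (hopf Y E w))) • dz Y w := by
  rw [← h.conj_dz_normal hw, h.dz_normal_eq hw, conjM_add, conjM_smul, conjM_smul, h.real w hw,
    h.conj_dzbar hw]
  simp [conj_ofNat]

omit hw in
theorem smooth_dzbar_hopf : ContDiffOn ℝ ∞ (dzbar (hopf Y E)) U :=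
  contDiffOn_dzbar h.smooth_hopf h.isOpen

theorem dzbar_dzbar_eq : dzbar (dzbar Y) w
    = (-((starRingEnd ℂ) (schwarz Y w) / 2)) • Y w + (starRingEnd ℂ) (hopf Y E w) • E w := by
  rw [← h.conj_dz_dz hw, h.dz_dz_eq hw, conjM_add, conjM_smul, conjM_smul, h.real w hw,
    h.real_normal w hw]
  simp [conj_ofNat]

/-- The conformal Codazzi equation: `k_z̄z̄ + (s̄ / 2) k` is real. -/
theorem codazzi : (starRingEnd ℂ) (dzbar (dzbar (hopf Y E)) w
    + (starRingEnd ℂ) (schwarz Y w) / 2 * hopf Y E w)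
    = dzbar (dzbar (hopf Y E)) w + (starRingEnd ℂ) (schwarz Y w) / 2 * hopf Y E w := by
  -- The Y-coefficient of E_zz̄ is twice the Codazzi expression. Since E is real, so is E_zz̄, and
  -- pairing with N extracts this coefficient.
  have e1 : dzbar (dz E) w = (2 * (dzbar (dzbar (hopf Y E)) w
      + (starRingEnd ℂ) (schwarz Y w) / 2 * hopf Y E w)) • Y w
      + (-(2 * (hopf Y E w * (starRingEnd ℂ) (hopf Y E w)))) • E w := by
    have d1 := h.diff hw h.smooth_dzbar_hopf
    have d2 := h.diff hw h.smooth_hopf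
    rw [dzbar_congr h.isOpen (fun x hx => h.dz_normal_eq hx) hw,
      dzbar_add ((d1.const_mul (2 : ℂ)).fun_smul (h.diff hw h.smooth))
        ((d2.const_mul (2 : ℂ)).fun_neg.fun_smul (h.diff hw h.smooth_dzbar)),
      dzbar_smul (d1.const_mul (2 : ℂ)) (h.diff hw h.smooth),
      dzbar_smul (d2.const_mul (2 : ℂ)).fun_neg (h.diff hw h.smooth_dzbar),
      dzbar_const_mul _ d1, h.dzbar_dzbar_eq hw]
    have : dzbar (fun x => -(2 * hopf Y E x)) w = -2 * dzbar (hopf Y E) w := by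
      simp only [← neg_mul]
      exact dzbar_const_mul _ d2
    rw [this]
    module
  have e2 : conjM (dzbar (dz E) w) = dzbar (dz E) w := by
    rw [← dz_conjM (h.diff hw (contDiffOn_dz h.smooth_normal h.isOpen)),
      dzbar_dz_comm h.smooth_normal h.isOpen hw]
    exact dz_congr h.isOpen (fun x hx => h.conj_dz_normal hx) hw
  rw [e1, conjM_add, conjM_smul, conjM_smul, h.real w hw, h.real_normal w hw] at e2
  have e3 := congrArg (fun v => lor v (nullN Y w)) e2
  simp only [lor_add_left, lor_smul_left, h.self_nullN hw, h.normal_nullN hw] at e3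
  rw [map_mul, map_ofNat] at e3
  linear_combination -e3 / 2

/-- The conformal Gauss equation `½ s_z̄ = 3 k k̄_z + k̄ k_z`. -/
theorem gauss : dzbar (schwarz Y) w
    = 6 * (hopf Y E w * (starRingEnd ℂ) (dzbar (hopf Y E) w))
      + 2 * (dz (hopf Y E) w * (starRingEnd ℂ) (hopf Y E w)) := by
  have d1 := h.diff hw h.smooth_schwarz
  have d2 := h.diff hw h.smooth_hopf
  have sc : ContDiffOn ℝ ∞ (fun x => (starRingEnd ℂ) (hopf Y E x)) U :=
    contDiffOn_conj h.smooth_hopf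
  have d3 := h.diff hw sc
  -- The Gauss equation is the Y-component of (Y_zz)_z̄ = (Y_zz̄)_z. Both sides are expanded in the
  -- frame and then paired with N.
  have e1 : dzbar (dz (dz Y)) w = (-(dzbar (schwarz Y) w / 2)) • Y w
      + (-(schwarz Y w / 2)) • dzbar Y w + dzbar (hopf Y E) w • E w
      + hopf Y E w • dzbar E w := by
    have d1' : DifferentiableAt ℝ (fun x => -(schwarz Y x / 2)) w := by
      simpa only [neg_mul, div_eq_inv_mul] using d1.const_mul (-(2 : ℂ)⁻¹)
    have : dzbar (fun x => -(schwarz Y x / 2)) w = -(dzbar (schwarz Y) w / 2) := by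
      have := dzbar_const_mul (-(2 : ℂ)⁻¹) d1
      simpa only [neg_mul, div_eq_inv_mul] using this
    rw [dzbar_congr h.isOpen (fun x hx => h.dz_dz_eq hx) hw,
      dzbar_add (d1'.fun_smul (h.diff hw h.smooth)) (d2.fun_smul (h.diff hw h.smooth_normal)),
      dzbar_smul d1' (h.diff hw h.smooth), dzbar_smul d2 (h.diff hw h.smooth_normal), this]
    module
  have e2 : dz (dzbar (dz Y)) w = (-(dz (hopf Y E) w * (starRingEnd ℂ) (hopf Y E w)
        + hopf Y E w * (starRingEnd ℂ) (dzbar (hopf Y E) w))) • Y w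
      + (-(hopf Y E w * (starRingEnd ℂ) (hopf Y E w))) • dz Y w
      + (1 / 2 : ℂ) • dz (nullN Y) w := by
    have : dz (fun x => -(hopf Y E x * (starRingEnd ℂ) (hopf Y E x))) w
        = -(dz (hopf Y E) w * (starRingEnd ℂ) (hopf Y E w)
        + hopf Y E w * (starRingEnd ℂ) (dzbar (hopf Y E) w)) := by
      have e := dz_const_mul (-1) (d2.fun_mul d3)
      simp only [neg_mul, one_mul] at e
      rw [e, dz_mul d2 d3, dz_conj d2]
    rw [dz_congr h.isOpen (fun x hx => h.dzbar_dz_eq hx) hw,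
      dz_add ((d2.fun_mul d3).fun_neg.fun_smul (h.diff hw h.smooth))
        ((h.diff hw h.smooth_nullN).fun_const_smul (1 / 2 : ℂ)),
      dz_smul (d2.fun_mul d3).fun_neg (h.diff hw h.smooth), this,
      dz_const_smul _ (h.diff hw h.smooth_nullN)]
  have e3 := congrArg (fun v => lor v (nullN Y w))
    (e1.symm.trans ((dzbar_dz_comm h.smooth_dz h.isOpen hw).trans e2))
  rw [h.dz_nullN_eq hw, h.dzbar_normal_eq hw] at e3
  simp only [lor_add_left, lor_smul_left, h.self_nullN hw, h.normal_nullN hw, h.dz_nullN hw,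
    h.dzbar_nullN hw] at e3
  linear_combination 2 * e3

end ConfFrame


/-! ### The invariants `μ̄` and `ρ` and the dual surface -/

/-- The function `μ̄ = -2 k_z̄ / k`. -/
def frameMuBar (Y E : ℂ → Mink) (w : ℂ) : ℂ := -2 * (dzbar (hopf Y E) w * (hopf Y E w)⁻¹)

/-- The function `ρ = μ̄_z - 2 k k̄`. -/
def frameRho (Y E : ℂ → Mink) (w : ℂ) : ℂ :=
  dz (frameMuBar Y E) w - 2 * (hopf Y E w * (starRingEnd ℂ) (hopf Y E w))

/-- The dual surface `Ŷ = ½|μ|² Y + μ̄ Y_z + μ Y_z̄ + N`. -/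
def dualSurface (Y E : ℂ → Mink) (w : ℂ) : Mink :=
  (frameMuBar Y E w * (starRingEnd ℂ) (frameMuBar Y E w) / 2) • Y w
    + frameMuBar Y E w • dz Y w + (starRingEnd ℂ) (frameMuBar Y E w) • dzbar Y w + nullN Y w

namespace ConfFrame

variable {U : Set ℂ} {Y E : ℂ → Mink} (h : ConfFrame U Y E)
  (hk : ∀ w ∈ U, hopf Y E w ≠ 0)

include h hk

theorem smooth_muBar : ContDiffOn ℝ ∞ (frameMuBar Y E) U :=
  contDiffOn_const.mul (h.smooth_dzbar_hopf.mul (h.smooth_hopf.inv hk))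

theorem smooth_rho : ContDiffOn ℝ ∞ (frameRho Y E) U :=
  (contDiffOn_dz (h.smooth_muBar hk) h.isOpen).sub
    (contDiffOn_const.mul (h.smooth_hopf.mul (contDiffOn_conj h.smooth_hopf)))

variable {w : ℂ} (hw : w ∈ U)

omit h in
include hw in
theorem dzbar_hopf_eq : dzbar (hopf Y E) w = -(1 / 2) * (frameMuBar Y E w * hopf Y E w) := by
  have := hk w hw
  rw [frameMuBar]
  field_simp

omit h hk in
theorem dz_muBar : dz (frameMuBar Y E) w
    = frameRho Y E w + 2 * (hopf Y E w * (starRingEnd ℂ) (hopf Y E w)) := by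
  rw [frameRho]; ring

include hw

theorem dzbar_mu : dzbar (fun x => (starRingEnd ℂ) (frameMuBar Y E x)) w
    = (starRingEnd ℂ) (frameRho Y E w) + 2 * (hopf Y E w * (starRingEnd ℂ) (hopf Y E w)) := by
  rw [dzbar_conj (h.diff hw (h.smooth_muBar hk)), dz_muBar]
  simp [conj_ofNat]; ring

/-- A real light-like vector lying in all mean curvature spheres is a multiple of the dual
surface. -/
theorem lor_dzbar_of_normal {c : Mink} (hE : ∀ w ∈ U, lor c (E w) = 0) :
    lor c (dzbar Y w) = -(1 / 2) * (frameMuBar Y E w * lor c (Y w)) := by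
  -- Differentiating ⟨c, E⟩ = 0 gives k⟨c, Y_z̄⟩ = k_z̄⟨c, Y⟩, and k can be divided out.
  have h1 := lor_dz_of_const h.isOpen contDiffOn_const h.smooth_normal hE hw
  rw [dz_const, lor_zero_left, h.dz_normal_eq hw, lor_add_right, lor_smul_right, lor_smul_right,
    dzbar_hopf_eq hk hw] at h1
  have hk' := hk w hw
  have : hopf Y E w * (lor c (dzbar Y w) + (1 / 2) * (frameMuBar Y E w * lor c (Y w))) = 0 := by
    linear_combination (-1 / 2) * h1
  linear_combination (mul_eq_zero.1 this).resolve_left hk'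

theorem lor_dz_of_normal {c : Mink} (hE : ∀ w ∈ U, lor c (E w) = 0) (hc : conjM c = c) :
    lor c (dz Y w) = -(1 / 2) * ((starRingEnd ℂ) (frameMuBar Y E w) * lor c (Y w)) := by
  rw [← hc, ← h.conj_dzbar hw, lor_conjM, h.lor_dzbar_of_normal hk hw hE]
  conv_rhs => rw [← h.real w hw, lor_conjM]
  simp [conj_ofNat]

/-- With the other products known, ⟨c, c⟩ = 0 written in the frame is linear in ⟨c, N⟩, with leading
coefficient a multiple of ⟨c, Y⟩. -/
theorem lor_nullN_of_normal {c : Mink} (hE : ∀ w ∈ U, lor c (E w) = 0) (hc : conjM c = c)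
    (hcc : lor c c = 0) (hcY : lor c (Y w) ≠ 0) :
    lor c (nullN Y w)
      = frameMuBar Y E w * (starRingEnd ℂ) (frameMuBar Y E w) / 2 * lor c (Y w) := by
  have e := congrArg (lor c) (h.expand hw c)
  simp only [lor_add_right, lor_smul_right, hE w hw, hcc, h.lor_dzbar_of_normal hk hw hE,
    h.lor_dz_of_normal hk hw hE hc] at e
  have : lor c (Y w) * (lor c (nullN Y w)
      - frameMuBar Y E w * (starRingEnd ℂ) (frameMuBar Y E w) / 2 * lor c (Y w)) = 0 := by
    linear_combination (1 / 2) * e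
  linear_combination (mul_eq_zero.1 this).resolve_left hcY

/-- All products of c with the frame are multiples of ⟨c, Y⟩, so c is determined up to scale. This
is the source of the uniqueness of the pole. -/
theorem eq_dualSurface {c : Mink} (hE : ∀ w ∈ U, lor c (E w) = 0) (hc : conjM c = c)
    (hcc : lor c c = 0) (hcY : lor c (Y w) ≠ 0) :
    c = (-lor c (Y w)) • dualSurface Y E w := by
  conv_lhs => rw [h.expand hw c]
  rw [h.lor_dzbar_of_normal hk hw hE, h.lor_dz_of_normal hk hw hE hc,
    h.lor_nullN_of_normal hk hw hE hc hcc hcY, hE w hw, dualSurface]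
  module

/-- There are two ways to compute ⟨c, Y_zz̄⟩: differentiate ⟨c, Y_z̄⟩ = -½μ̄⟨c, Y⟩ in z, or pair c
with the structure equation for Y_zz̄. The results differ by a multiple of ρ⟨c, Y⟩. -/
theorem rho_eq_zero_of_normal {c : Mink} (hE : ∀ w ∈ U, lor c (E w) = 0) (hc : conjM c = c)
    (hcc : lor c c = 0) (hcY : lor c (Y w) ≠ 0) : frameRho Y E w = 0 := by
  have sY : ContDiffOn ℝ ∞ (fun x => lor c (Y x)) U := contDiffOn_lor contDiffOn_const h.smooth
  have dm := h.diff hw (h.smooth_muBar hk)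
  have e1 : lor c (dz (dzbar Y) w) = dz (fun x => lor c (dzbar Y x)) w := by
    rw [dz_lor (differentiableAt_const _) (h.diff hw h.smooth_dzbar), dz_const, lor_zero_left,
      zero_add]
  rw [dz_congr h.isOpen (fun x hx => h.lor_dzbar_of_normal hk hx hE) hw,
    dz_const_mul _ (dm.fun_mul (h.diff hw sY)), dz_mul dm (h.diff hw sY),
    dz_lor (differentiableAt_const _) (h.diff hw h.smooth), dz_const, lor_zero_left, zero_add,
    h.lor_dz_of_normal hk hw hE hc, ← dzbar_dz_comm h.smooth h.isOpen hw] at e1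
  have e2 := congrArg (lor c) (h.dzbar_dz_eq hw)
  rw [lor_add_right, lor_smul_right, lor_smul_right,
    h.lor_nullN_of_normal hk hw hE hc hcc hcY, e1] at e2
  have : lor c (Y w) * frameRho Y E w = 0 := by
    rw [frameRho]
    linear_combination (-2) * e2
  exact (mul_eq_zero.1 this).resolve_left hcY

/-! Consequences of the Willmore equation `k_z̄z̄ + (s̄ / 2) k = 0`. -/

/-- Inserting k_z̄ = -½μ̄k twice turns the Willmore equation into (k/2)(s̄ - μ̄_z̄ + ½μ̄²) = 0, and
k is invertible. -/
theorem schwarz_eq_of_willmore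
    (hW : dzbar (dzbar (hopf Y E)) w + (starRingEnd ℂ) (schwarz Y w) / 2 * hopf Y E w = 0) :
    schwarz Y w = dz (fun x => (starRingEnd ℂ) (frameMuBar Y E x)) w
      - (starRingEnd ℂ) (frameMuBar Y E w) ^ 2 / 2 := by
  have dm := h.diff hw (h.smooth_muBar hk)
  have dk := h.diff hw h.smooth_hopf
  rw [dzbar_congr h.isOpen (fun x hx => dzbar_hopf_eq hk hx) hw,
    dzbar_const_mul _ (dm.fun_mul dk), dzbar_mul dm dk, dzbar_hopf_eq hk hw] at hW
  have e : hopf Y E w * ((starRingEnd ℂ) (schwarz Y w)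
      - (dzbar (frameMuBar Y E) w - frameMuBar Y E w ^ 2 / 2)) = 0 := by
    linear_combination 2 * hW
  have e' := (mul_eq_zero.1 e).resolve_left (hk w hw)
  have e'' := congrArg (starRingEnd ℂ) e'
  rw [dz_conj dm]
  simp only [map_sub, map_div₀, map_pow, map_ofNat, conj_conj, map_zero] at e''
  linear_combination e''

omit hw in
-- Differentiate s = μ_z - ½μ² in z̄, with s_z̄ from the Gauss equation and μ_z̄ = ρ̄ + 2|k|². The
-- terms in k_z cancel, and those in k k̄_z cancel against μ|k|² because k̄_z = -½μk̄.
theorem dz_conj_rho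
    (hW : ∀ w ∈ U,
      dzbar (dzbar (hopf Y E)) w + (starRingEnd ℂ) (schwarz Y w) / 2 * hopf Y E w = 0)
    (hw : w ∈ U) :
    dz (fun x => (starRingEnd ℂ) (frameRho Y E x)) w
      = (starRingEnd ℂ) (frameMuBar Y E w) * (starRingEnd ℂ) (frameRho Y E w) := by
  have sm := contDiffOn_conj (h.smooth_muBar hk)
  have sr := contDiffOn_conj (h.smooth_rho hk)
  have dm := h.diff hw sm
  have dk := h.diff hw h.smooth_hopf
  have dk' := h.diff hw (contDiffOn_conj h.smooth_hopf)
  have e1 := dzbar_congr h.isOpen (fun x hx => h.schwarz_eq_of_willmore hk hx (hW x hx)) hw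
  have e2 : dzbar (fun x => dz (fun x => (starRingEnd ℂ) (frameMuBar Y E x)) x
      - (starRingEnd ℂ) (frameMuBar Y E x) ^ 2 / 2) w
      = dzbar (dz (fun x => (starRingEnd ℂ) (frameMuBar Y E x))) w
        - (starRingEnd ℂ) (frameMuBar Y E w)
          * dzbar (fun x => (starRingEnd ℂ) (frameMuBar Y E x)) w := by
    have : (fun x => dz (fun x => (starRingEnd ℂ) (frameMuBar Y E x)) x
        - (starRingEnd ℂ) (frameMuBar Y E x) ^ 2 / 2)
        = fun x => dz (fun x => (starRingEnd ℂ) (frameMuBar Y E x)) x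
        + (-(1 / 2)) * ((starRingEnd ℂ) (frameMuBar Y E x) * (starRingEnd ℂ) (frameMuBar Y E x)) := by
      funext x; ring
    rw [this, dzbar_add (h.diff hw (contDiffOn_dz sm h.isOpen)) ((dm.fun_mul dm).const_mul _),
      dzbar_const_mul _ (dm.fun_mul dm), dzbar_mul dm dm]
    ring
  have e3 : dz (dzbar (fun x => (starRingEnd ℂ) (frameMuBar Y E x))) w
      = dz (fun x => (starRingEnd ℂ) (frameRho Y E x)) w
        + 2 * (dz (hopf Y E) w * (starRingEnd ℂ) (hopf Y E w)
          + hopf Y E w * (starRingEnd ℂ) (dzbar (hopf Y E) w)) := by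
    rw [dz_congr h.isOpen (fun x hx => h.dzbar_mu hk hx) hw,
      dz_add (h.diff hw sr) ((dk.fun_mul dk').const_mul _), dz_const_mul _ (dk.fun_mul dk'),
      dz_mul dk dk', dz_conj dk]
  rw [e2, h.gauss hw, dzbar_dz_comm sm h.isOpen hw, e3, h.dzbar_mu hk hw,
    dzbar_hopf_eq hk hw] at e1
  simp only [map_mul, map_neg, map_div₀, map_one, map_ofNat] at e1
  linear_combination -e1

/-- If the Möbius curvature is constantly `1`, i.e. if `ρ` is purely imaginary, then `ρ = 0`. -/
theorem rho_eq_zero_of_imaginary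
    (hW : ∀ w ∈ U,
      dzbar (dzbar (hopf Y E)) w + (starRingEnd ℂ) (schwarz Y w) / 2 * hopf Y E w = 0)
    (hI : ∀ w ∈ U, (starRingEnd ℂ) (frameRho Y E w) = -frameRho Y E w) :
    frameRho Y E w = 0 := by
  have sm := contDiffOn_conj (h.smooth_muBar hk)
  have sr := h.smooth_rho hk
  have e1 : ∀ x ∈ U, dz (frameRho Y E) x
      = (starRingEnd ℂ) (frameMuBar Y E x) * frameRho Y E x := by
    intro x hx
    have e := h.dz_conj_rho hk hW hx
    have e' : dz (fun x => -frameRho Y E x) x = -dz (frameRho Y E) x := by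
      simpa using dz_const_mul (-1) (h.diff hx sr)
    rw [dz_congr h.isOpen hI hx, hI x hx, e'] at e
    linear_combination -e
  have e2 : ∀ x ∈ U, dzbar (frameRho Y E) x = frameMuBar Y E x * frameRho Y E x := by
    intro x hx
    have e := congrArg (starRingEnd ℂ) (h.dz_conj_rho hk hW hx)
    rw [dz_conj (h.diff hx sr)] at e
    simpa using e
  -- Equality of the mixed derivatives of ρ reads μ_z̄ρ = (μ̄)_zρ, and the two factors differ by ρ̄
  -- - ρ = -2ρ.
  have e3 := dzbar_congr h.isOpen e1 hw
  have e4 := dz_congr h.isOpen e2 hw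
  rw [dzbar_mul (h.diff hw sm) (h.diff hw sr), h.dzbar_mu hk hw, e2 w hw, hI w hw] at e3
  rw [dz_mul (h.diff hw (h.smooth_muBar hk)) (h.diff hw sr), dz_muBar, e1 w hw] at e4
  have e5 := dzbar_dz_comm sr h.isOpen hw
  rw [e3, e4] at e5
  have : frameRho Y E w ^ 2 = 0 := by linear_combination (-1 / 2) * e5
  exact pow_eq_zero_iff (two_ne_zero) |>.1 this

/-- If `ρ = 0`, the dual surface of a Willmore surface is stationary. -/
theorem dz_dualSurface
    (hW : dzbar (dzbar (hopf Y E)) w + (starRingEnd ℂ) (schwarz Y w) / 2 * hopf Y E w = 0)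
    (hρ : frameRho Y E w = 0) :
    dz (dualSurface Y E) w = ((starRingEnd ℂ) (frameMuBar Y E w) / 2) • dualSurface Y E w := by
  have dm := h.diff hw (h.smooth_muBar hk)
  have dm' := h.diff hw (contDiffOn_conj (h.smooth_muBar hk))
  have dY := h.diff hw h.smooth
  have d1 := h.diff hw h.smooth_dz
  have d2 := h.diff hw h.smooth_dzbar
  have dN := h.diff hw h.smooth_nullN
  have hfun : dualSurface Y E = fun x =>
      ((1 / 2 * (frameMuBar Y E x * (starRingEnd ℂ) (frameMuBar Y E x))) • Y x
        + frameMuBar Y E x • dz Y x) + ((starRingEnd ℂ) (frameMuBar Y E x) • dzbar Y x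
        + nullN Y x) := by
    funext x
    rw [dualSurface]
    module
  have dmm : DifferentiableAt ℝ
      (fun x => (1 / 2 : ℂ) * (frameMuBar Y E x * (starRingEnd ℂ) (frameMuBar Y E x))) w :=
    (dm.fun_mul dm').const_mul _
  have hs := h.schwarz_eq_of_willmore hk hw hW
  -- In the frame, the E-component of Ŷ_z is μ̄k + 2k_z̄ = 0 and the N-component is μ/2. The
  -- Y_z̄-component μ_z - s equals ½μ² by the Willmore equation, and ρ enters only the Y_z- and
  -- Y-components.
  rw [congrArg (fun F => dz F w) hfun,
    dz_add ((dmm.fun_smul dY).fun_add (dm.fun_smul d1)) ((dm'.fun_smul d2).fun_add dN),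
    dz_add (dmm.fun_smul dY) (dm.fun_smul d1), dz_add (dm'.fun_smul d2) dN,
    dz_smul dmm dY, dz_smul dm d1, dz_smul dm' d2, dz_const_mul _ (dm.fun_mul dm'),
    dz_mul dm dm', h.dz_nullN_eq hw, h.dz_dz_eq hw, ← dzbar_dz_comm h.smooth h.isOpen hw,
    h.dzbar_dz_eq hw, dzbar_hopf_eq hk hw, dz_muBar, hρ,
    show dz (fun x => (starRingEnd ℂ) (frameMuBar Y E x)) w = schwarz Y w
      + (starRingEnd ℂ) (frameMuBar Y E w) ^ 2 / 2 by linear_combination -hs, dualSurface]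
  module

omit hk in
theorem conj_dualSurface : conjM (dualSurface Y E w) = dualSurface Y E w := by
  simp only [dualSurface, conjM_add, conjM_smul, h.real w hw, h.conj_dz hw, h.conj_dzbar hw,
    h.conj_nullN hw, map_mul, map_div₀, conj_conj, map_ofNat]
  module

omit hk in
theorem dualSurface_null : lor (dualSurface Y E w) (dualSurface Y E w) = 0 := by
  simp only [dualSurface, lor_add_left, lor_add_right, lor_smul_left, lor_smul_right,
    h.lor_self w hw, h.self_dz hw, h.self_dzbar hw, h.self_nullN hw, h.lor_dz_dz w hw,
    h.lor_dz_dzbar w hw, h.dz_nullN hw, h.dzbar_dzbar hw, h.dzbar_nullN hw, h.nullN_nullN hw,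
    lor_comm (dz Y w) (Y w), lor_comm (dzbar Y w) (Y w), lor_comm (nullN Y w) (Y w),
    lor_comm (dzbar Y w) (dz Y w), lor_comm (nullN Y w) (dz Y w),
    lor_comm (nullN Y w) (dzbar Y w)]
  ring

omit hk in
theorem dualSurface_self : lor (dualSurface Y E w) (Y w) = -1 := by
  simp only [dualSurface, h.lor_self w hw, lor_comm _ (Y w),
    h.self_dz hw, h.self_dzbar hw, h.self_nullN hw, lor_add_right, lor_smul_right]
  ring

omit hk in
theorem dualSurface_normal : lor (dualSurface Y E w) (E w) = 0 := by
  simp only [dualSurface, lor_add_right, lor_smul_right, lor_comm _ (E w), h.normal_self w hw,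
    h.normal_dz w hw, h.normal_dzbar hw, h.normal_nullN hw]
  ring

omit hw in
theorem smooth_dualSurface : ContDiffOn ℝ ∞ (dualSurface Y E) U := by
  have sm := h.smooth_muBar hk
  have sm' := contDiffOn_conj sm
  exact ((((sm.mul sm').div_const 2).smul h.smooth).add (sm.smul h.smooth_dz)).add
    (sm'.smul h.smooth_dzbar) |>.add h.smooth_nullN

end ConfFrame


/-! ### Vectors of `ℝ⁴` in Minkowski space -/

/-- The inclusion `ℝ⁴ → ℝ^{4,1} ⊗ ℂ` as the space-like vectors orthogonal to the time axis. -/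
def embL : EuclideanSpace ℝ (Fin 4) →L[ℝ] Mink :=
  LinearMap.toContinuousLinearMap
    { toFun := fun a => (Fin.cons 0 (fun i : Fin 4 => ((a i : ℝ) : ℂ)) : Mink)
      map_add' := fun a b => by
        funext i
        refine Fin.cases ?_ (fun j => ?_) i <;> simp
      map_smul' := fun c a => by
        funext i
        refine Fin.cases ?_ (fun j => ?_) i <;> simp }

/-- The light-like vector `(1, a)`. -/
def lightVec (a : EuclideanSpace ℝ (Fin 4)) : Mink :=
  Fin.cons (1 : ℂ) (fun i : Fin 4 => ((a i : ℝ) : ℂ))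

theorem embL_zero_coord (a : EuclideanSpace ℝ (Fin 4)) : embL a 0 = 0 := rfl

theorem embL_succ (a : EuclideanSpace ℝ (Fin 4)) (i : Fin 4) : embL a i.succ = (a i : ℂ) := rfl

theorem lightVec_zero_coord (a : EuclideanSpace ℝ (Fin 4)) : lightVec a 0 = 1 := rfl

theorem lightVec_succ (a : EuclideanSpace ℝ (Fin 4)) (i : Fin 4) :
    lightVec a i.succ = (a i : ℂ) := rfl

theorem lightVec_eq (a : EuclideanSpace ℝ (Fin 4)) : lightVec a = lightVec 0 + embL a := by
  funext i
  refine Fin.cases ?_ (fun j => ?_) i <;>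
    simp [lightVec_zero_coord, embL_zero_coord, lightVec_succ, embL_succ]

theorem lor_embL_embL (a b : EuclideanSpace ℝ (Fin 4)) :
    lor (embL a) (embL b) = ((inner ℝ a b : ℝ) : ℂ) := by
  simp only [lor, embL_zero_coord, embL_succ, PiLp.inner_apply]
  push_cast
  simp [mul_comm]

theorem lor_lightVec_embL (a b : EuclideanSpace ℝ (Fin 4)) :
    lor (lightVec a) (embL b) = ((inner ℝ a b : ℝ) : ℂ) := by
  simp only [lor, embL_zero_coord, embL_succ, lightVec_succ, PiLp.inner_apply]
  push_cast
  simp [mul_comm]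

theorem lor_lightVec_lightVec (a b : EuclideanSpace ℝ (Fin 4)) :
    lor (lightVec a) (lightVec b) = ((inner ℝ a b : ℝ) : ℂ) - 1 := by
  simp only [lor, lightVec_zero_coord, lightVec_succ, PiLp.inner_apply]
  push_cast
  simp [mul_comm]
  ring

theorem conjM_embL (a : EuclideanSpace ℝ (Fin 4)) : conjM (embL a) = embL a := by
  funext i
  refine Fin.cases ?_ (fun j => ?_) i <;> simp [conjM, embL_zero_coord, embL_succ]

theorem conjM_lightVec (a : EuclideanSpace ℝ (Fin 4)) : conjM (lightVec a) = lightVec a := by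
  funext i
  refine Fin.cases ?_ (fun j => ?_) i <;> simp [conjM, lightVec_zero_coord, lightVec_succ]

theorem contDiff_lightVec : ContDiff ℝ ∞ lightVec := by
  have : lightVec = fun a => lightVec 0 + embL a := funext lightVec_eq
  rw [this]
  exact contDiff_const.add embL.contDiff

theorem fderiv_embL_comp {g : ℂ → EuclideanSpace ℝ (Fin 4)} {w : ℂ}
    (hg : DifferentiableAt ℝ g w) (v : ℂ) :
    fderiv ℝ (fun x => embL (g x)) w v = embL (fderiv ℝ g w v) := by
  have : HasFDerivAt (fun x => embL (g x)) (embL.comp (fderiv ℝ g w)) w :=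
    embL.hasFDerivAt.comp w hg.hasFDerivAt
  rw [this.fderiv]
  rfl

theorem fderiv_lightVec_comp {g : ℂ → EuclideanSpace ℝ (Fin 4)} {w : ℂ}
    (hg : DifferentiableAt ℝ g w) (v : ℂ) :
    fderiv ℝ (fun x => lightVec (g x)) w v = embL (fderiv ℝ g w v) := by
  have : (fun x => lightVec (g x)) = fun x => lightVec 0 + embL (g x) :=
    funext fun x => lightVec_eq _
  rw [this, fderiv_const_add, fderiv_embL_comp hg]

/-! ### The cross product of `ℝ⁴` and the normal of a surface in the 3-sphere -/

/-- The cross product of three vectors of `ℝ⁴`. -/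
def cross (a b c : EuclideanSpace ℝ (Fin 4)) : EuclideanSpace ℝ (Fin 4) :=
  WithLp.toLp 2
    ![-(a 1 * (b 2 * c 3 - b 3 * c 2) - a 2 * (b 1 * c 3 - b 3 * c 1)
        + a 3 * (b 1 * c 2 - b 2 * c 1)),
      a 0 * (b 2 * c 3 - b 3 * c 2) - a 2 * (b 0 * c 3 - b 3 * c 0)
        + a 3 * (b 0 * c 2 - b 2 * c 0),
      -(a 0 * (b 1 * c 3 - b 3 * c 1) - a 1 * (b 0 * c 3 - b 3 * c 0)
        + a 3 * (b 0 * c 1 - b 1 * c 0)),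
      a 0 * (b 1 * c 2 - b 2 * c 1) - a 1 * (b 0 * c 2 - b 2 * c 0)
        + a 2 * (b 0 * c 1 - b 1 * c 0)]

theorem inner_eq_sum_four (a b : EuclideanSpace ℝ (Fin 4)) :
    inner ℝ a b = a 0 * b 0 + a 1 * b 1 + a 2 * b 2 + a 3 * b 3 := by
  simp [PiLp.inner_apply, Fin.sum_univ_four, mul_comm]

theorem det_eq_inner_cross (a b c d : EuclideanSpace ℝ (Fin 4)) :
    Matrix.det (fun i j : Fin 4 => (![a, b, c, d] i) j) = inner ℝ (cross a b c) d := by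
  change Matrix.det (Matrix.of fun i j : Fin 4 => (![a, b, c, d] i) j) = _
  rw [Matrix.det_succ_row_zero, inner_eq_sum_four]
  simp [Matrix.det_fin_three, Fin.sum_univ_succ, cross, Fin.succAbove, Matrix.submatrix]
  ring

theorem inner_cross_first (a b c : EuclideanSpace ℝ (Fin 4)) : inner ℝ (cross a b c) a = 0 := by
  simp [inner_eq_sum_four, cross]; ring

theorem inner_cross_second (a b c : EuclideanSpace ℝ (Fin 4)) : inner ℝ (cross a b c) b = 0 := by
  simp [inner_eq_sum_four, cross]; ring

theorem inner_cross_third (a b c : EuclideanSpace ℝ (Fin 4)) : inner ℝ (cross a b c) c = 0 := by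
  simp [inner_eq_sum_four, cross]; ring

/-- This is the Gram determinant of the three vectors. For f, f_u, f_v with f on the sphere it
reduces to EG - F², which is why `unitNormal` has length one. -/
theorem inner_cross_cross (a b c : EuclideanSpace ℝ (Fin 4)) :
    inner ℝ (cross a b c) (cross a b c)
      = inner ℝ a a * (inner ℝ b b * inner ℝ c c - inner ℝ b c ^ 2)
        - inner ℝ a b * (inner ℝ a b * inner ℝ c c - inner ℝ b c * inner ℝ a c)
        + inner ℝ a c * (inner ℝ a b * inner ℝ b c - inner ℝ b b * inner ℝ a c) := by
  simp only [inner_eq_sum_four, cross, Matrix.cons_val]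
  ring

theorem contDiff_cross : ContDiff ℝ ∞
    (fun p : EuclideanSpace ℝ (Fin 4) × EuclideanSpace ℝ (Fin 4) × EuclideanSpace ℝ (Fin 4) =>
      cross p.1 p.2.1 p.2.2) := by
  rw [contDiff_euclidean]
  intro i
  fin_cases i <;> simp [cross] <;> fun_prop

/-- The unit normal, inside the 3-sphere, of a surface in the 3-sphere. -/
def unitNormal (f : ℂ → EuclideanSpace ℝ (Fin 4)) (w : ℂ) : EuclideanSpace ℝ (Fin 4) :=
  (areaDensity f w)⁻¹ • cross (f w) (pu f w) (pv f w)

theorem pairNormalS3_eq (f : ℂ → EuclideanSpace ℝ (Fin 4)) (w : ℂ)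
    (a : EuclideanSpace ℝ (Fin 4)) : pairNormalS3 f w a = inner ℝ (unitNormal f w) a := by
  rw [pairNormalS3, det_eq_inner_cross, unitNormal, inner_smul_left]
  simp [div_eq_inv_mul]

theorem inner_unitNormal_self (f : ℂ → EuclideanSpace ℝ (Fin 4)) (w : ℂ) :
    inner ℝ (unitNormal f w) (f w) = 0 := by
  rw [unitNormal, inner_smul_left, inner_cross_first, mul_zero]

theorem inner_unitNormal_pu (f : ℂ → EuclideanSpace ℝ (Fin 4)) (w : ℂ) :
    inner ℝ (unitNormal f w) (pu f w) = 0 := by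
  rw [unitNormal, inner_smul_left, inner_cross_second, mul_zero]

theorem inner_unitNormal_pv (f : ℂ → EuclideanSpace ℝ (Fin 4)) (w : ℂ) :
    inner ℝ (unitNormal f w) (pv f w) = 0 := by
  rw [unitNormal, inner_smul_left, inner_cross_third, mul_zero]

/-- A smooth surface patch in `ℝ⁴`, not necessarily immersed. -/
structure SmoothPatch (U : Set ℂ) (f : ℂ → EuclideanSpace ℝ (Fin 4)) : Prop where
  isOpen : IsOpen U
  smooth : ContDiffOn ℝ ∞ f U

namespace SmoothPatch

variable {U : Set ℂ} {f : ℂ → EuclideanSpace ℝ (Fin 4)} (h : SmoothPatch U f)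

include h

theorem smooth_pu : ContDiffOn ℝ ∞ (pu f) U := h.smooth.fderiv_apply_const h.isOpen 1

theorem smooth_pv : ContDiffOn ℝ ∞ (pv f) U := h.smooth.fderiv_apply_const h.isOpen I

variable {w : ℂ} (hw : w ∈ U)

include hw

theorem diff {V : Type*} [NormedAddCommGroup V] [NormedSpace ℝ V] {g : ℂ → V}
    (hg : ContDiffOn ℝ ∞ g U) : DifferentiableAt ℝ g w := hg.differentiableAt_of_isOpen h.isOpen hw

/-- The first derivatives of the light cone lift `(1, f)`. -/
theorem dz_lightVec : dz (fun x => lightVec (f x)) w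
    = (1 / 2 : ℂ) • (embL (pu f w) - I • embL (pv f w)) := by
  simp only [dz, fderiv_lightVec_comp (h.diff hw h.smooth), pu, pv]

theorem dzbar_lightVec : dzbar (fun x => lightVec (f x)) w
    = (1 / 2 : ℂ) • (embL (pu f w) + I • embL (pv f w)) := by
  simp only [dzbar, fderiv_lightVec_comp (h.diff hw h.smooth), pu, pv]

omit hw in
theorem smooth_lightVec : ContDiffOn ℝ ∞ (fun x => lightVec (f x)) U :=
  contDiff_lightVec.comp_contDiffOn h.smooth

omit h hw in
theorem smooth_embL {g : ℂ → EuclideanSpace ℝ (Fin 4)} (hg : ContDiffOn ℝ ∞ g U) :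
    ContDiffOn ℝ ∞ (fun x => embL (g x)) U :=
  embL.contDiff.comp_contDiffOn hg

theorem fderiv_dz_lightVec (v : ℂ) : fderiv ℝ (dz (fun x => lightVec (f x))) w v
    = (1 / 2 : ℂ) • (embL (fderiv ℝ (pu f) w v) - I • embL (fderiv ℝ (pv f) w v)) := by
  have du := h.diff hw (smooth_embL h.smooth_pu)
  have dv := h.diff hw (smooth_embL h.smooth_pv)
  rw [fderiv_congr_of_isOpen h.isOpen (fun x hx => h.dz_lightVec hx) hw,
    ((du.hasFDerivAt.fun_sub (dv.hasFDerivAt.fun_const_smul I)).fun_const_smul (1 / 2 : ℂ)).fderiv]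
  simp only [smul_apply, sub_apply, fderiv_embL_comp (h.diff hw h.smooth_pu),
    fderiv_embL_comp (h.diff hw h.smooth_pv)]

theorem pu_pv : pu (pv f) w = pv (pu f) w :=
  fderiv_comm_of_isOpen h.smooth h.isOpen hw I 1

theorem dz_dz_lightVec : dz (dz (fun x => lightVec (f x))) w
    = (1 / 4 : ℂ) • (embL (pu (pu f) w) - (2 * I) • embL (pv (pu f) w)
        - embL (pv (pv f) w)) := by
  have e := h.pu_pv hw
  conv_lhs => rw [dz]
  rw [h.fderiv_dz_lightVec hw, h.fderiv_dz_lightVec hw]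
  simp only [pu, pv] at e ⊢
  rw [e]
  have hI : I * I = -1 := I_mul_I
  simp only [smul_sub, smul_smul]
  rw [show I * (1 / 2 * I) = -(1 / 2) by linear_combination (1 / 2) * hI]
  module

theorem dzbar_dz_lightVec : dzbar (dz (fun x => lightVec (f x))) w
    = (1 / 4 : ℂ) • (embL (pu (pu f) w) + embL (pv (pv f) w)) := by
  have e := h.pu_pv hw
  conv_lhs => rw [dzbar]
  rw [h.fderiv_dz_lightVec hw, h.fderiv_dz_lightVec hw]
  simp only [pu, pv] at e ⊢
  rw [e]
  have hI : I * I = -1 := I_mul_I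
  simp only [smul_sub, smul_add, smul_smul]
  rw [show 1 / 2 * (I * (1 / 2 * I)) = -(1 / 4) by linear_combination (1 / 4) * hI]
  module

theorem lor_dz_lightVec_dz : lor (dz (fun x => lightVec (f x)) w) (dz (fun x => lightVec (f x)) w)
    = (1 / 4) * (coeffE f w - coeffG f w - 2 * I * coeffF f w) := by
  rw [h.dz_lightVec hw]
  simp only [lor_smul_left, lor_smul_right, lor_sub_left, lor_sub_right, lor_embL_embL, coeffE,
    coeffF, coeffG, real_inner_comm (pu f w) (pv f w)]
  linear_combination (1 / 4) * ((inner ℝ (pv f w) (pv f w) : ℝ) : ℂ) * I_mul_I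

theorem lor_dz_lightVec_dzbar :
    lor (dz (fun x => lightVec (f x)) w) (dzbar (fun x => lightVec (f x)) w)
    = (1 / 4) * (coeffE f w + coeffG f w) := by
  rw [h.dz_lightVec hw, h.dzbar_lightVec hw]
  simp only [lor_smul_left, lor_smul_right, lor_sub_left, lor_add_right, lor_embL_embL, coeffE,
    coeffG, real_inner_comm (pu f w) (pv f w)]
  linear_combination -(1 / 4) * ((inner ℝ (pv f w) (pv f w) : ℝ) : ℂ) * I_mul_I

end SmoothPatch

/-- A surface patch in the unit sphere, not necessarily immersed. -/
structure SpherePatch (U : Set ℂ) (f : ℂ → EuclideanSpace ℝ (Fin 4)) : Prop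
    extends SmoothPatch U f where
  norm_eq : ∀ w ∈ U, ‖f w‖ = 1

namespace SpherePatch

variable {U : Set ℂ} {f : ℂ → EuclideanSpace ℝ (Fin 4)} (h : SpherePatch U f)

include h

variable {w : ℂ} (hw : w ∈ U)

include hw

theorem inner_self : inner ℝ (f w) (f w) = (1 : ℝ) := by
  rw [real_inner_self_eq_norm_sq, h.norm_eq w hw, one_pow]

omit h in
theorem inner_fderiv_of_const (hU : IsOpen U) {a b : ℂ → EuclideanSpace ℝ (Fin 4)}
    (ha : ContDiffOn ℝ ∞ a U) (hb : ContDiffOn ℝ ∞ b U) {r : ℂ → ℝ}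
    (hr : ∀ w ∈ U, inner ℝ (a w) (b w) = r w) (v : ℂ) :
    inner ℝ (a w) (fderiv ℝ b w v) + inner ℝ (fderiv ℝ a w v) (b w) = fderiv ℝ r w v := by
  rw [← fderiv_congr_of_isOpen hU hr hw,
    fderiv_inner_apply ℝ (ha.differentiableAt_of_isOpen hU hw)
      (hb.differentiableAt_of_isOpen hU hw)]

theorem inner_pu : inner ℝ (f w) (pu f w) = (0 : ℝ) := by
  have := inner_fderiv_of_const hw h.isOpen h.smooth h.smooth (fun x hx => h.inner_self hx) 1
  rw [real_inner_comm (f w), fderiv_fun_const] at this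
  simp only [Pi.zero_apply, zero_apply] at this
  rw [pu]; linarith

theorem inner_pv : inner ℝ (f w) (pv f w) = (0 : ℝ) := by
  have := inner_fderiv_of_const hw h.isOpen h.smooth h.smooth (fun x hx => h.inner_self hx) I
  rw [real_inner_comm (f w), fderiv_fun_const] at this
  simp only [Pi.zero_apply, zero_apply] at this
  rw [pv]; linarith

theorem inner_unitNormal_unitNormal (hΔ : 0 < coeffE f w * coeffG f w - coeffF f w ^ 2) :
    inner ℝ (unitNormal f w) (unitNormal f w) = (1 : ℝ) := by
  have hs : areaDensity f w ^ 2 = coeffE f w * coeffG f w - coeffF f w ^ 2 :=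
    Real.sq_sqrt hΔ.le
  have hs0 : areaDensity f w ≠ 0 := (Real.sqrt_pos.2 hΔ).ne'
  rw [unitNormal, inner_smul_left, inner_smul_right, inner_cross_cross, h.inner_self hw,
    h.inner_pu hw, h.inner_pv hw]
  simp only [coeffE, coeffF, coeffG] at hs
  simp only [conj_trivial]
  field_simp
  linarith

theorem lightVec_self : lor (lightVec (f w)) (lightVec (f w)) = 0 := by
  rw [lor_lightVec_lightVec, h.inner_self hw]; simp

theorem lightVec_dz : lor (lightVec (f w)) (dz (fun x => lightVec (f x)) w) = 0 := by
  rw [h.dz_lightVec hw, lor_smul_right, lor_sub_right, lor_smul_right, lor_lightVec_embL,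
    lor_lightVec_embL, h.inner_pu hw, h.inner_pv hw]
  simp

theorem lightVec_dzbar : lor (lightVec (f w)) (dzbar (fun x => lightVec (f x)) w) = 0 := by
  rw [h.dzbar_lightVec hw, lor_smul_right, lor_add_right, lor_smul_right, lor_lightVec_embL,
    lor_lightVec_embL, h.inner_pu hw, h.inner_pv hw]
  simp

theorem lightVec_dz_dz : lor (lightVec (f w)) (dz (dz (fun x => lightVec (f x))) w)
    = -(1 / 4) * (coeffE f w - coeffG f w - 2 * I * coeffF f w) := by
  have := lor_dz_of_const h.isOpen h.smooth_lightVec (contDiffOn_dz h.smooth_lightVec h.isOpen)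
    (fun x hx => h.lightVec_dz hx) hw
  rw [h.lor_dz_lightVec_dz hw] at this
  linear_combination this

theorem lightVec_dzbar_dz : lor (lightVec (f w)) (dzbar (dz (fun x => lightVec (f x))) w)
    = -(1 / 4) * (coeffE f w + coeffG f w) := by
  have := lor_dzbar_of_const h.isOpen h.smooth_lightVec (contDiffOn_dz h.smooth_lightVec h.isOpen)
    (fun x hx => h.lightVec_dz hx) hw
  rw [lor_comm, h.lor_dz_lightVec_dzbar hw] at this
  linear_combination this

/-! Products of the derivatives of a general lift `X = l (1, f)`. -/

variable {l : ℂ → ℂ} (hl : ContDiffOn ℝ ∞ l U)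

include hl

theorem dz_smul_lightVec : dz (fun x => l x • lightVec (f x)) w
    = dz l w • lightVec (f w) + l w • dz (fun x => lightVec (f x)) w :=
  dz_smul (h.diff hw hl) (h.diff hw h.smooth_lightVec)

theorem dzbar_smul_lightVec : dzbar (fun x => l x • lightVec (f x)) w
    = dzbar l w • lightVec (f w) + l w • dzbar (fun x => lightVec (f x)) w :=
  dzbar_smul (h.diff hw hl) (h.diff hw h.smooth_lightVec)

theorem dz_dz_smul_lightVec : dz (dz (fun x => l x • lightVec (f x))) w
    = dz (dz l) w • lightVec (f w) + (2 * dz l w) • dz (fun x => lightVec (f x)) w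
      + l w • dz (dz (fun x => lightVec (f x))) w := by
  have s1 := h.diff hw (contDiffOn_dz hl h.isOpen)
  have s2 := h.diff hw h.smooth_lightVec
  have s3 := h.diff hw (contDiffOn_dz h.smooth_lightVec h.isOpen)
  rw [dz_congr h.isOpen (fun x hx => h.dz_smul_lightVec hx hl) hw,
    dz_add (s1.fun_smul s2) ((h.diff hw hl).fun_smul s3), dz_smul s1 s2,
    dz_smul (h.diff hw hl) s3]
  module

theorem dzbar_dz_smul_lightVec : dzbar (dz (fun x => l x • lightVec (f x))) w
    = dzbar (dz l) w • lightVec (f w) + dz l w • dzbar (fun x => lightVec (f x)) w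
      + dzbar l w • dz (fun x => lightVec (f x)) w
      + l w • dzbar (dz (fun x => lightVec (f x))) w := by
  have s1 := h.diff hw (contDiffOn_dz hl h.isOpen)
  have s2 := h.diff hw h.smooth_lightVec
  have s3 := h.diff hw (contDiffOn_dz h.smooth_lightVec h.isOpen)
  rw [dzbar_congr h.isOpen (fun x hx => h.dz_smul_lightVec hx hl) hw,
    dzbar_add (s1.fun_smul s2) ((h.diff hw hl).fun_smul s3), dzbar_smul s1 s2,
    dzbar_smul (h.diff hw hl) s3]
  module

/-- As (1, f) is null and orthogonal to its first derivatives, the derivatives of l drop out and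
only the factor l² remains. Conformality is not assumed, because variations leave the conformal
class. -/
theorem lor_dz_lift : lor (dz (fun x => l x • lightVec (f x)) w)
    (dz (fun x => l x • lightVec (f x)) w)
    = l w ^ 2 / 4 * (coeffE f w - coeffG f w - 2 * I * coeffF f w) := by
  rw [h.dz_smul_lightVec hw hl]
  simp only [lor_add_left, lor_add_right, lor_smul_left, lor_smul_right, h.lightVec_self hw,
    h.lightVec_dz hw, lor_comm _ (lightVec (f w)), h.lor_dz_lightVec_dz hw]
  ring

theorem lor_dz_dzbar_lift : lor (dz (fun x => l x • lightVec (f x)) w)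
    (dzbar (fun x => l x • lightVec (f x)) w)
    = l w ^ 2 / 4 * (coeffE f w + coeffG f w) := by
  rw [h.dz_smul_lightVec hw hl, h.dzbar_smul_lightVec hw hl]
  simp only [lor_add_left, lor_add_right, lor_smul_left, lor_smul_right, h.lightVec_self hw,
    h.lightVec_dz hw, h.lightVec_dzbar hw, lor_comm _ (lightVec (f w)),
    h.lor_dz_lightVec_dzbar hw]
  ring

variable {n : EuclideanSpace ℝ (Fin 4)} (n0 : inner ℝ n (f w) = (0 : ℝ))
  (n1 : inner ℝ n (pu f w) = (0 : ℝ)) (n2 : inner ℝ n (pv f w) = (0 : ℝ)) (r : ℂ)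

omit h hw hl in
include n0 in
theorem lor_lightVec_normal : lor (embL n) (lightVec (f w)) = 0 := by
  rw [lor_comm, lor_lightVec_embL, real_inner_comm, n0]; simp

omit hl in
include n1 n2 in
theorem lor_dz_lightVec_normal : lor (embL n) (dz (fun x => lightVec (f x)) w) = 0 := by
  rw [h.dz_lightVec hw, lor_smul_right, lor_sub_right, lor_smul_right, lor_embL_embL,
    lor_embL_embL, n1, n2]
  simp

omit hl in
include n1 n2 in
theorem lor_dzbar_lightVec_normal : lor (embL n) (dzbar (fun x => lightVec (f x)) w) = 0 := by
  rw [h.dzbar_lightVec hw, lor_smul_right, lor_add_right, lor_smul_right, lor_embL_embL,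
    lor_embL_embL, n1, n2]
  simp

include n0 n1 n2 in
-- The vectors `embL n + r • lightVec (f w)` are normals of the spheres tangent to the surface at
-- f(w). Passing to another tangent sphere subtracts r times the first fundamental form from the
-- second, and the derivatives of l again drop out.
theorem lor_dz_dz_lift_normal :
    lor (embL n + r • lightVec (f w)) (dz (dz (fun x => l x • lightVec (f x))) w)
    = l w / 4 * (inner ℝ n (pu (pu f) w) - inner ℝ n (pv (pv f) w)
      - 2 * I * inner ℝ n (pv (pu f) w)
      - r * (coeffE f w - coeffG f w - 2 * I * coeffF f w)) := by
  have e : lor (embL n) (dz (dz (fun x => lightVec (f x))) w)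
      = 1 / 4 * (inner ℝ n (pu (pu f) w) - 2 * I * inner ℝ n (pv (pu f) w)
        - inner ℝ n (pv (pv f) w)) := by
    rw [h.dz_dz_lightVec hw]
    simp only [lor_smul_right, lor_sub_right, lor_embL_embL]
  rw [h.dz_dz_smul_lightVec hw hl]
  simp only [lor_add_left, lor_add_right, lor_smul_left, lor_smul_right, h.lightVec_self hw,
    h.lightVec_dz hw, h.lightVec_dz_dz hw, h.lor_dz_lightVec_normal hw n1 n2,
    lor_lightVec_normal n0, e]
  ring

include n0 n1 n2 in
theorem lor_dzbar_dz_lift_normal :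
    lor (embL n + r • lightVec (f w)) (dzbar (dz (fun x => l x • lightVec (f x))) w)
    = l w / 4 * (inner ℝ n (pu (pu f) w) + inner ℝ n (pv (pv f) w)
      - r * (coeffE f w + coeffG f w)) := by
  have e : lor (embL n) (dzbar (dz (fun x => lightVec (f x))) w)
      = 1 / 4 * (inner ℝ n (pu (pu f) w) + inner ℝ n (pv (pv f) w)) := by
    rw [h.dzbar_dz_lightVec hw]
    simp only [lor_smul_right, lor_add_right, lor_embL_embL]
  rw [h.dzbar_dz_smul_lightVec hw hl]
  simp only [lor_add_left, lor_add_right, lor_smul_left, lor_smul_right, h.lightVec_self hw,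
    h.lightVec_dz hw, h.lightVec_dzbar hw, h.lightVec_dzbar_dz hw,
    h.lor_dz_lightVec_normal hw n1 n2, h.lor_dzbar_lightVec_normal hw n1 n2,
    lor_lightVec_normal n0, e]
  ring

end SpherePatch


/-! ### The frozen invariants in terms of the frame -/

namespace ConfFrame

variable {U : Set ℂ} {f : ℂ → EuclideanSpace ℝ (Fin 4)} {E : ℂ → Mink}
  (h : ConfFrame U (lift f) E) {w : ℂ} (hw : w ∈ U)

include h hw

/-- V^⊥ is the line of E: in the frame expansion of A, `normalProj` removes precisely the other four
components. Every invariant built from κ thus becomes an expression in the coefficient k. -/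
theorem normalProj_eq (A : Mink) : normalProj f w A = lor A (E w) • E w := by
  have e := h.expand hw A
  have hN : frameN f w = nullN (lift f) w := rfl
  rw [normalProj, hN]
  nth_rewrite 1 [e]
  module

theorem kappa_eq : kappa f w = hopf (lift f) E w • E w := by
  rw [kappa, h.normalProj_eq hw, hopf]

theorem Dkappa_eq : Dkappa f w = dzbar (hopf (lift f) E) w • E w := by
  rw [Dkappa, h.normalProj_eq hw, dzbar_congr h.isOpen (fun x hx => h.kappa_eq hx) hw,
    dzbar_smul (h.diff hw h.smooth_hopf) (h.diff hw h.smooth_normal), lor_add_left, lor_smul_left,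
    lor_smul_left, h.normal_normal w hw, h.normal_dzbar_normal hw]
  simp

theorem kappaSq_eq : kappaSq f w = normSq (hopf (lift f) E w) := by
  rw [kappaSq, h.kappa_eq hw, conjM_smul, lor_smul_left, lor_smul_right, h.real_normal w hw,
    h.normal_normal w hw, mul_one, mul_conj, ofReal_re]

theorem muBar_eq (hk : hopf (lift f) E w ≠ 0) : muBar f w = frameMuBar (lift f) E w := by
  have hk' : (starRingEnd ℂ) (hopf (lift f) E w) ≠ 0 := by simpa using hk
  rw [muBar, h.Dkappa_eq hw, h.kappa_eq hw, h.kappaSq_eq hw, conjM_smul, lor_smul_left,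
    lor_smul_right, h.real_normal w hw, h.normal_normal w hw, ← mul_conj, frameMuBar]
  field_simp

omit hw

variable (hk : ∀ w ∈ U, hopf (lift f) E w ≠ 0)

include hk hw

theorem rho_eq : rho f w = frameRho (lift f) E w := by
  rw [rho, dz_congr h.isOpen (fun x hx => h.muBar_eq hx (hk x hx)) hw, h.kappaSq_eq hw,
    ← mul_conj, frameRho]

theorem invP_eq_zero_iff : invP f w = 0 ↔ frameRho (lift f) E w = 0 := by
  rw [invP, h.rho_eq hw hk, h.kappaSq_eq hw, div_eq_zero_iff]
  simp [hk w hw]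

omit h hk hw in
theorem _root_.MobiusSurface.wirt_log (ε : ℂ) {r : ℂ → ℝ} {w : ℂ} (hr : DifferentiableAt ℝ r w)
    (hpos : r w ≠ 0) : wirt ε (fun x => ((Real.log (r x) : ℝ) : ℂ)) w
      = wirt ε (fun x => ((r x : ℝ) : ℂ)) w * ((r w : ℝ) : ℂ)⁻¹ := by
  have e1 : HasFDerivAt (fun x => ((Real.log (r x) : ℝ) : ℂ))
      (ofRealCLM.comp ((r w)⁻¹ • fderiv ℝ r w)) w :=
    ofRealCLM.hasFDerivAt.comp w (hr.hasFDerivAt.log hpos)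
  have e2 : HasFDerivAt (fun x => ((r x : ℝ) : ℂ)) (ofRealCLM.comp (fderiv ℝ r w)) w :=
    ofRealCLM.hasFDerivAt.comp w hr.hasFDerivAt
  simp only [wirt, e1.fderiv, e2.fderiv]
  simp
  ring

/-- Formally 2ω = log 4 + log k + log k̄, where (log k̄)_z is the conjugate of k_z̄/k, that is -½μ.
-/
theorem dz_omega : dz (fun x => ((omega f x : ℝ) : ℂ)) w
    = 1 / 2 * (dz (hopf (lift f) E) w * (hopf (lift f) E w)⁻¹
      - 1 / 2 * (starRingEnd ℂ) (frameMuBar (lift f) E w)) := by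
  set k := hopf (lift f) E with hkdef
  have dk := h.diff hw h.smooth_hopf
  have dk' := h.diff hw (contDiffOn_conj h.smooth_hopf)
  have hkw : k w ≠ 0 := hk w hw
  have hkw' : (starRingEnd ℂ) (k w) ≠ 0 := by simpa using hkw
  have hnq : ∀ x, ((normSq (k x) : ℝ) : ℂ) = k x * (starRingEnd ℂ) (k x) :=
    fun x => (mul_conj _).symm
  have sq : ContDiffOn ℝ ∞ (fun x => normSq (k x)) U := by
    have : ContDiffOn ℝ ∞ (fun x => reCLM (k x * (starRingEnd ℂ) (k x))) U :=
      reCLM.contDiff.comp_contDiffOn (h.smooth_hopf.mul (contDiffOn_conj h.smooth_hopf))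
    refine this.congr fun x _ => ?_
    rw [mul_conj]; rfl
  have e1 : ∀ x ∈ U, ((omega f x : ℝ) : ℂ)
      = 1 / 2 * ((Real.log (4 * normSq (k x)) : ℝ) : ℂ) := by
    intro x hx
    rw [omega, h.kappaSq_eq hx]
    push_cast
    ring
  have d4 : DifferentiableAt ℝ (fun x => 4 * normSq (k x)) w := (h.diff hw sq).const_mul 4
  have h4 : 4 * normSq (k w) ≠ 0 := by simpa using hkw
  have dl : DifferentiableAt ℝ (fun x => ((Real.log (4 * normSq (k x)) : ℝ) : ℂ)) w :=
    ofRealCLM.differentiableAt.comp w (d4.log h4)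
  have e2 : dz (fun x => ((4 * normSq (k x) : ℝ) : ℂ)) w
      = 4 * (dz k w * (starRingEnd ℂ) (k w) + k w * (starRingEnd ℂ) (dzbar k w)) := by
    have : (fun x => ((4 * normSq (k x) : ℝ) : ℂ))
        = fun x => 4 * (k x * (starRingEnd ℂ) (k x)) := by
      funext x; push_cast; rw [hnq]
    rw [this, dz_const_mul _ (dk.fun_mul dk'), dz_mul dk dk', dz_conj dk]
  rw [dz_congr h.isOpen e1 hw, dz_const_mul _ dl, dz_eq_wirt, wirt_log _ d4 h4, ← dz_eq_wirt, e2,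
    dzbar_hopf_eq hk hw]
  push_cast
  rw [hnq]
  simp only [map_mul, map_neg, map_div₀, map_one, conj_ofNat]
  rw [← hkdef]
  field_simp
  ring

theorem dzbar_dz_omega : dzbar (dz (fun x => ((omega f x : ℝ) : ℂ))) w
    = -(1 / 4) * (dz (frameMuBar (lift f) E) w
      + (starRingEnd ℂ) (dz (frameMuBar (lift f) E) w)) := by
  set k := hopf (lift f) E with hkdef
  have hkw : k w ≠ 0 := hk w hw
  have sq : ContDiffOn ℝ ∞ (fun x => dz k x * (k x)⁻¹) U :=
    (contDiffOn_dz h.smooth_hopf h.isOpen).mul (h.smooth_hopf.inv hk)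
  have sm := h.smooth_muBar hk
  have dm' := h.diff hw (contDiffOn_conj sm)
  have dk := h.diff hw h.smooth_hopf
  have dq := h.diff hw sq
  have e1 : ∀ x ∈ U, dz k x = dz k x * (k x)⁻¹ * k x := by
    intro x hx
    have := hk x hx
    field_simp
  -- This is (k_z/k)_z̄ = (k_z̄/k)_z, obtained without a branch of log k by differentiating k_z =
  -- (k_z/k)·k.
  have e2 : dzbar (fun x => dz k x * (k x)⁻¹) w = -(1 / 2) * dz (frameMuBar (lift f) E) w := by
    have a := dzbar_congr h.isOpen e1 hw
    rw [dzbar_mul dq dk, dzbar_dz_comm h.smooth_hopf h.isOpen hw,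
      dz_congr h.isOpen (fun x hx => dzbar_hopf_eq hk hx) hw,
      dz_const_mul _ ((h.diff hw sm).fun_mul dk), dz_mul (h.diff hw sm) dk,
      dzbar_hopf_eq hk hw, ← hkdef] at a
    have b : k w * (dzbar (fun x => dz k x * (k x)⁻¹) w
        + 1 / 2 * dz (frameMuBar (lift f) E) w) = 0 := by
      have c : (k w)⁻¹ * k w = 1 := inv_mul_cancel₀ hkw
      linear_combination -a + (1 / 2) * dz k w * frameMuBar (lift f) E w * c
    linear_combination (mul_eq_zero.1 b).resolve_left hkw
  have e3 : ∀ x ∈ U, dz (fun x => ((omega f x : ℝ) : ℂ)) x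
      = 1 / 2 * (dz k x * (k x)⁻¹)
        + -(1 / 4) * (starRingEnd ℂ) (frameMuBar (lift f) E x) := by
    intro x hx
    rw [h.dz_omega hx hk]; ring
  rw [dzbar_congr h.isOpen e3 hw, dzbar_add (dq.const_mul _) (dm'.const_mul _),
    dzbar_const_mul _ dq, dzbar_const_mul _ dm', e2, dzbar_conj (h.diff hw sm)]
  ring

/-- The Möbius curvature is `1 + ½ Re 𝒫`. -/
theorem mobiusK_eq_one_iff : mobiusK f w = 1 ↔
    (starRingEnd ℂ) (frameRho (lift f) E w) = -frameRho (lift f) E w := by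
  have hpos : 0 < normSq (hopf (lift f) E w) := normSq_pos.2 (hk w hw)
  have hexp : Real.exp (-2 * omega f w) = (4 * normSq (hopf (lift f) E w))⁻¹ := by
    rw [omega, h.kappaSq_eq hw, show ∀ a : ℝ, -2 * (a / 2) = -a by intro a; ring, Real.exp_neg,
      Real.exp_log (by positivity)]
  -- Here μ̄_z = ρ + 2|k|² is used. The factor -4e^{-2ω} equals -1/|k|², which turns this value into
  -- 1 + ½ Re 𝒫.
  have hre : (dzbar (dz (fun x => ((omega f x : ℝ) : ℂ))) w).re
      = -(1 / 2) * (frameRho (lift f) E w).re - normSq (hopf (lift f) E w) := by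
    rw [h.dzbar_dz_omega hw hk, dz_muBar, mul_conj, add_conj]
    norm_cast
    simp
    ring
  rw [mobiusK, hexp, hre]
  constructor
  · intro e
    have : (frameRho (lift f) E w).re = 0 := by
      field_simp at e
      linarith
    apply Complex.ext <;> simp [this]
  · intro e
    have : (frameRho (lift f) E w).re = 0 := by
      have := congrArg re e
      simp at this
      linarith
    rw [this]
    field_simp
    ring

end ConfFrame

/-! ### Conformal patches -/

/-- A conformally parametrised surface patch in the unit 3-sphere. -/
structure ConfPatch (U : Set ℂ) (f : ℂ → EuclideanSpace ℝ (Fin 4)) : Prop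
    extends SpherePatch U f where
  pos : ∀ w ∈ U, 0 < coeffE f w
  coeffE_eq : ∀ w ∈ U, coeffE f w = coeffG f w
  coeffF_eq : ∀ w ∈ U, coeffF f w = 0

/-- The conformal factor of the canonical lift. -/
def liftFactor (f : ℂ → EuclideanSpace ℝ (Fin 4)) (w : ℂ) : ℝ := (Real.sqrt (coeffE f w))⁻¹

/-- The mean curvature in a conformal coordinate. -/
def confMean (f : ℂ → EuclideanSpace ℝ (Fin 4)) (w : ℂ) : ℝ :=
  (coeffLS3 f w + coeffNS3 f w) / (2 * coeffE f w)

/-- The unit normal field of the mean curvature spheres. -/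
def sphereNormal (f : ℂ → EuclideanSpace ℝ (Fin 4)) (w : ℂ) : Mink :=
  embL (unitNormal f w) + (confMean f w : ℂ) • lightVec (f w)

theorem lift_eq (f : ℂ → EuclideanSpace ℝ (Fin 4)) :
    lift f = fun w => (liftFactor f w : ℂ) • lightVec (f w) := rfl

theorem contDiffOn_ofReal {X : Type*} [NormedAddCommGroup X] [NormedSpace ℝ X] {S : Set X}
    {r : X → ℝ} (hr : ContDiffOn ℝ ∞ r S) : ContDiffOn ℝ ∞ (fun x => (r x : ℂ)) S :=
  ofRealCLM.contDiff.comp_contDiffOn hr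

namespace ConfPatch

variable {U : Set ℂ} {f : ℂ → EuclideanSpace ℝ (Fin 4)} (h : ConfPatch U f)

include h

theorem smooth_coeffE : ContDiffOn ℝ ∞ (coeffE f) U := h.smooth_pu.inner ℝ h.smooth_pu

theorem smooth_liftFactor : ContDiffOn ℝ ∞ (liftFactor f) U :=
  (h.smooth_coeffE.sqrt fun w hw => (h.pos w hw).ne').inv
    fun w hw => (Real.sqrt_pos.2 (h.pos w hw)).ne'

theorem smooth_lift : ContDiffOn ℝ ∞ (lift f) U := by
  rw [lift_eq]
  exact (contDiffOn_ofReal h.smooth_liftFactor).smul h.smooth_lightVec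

theorem smooth_unitNormal : ContDiffOn ℝ ∞ (unitNormal f) U := by
  have hc : ContDiffOn ℝ ∞ (fun w => cross (f w) (pu f w) (pv f w)) U :=
    contDiff_cross.comp_contDiffOn (h.smooth.prodMk (h.smooth_pu.prodMk h.smooth_pv))
  have : ContDiffOn ℝ ∞ (fun w => (coeffE f w)⁻¹ • cross (f w) (pu f w) (pv f w)) U :=
    (h.smooth_coeffE.inv fun w hw => (h.pos w hw).ne').smul hc
  refine this.congr fun w hw => ?_
  rw [unitNormal, areaDensity, ← h.coeffE_eq w hw, h.coeffF_eq w hw,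
    show coeffE f w * coeffE f w - 0 ^ 2 = coeffE f w ^ 2 by ring, Real.sqrt_sq (h.pos w hw).le]

theorem smooth_confMean : ContDiffOn ℝ ∞ (confMean f) U := by
  have h1 : ContDiffOn ℝ ∞ (pu (pu f)) U := h.smooth_pu.fderiv_apply_const h.isOpen 1
  have h2 : ContDiffOn ℝ ∞ (pv (pv f)) U := h.smooth_pv.fderiv_apply_const h.isOpen I
  have : ContDiffOn ℝ ∞ (fun w => (inner ℝ (unitNormal f w) (pu (pu f) w)
      + inner ℝ (unitNormal f w) (pv (pv f) w)) / (2 * coeffE f w)) U :=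
    ((h.smooth_unitNormal.inner ℝ h1).add (h.smooth_unitNormal.inner ℝ h2)).div
      (contDiffOn_const.mul h.smooth_coeffE) fun w hw => by have := h.pos w hw; positivity
  refine this.congr fun w _ => ?_
  rw [confMean, coeffLS3, coeffNS3, pairNormalS3_eq, pairNormalS3_eq]

theorem smooth_sphereNormal : ContDiffOn ℝ ∞ (sphereNormal f) U :=
  (SmoothPatch.smooth_embL h.smooth_unitNormal).add
    ((contDiffOn_ofReal h.smooth_confMean).smul h.smooth_lightVec)

variable {w : ℂ} (hw : w ∈ U)

include hw

theorem liftFactor_pos : 0 < liftFactor f w := inv_pos.2 (Real.sqrt_pos.2 (h.pos w hw))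

theorem liftFactor_sq : (liftFactor f w : ℂ) ^ 2 * coeffE f w = 1 := by
  have := h.pos w hw
  norm_cast
  rw [liftFactor, inv_pow, Real.sq_sqrt this.le, inv_mul_cancel₀ this.ne']

theorem discr_pos : 0 < coeffE f w * coeffG f w - coeffF f w ^ 2 := by
  have := h.pos w hw
  rw [← h.coeffE_eq w hw, h.coeffF_eq w hw]
  nlinarith

theorem lor_sphereNormal_lightVec : lor (sphereNormal f w) (lightVec (f w)) = 0 := by
  rw [sphereNormal, lor_add_left, lor_smul_left, h.lightVec_self hw,
    SpherePatch.lor_lightVec_normal (inner_unitNormal_self f w)]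
  simp

theorem lor_sphereNormal_dz :
    lor (sphereNormal f w) (dz (fun x => lightVec (f x)) w) = 0 := by
  rw [sphereNormal, lor_add_left, lor_smul_left, h.lightVec_dz hw,
    h.lor_dz_lightVec_normal hw (inner_unitNormal_pu f w) (inner_unitNormal_pv f w)]
  simp

/-- This condition fixes the multiple r of (1, f) in `sphereNormal`: the product is proportional to
L + N - 2rE, with E the metric coefficient, so r must be the mean curvature. -/
theorem lor_sphereNormal_dzbar_dz {l : ℂ → ℂ} (hl : ContDiffOn ℝ ∞ l U) :
    lor (sphereNormal f w) (dzbar (dz (fun x => l x • lightVec (f x))) w) = 0 := by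
  have hE : (coeffE f w : ℂ) ≠ 0 := by exact_mod_cast (h.pos w hw).ne'
  rw [sphereNormal, h.lor_dzbar_dz_lift_normal hw hl (inner_unitNormal_self f w)
    (inner_unitNormal_pu f w) (inner_unitNormal_pv f w), ← h.coeffE_eq w hw, confMean, coeffLS3,
    coeffNS3, pairNormalS3_eq, pairNormalS3_eq]
  push_cast
  field_simp
  ring

omit hw in
theorem confFrame : ConfFrame U (lift f) (sphereNormal f) where
  isOpen := h.isOpen
  smooth := h.smooth_lift
  smooth_normal := h.smooth_sphereNormal
  real w _ := by rw [lift_eq]; simp only [conjM_smul, conjM_lightVec, conj_ofReal]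
  real_normal w _ := by
    simp only [sphereNormal, conjM_add, conjM_smul, conjM_lightVec, conjM_embL, conj_ofReal]
  lor_self w hw := by
    rw [lift_eq]
    simp only [lor_smul_left, lor_smul_right, h.lightVec_self hw, mul_zero]
  lor_dz_dz w hw := by
    rw [lift_eq, h.lor_dz_lift hw (contDiffOn_ofReal h.smooth_liftFactor), ← h.coeffE_eq w hw,
      h.coeffF_eq w hw]
    simp
  lor_dz_dzbar w hw := by
    rw [lift_eq, h.lor_dz_dzbar_lift hw (contDiffOn_ofReal h.smooth_liftFactor),
      ← h.coeffE_eq w hw]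
    linear_combination (1 / 2) * h.liftFactor_sq hw
  normal_normal w hw := by
    rw [sphereNormal]
    simp only [lor_add_left, lor_add_right, lor_smul_left, lor_smul_right, h.lightVec_self hw,
      lor_comm (lightVec (f w)) (embL _),
      SpherePatch.lor_lightVec_normal (inner_unitNormal_self f w), lor_embL_embL,
      h.inner_unitNormal_unitNormal hw (h.discr_pos hw)]
    simp
  normal_self w hw := by
    rw [lift_eq]
    simp only [lor_smul_right, h.lor_sphereNormal_lightVec hw, mul_zero]
  normal_dz w hw := by
    rw [lift_eq, h.dz_smul_lightVec hw (contDiffOn_ofReal h.smooth_liftFactor), lor_add_right,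
      lor_smul_right, lor_smul_right, h.lor_sphereNormal_lightVec hw, h.lor_sphereNormal_dz hw]
    simp
  normal_dzbar_dz w hw :=
    h.lor_sphereNormal_dzbar_dz hw (contDiffOn_ofReal h.smooth_liftFactor)

theorem hopf_eq : hopf (lift f) (sphereNormal f) w = (liftFactor f w : ℂ) / 4
    * (coeffLS3 f w - coeffNS3 f w - 2 * I * coeffMS3 f w) := by
  rw [hopf, lor_comm, lift_eq, sphereNormal,
    h.lor_dz_dz_lift_normal hw (contDiffOn_ofReal h.smooth_liftFactor) (inner_unitNormal_self f w)
      (inner_unitNormal_pu f w) (inner_unitNormal_pv f w), ← h.coeffE_eq w hw,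
    h.coeffF_eq w hw, coeffLS3, coeffNS3, coeffMS3, pairNormalS3_eq, pairNormalS3_eq,
    pairNormalS3_eq]
  simp

/-- k is a nonzero multiple of L - N - 2iM. In a conformal coordinate its vanishing makes the second
fundamental form a multiple of the first. -/
theorem hopf_ne_zero (hu : ¬ IsUmbilicS3 f w) : hopf (lift f) (sphereNormal f) w ≠ 0 := by
  intro e
  rw [h.hopf_eq hw] at e
  have hl : (liftFactor f w : ℂ) / 4 ≠ 0 := by
    have := (h.liftFactor_pos hw).ne'
    simpa using this
  have e' := (mul_eq_zero.1 e).resolve_left hl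
  have e1 := congrArg re e'
  have e2 := congrArg im e'
  simp at e1 e2
  have hE := (h.pos w hw).ne'
  refine hu ⟨coeffLS3 f w / coeffE f w, ?_, ?_, ?_⟩
  · field_simp
  · rw [h.coeffF_eq w hw, mul_zero, e2]
  · rw [← h.coeffE_eq w hw]
    field_simp
    linarith

end ConfPatch


/-! ### Families of maps depending on a parameter -/

section Families

variable {E : Type*} [NormedAddCommGroup E] [NormedSpace ℝ E] {U : Set ℂ} {G : ℝ → ℂ → E}

theorem isOpen_univ_prod (hU : IsOpen U) : IsOpen ((univ : Set ℝ) ×ˢ U) := isOpen_univ.prod hU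

theorem fderiv_family (hU : IsOpen U)
    (hG : ContDiffOn ℝ ∞ (fun q : ℝ × ℂ => G q.1 q.2) (univ ×ˢ U)) (t : ℝ) {w : ℂ} (hw : w ∈ U)
    (v : ℂ) : fderiv ℝ (G t) w v = fderiv ℝ (fun q : ℝ × ℂ => G q.1 q.2) (t, w) (0, v) := by
  have hd := hG.differentiableAt_of_isOpen (isOpen_univ_prod hU)
    (show (t, w) ∈ (univ : Set ℝ) ×ˢ U from ⟨trivial, hw⟩)
  have : HasFDerivAt (G t) ((fderiv ℝ (fun q : ℝ × ℂ => G q.1 q.2) (t, w)).comp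
      (ContinuousLinearMap.inr ℝ ℝ ℂ)) w :=
    HasFDerivAt.comp (f := fun x => (t, x)) w hd.hasFDerivAt (hasFDerivAt_prodMk_right t w)
  rw [this.fderiv]
  simp

theorem hasDerivAt_family (hU : IsOpen U)
    (hG : ContDiffOn ℝ ∞ (fun q : ℝ × ℂ => G q.1 q.2) (univ ×ˢ U)) (t : ℝ) {w : ℂ} (hw : w ∈ U) :
    HasDerivAt (fun t => G t w) (fderiv ℝ (fun q : ℝ × ℂ => G q.1 q.2) (t, w) (1, 0)) t := by
  have hd := hG.differentiableAt_of_isOpen (isOpen_univ_prod hU)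
    (show (t, w) ∈ (univ : Set ℝ) ×ˢ U from ⟨trivial, hw⟩)
  have : HasFDerivAt (fun t => G t w) ((fderiv ℝ (fun q : ℝ × ℂ => G q.1 q.2) (t, w)).comp
      (ContinuousLinearMap.inl ℝ ℝ ℂ)) t :=
    HasFDerivAt.comp (f := fun x => (x, w)) t hd.hasFDerivAt (hasFDerivAt_prodMk_left t w)
  simpa using this.hasDerivAt

theorem contDiffOn_fderiv_family (hU : IsOpen U)
    (hG : ContDiffOn ℝ ∞ (fun q : ℝ × ℂ => G q.1 q.2) (univ ×ˢ U)) (v : ℂ) :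
    ContDiffOn ℝ ∞ (fun q : ℝ × ℂ => fderiv ℝ (G q.1) q.2 v) (univ ×ˢ U) :=
  (hG.fderiv_apply_const (isOpen_univ_prod hU) (0, v)).congr
    fun q hq => fderiv_family hU hG q.1 hq.2 v

theorem contDiffOn_slice (hG : ContDiffOn ℝ ∞ (fun q : ℝ × ℂ => G q.1 q.2) (univ ×ˢ U)) (t : ℝ) :
    ContDiffOn ℝ ∞ (G t) U :=
  hG.comp (f := fun x : ℂ => (t, x)) (contDiff_const.prodMk contDiff_id).contDiffOn
    fun _ hx => ⟨trivial, hx⟩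

/-- The derivative with respect to the parameter commutes with partial derivatives. -/
theorem hasDerivAt_fderiv_family (hU : IsOpen U)
    (hG : ContDiffOn ℝ ∞ (fun q : ℝ × ℂ => G q.1 q.2) (univ ×ˢ U)) (t : ℝ) {w : ℂ} (hw : w ∈ U)
    (v : ℂ) : HasDerivAt (fun t => fderiv ℝ (G t) w v)
      (fderiv ℝ (fun x => deriv (fun t => G t x) t) w v) t := by
  have hΩ := isOpen_univ_prod hU
  have hB := hasDerivAt_family (G := fun t x => fderiv ℝ (G t) x v) hU
    (contDiffOn_fderiv_family hU hG v) t hw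
  have hmem : (t, w) ∈ (univ : Set ℝ) ×ˢ U := ⟨trivial, hw⟩
  have e1 : fderiv ℝ (fun q : ℝ × ℂ => fderiv ℝ (G q.1) q.2 v) (t, w)
      = fderiv ℝ (fun q => fderiv ℝ (fun q : ℝ × ℂ => G q.1 q.2) q (0, v)) (t, w) :=
    fderiv_congr_of_isOpen hΩ (fun q hq => fderiv_family hU hG q.1 hq.2 v) hmem
  have e2 : fderiv ℝ (fun x => deriv (fun t => G t x) t) w v
      = fderiv ℝ (fun q => fderiv ℝ (fun q : ℝ × ℂ => G q.1 q.2) q (1, 0)) (t, w) (0, v) := by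
    rw [fderiv_congr_of_isOpen hU (fun x hx => (hasDerivAt_family hU hG t hx).deriv) hw]
    exact fderiv_family (G := fun t x => fderiv ℝ (fun q : ℝ × ℂ => G q.1 q.2) (t, x) (1, 0)) hU
      (hG.fderiv_apply_const hΩ (1, 0)) t hw v
  rw [e1, fderiv_comm_of_isOpen hG hΩ hmem, ← e2] at hB
  exact hB

end Families

section WirtingerFamilies

variable {E : Type*} [NormedAddCommGroup E] [NormedSpace ℂ E] {U : Set ℂ} {G : ℝ → ℂ → E}

theorem contDiffOn_wirt_family (ε : ℂ) (hU : IsOpen U)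
    (hG : ContDiffOn ℝ ∞ (fun q : ℝ × ℂ => G q.1 q.2) (univ ×ˢ U)) :
    ContDiffOn ℝ ∞ (fun q : ℝ × ℂ => wirt ε (G q.1) q.2) (univ ×ˢ U) :=
  ((contDiffOn_fderiv_family hU hG 1).add
    ((contDiffOn_fderiv_family hU hG I).const_smul ε)).const_smul (1 / 2 : ℂ)

theorem hasDerivAt_wirt_family (ε : ℂ) (hU : IsOpen U)
    (hG : ContDiffOn ℝ ∞ (fun q : ℝ × ℂ => G q.1 q.2) (univ ×ˢ U)) (t : ℝ) {w : ℂ} (hw : w ∈ U) :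
    HasDerivAt (fun t => wirt ε (G t) w) (wirt ε (fun x => deriv (fun t => G t x) t) w) t :=
  ((hasDerivAt_fderiv_family hU hG t hw 1).add
    ((hasDerivAt_fderiv_family hU hG t hw I).const_smul ε)).const_smul (1 / 2 : ℂ)

theorem hasDerivAt_wirt_wirt_family (ε δ : ℂ) (hU : IsOpen U)
    (hG : ContDiffOn ℝ ∞ (fun q : ℝ × ℂ => G q.1 q.2) (univ ×ˢ U)) (t : ℝ) {w : ℂ} (hw : w ∈ U) :
    HasDerivAt (fun t => wirt ε (wirt δ (G t)) w)
      (wirt ε (wirt δ (fun x => deriv (fun t => G t x) t)) w) t := by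
  have := hasDerivAt_wirt_family (G := fun t x => wirt δ (G t) x) ε hU
    (contDiffOn_wirt_family δ hU hG) t hw
  rwa [wirt_congr ε hU (fun x hx => (hasDerivAt_wirt_family δ hU hG t hx).deriv) hw] at this

end WirtingerFamilies

/-- Differentiation under the integral sign over a compact set. -/
theorem hasDerivAt_integral_of_contDiffOn {D : ℝ → ℂ → ℝ} {O : Set (ℝ × ℂ)} (hO : IsOpen O)
    (hD : ContDiffOn ℝ ∞ (fun q : ℝ × ℂ => D q.1 q.2) O) {C : Set ℂ} (hC : IsCompact C)
    (hCO : ∀ w ∈ C, ((0 : ℝ), w) ∈ O) :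
    HasDerivAt (fun t => ∫ w in C, D t w) (∫ w in C, deriv (fun t => D t w) 0) 0 := by
  -- Smoothness is known only on a neighbourhood of {0} × C. Compactness of C gives one interval of
  -- parameters that works for all its points, and hence a constant dominating function.
  obtain ⟨u, v, hu, hv, h0u, hCv, huv⟩ := generalized_tube_lemma (isCompact_singleton (x := (0 : ℝ)))
    hC hO (by rintro ⟨t, w⟩ ⟨ht, hw⟩; rw [mem_singleton_iff] at ht; subst ht; exact hCO w hw)
  obtain ⟨ε, hε, hεu⟩ := Metric.isOpen_iff.1 hu 0 (h0u rfl)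
  have hsub : Metric.closedBall (0 : ℝ) (ε / 2) ×ˢ C ⊆ O := fun q hq =>
    huv ⟨hεu (Metric.closedBall_subset_ball (by linarith) hq.1), hCv hq.2⟩
  have hderiv : ∀ q ∈ O, HasDerivAt (fun t => D t q.2)
      (fderiv ℝ (fun q : ℝ × ℂ => D q.1 q.2) q (1, 0)) q.1 := by
    intro q hq
    have : HasFDerivAt (fun t => D t q.2) ((fderiv ℝ (fun q : ℝ × ℂ => D q.1 q.2) q).comp
        (ContinuousLinearMap.inl ℝ ℝ ℂ)) q.1 :=
      HasFDerivAt.comp (f := fun x => (x, q.2)) q.1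
        (hD.differentiableAt_of_isOpen hO hq).hasFDerivAt (hasFDerivAt_prodMk_left q.1 q.2)
    simpa using this.hasDerivAt
  have hcont : ContinuousOn (fun q => fderiv ℝ (fun q : ℝ × ℂ => D q.1 q.2) q (1, 0)) O :=
    (hD.fderiv_apply_const hO (1, 0)).continuousOn
  have hK : IsCompact (Metric.closedBall (0 : ℝ) (ε / 2) ×ˢ C) :=
    (isCompact_closedBall _ _).prod hC
  obtain ⟨B, hB⟩ := hK.exists_bound_of_continuousOn (hcont.mono hsub)
  have hball : Metric.closedBall (0 : ℝ) (ε / 2) ∈ nhds (0 : ℝ) :=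
    Metric.closedBall_mem_nhds _ (by linarith)
  have hslice : ∀ t ∈ Metric.closedBall (0 : ℝ) (ε / 2), ContinuousOn (D t) C := fun t ht =>
    hD.continuousOn.comp (f := fun x : ℂ => (t, x)) (by fun_prop) fun x hx => hsub ⟨ht, hx⟩
  have h0 : (0 : ℝ) ∈ Metric.closedBall (0 : ℝ) (ε / 2) :=
    Metric.mem_closedBall_self (by linarith)
  have key := hasDerivAt_integral_of_dominated_loc_of_deriv_le (μ := volume.restrict C)
    (F := D) (F' := fun t w => deriv (fun t => D t w) t) (bound := fun _ => B) hball
    (Filter.eventually_of_mem hball fun t ht =>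
      (hslice t ht).aestronglyMeasurable hC.measurableSet)
    ((hslice 0 h0).integrableOn_compact hC)
    (ContinuousOn.aestronglyMeasurable (ContinuousOn.congr
      (f := fun w => fderiv ℝ (fun q : ℝ × ℂ => D q.1 q.2) (0, w) (1, 0))
      (hcont.comp (f := fun x : ℂ => ((0 : ℝ), x)) (by fun_prop) fun x hx => hsub ⟨h0, hx⟩)
      fun w hw => (hderiv (0, w) (hsub ⟨h0, hw⟩)).deriv) hC.measurableSet)
    ((ae_restrict_mem hC.measurableSet).mono fun w hw t ht => by
      rw [(hderiv (t, w) (hsub ⟨ht, hw⟩)).deriv]; exact hB (t, w) ⟨ht, hw⟩)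
    (by
      have : IsFiniteMeasure (volume.restrict C) := ⟨by simpa using hC.measure_lt_top⟩
      exact integrable_const B)
    ((ae_restrict_mem hC.measurableSet).mono fun w hw t ht => by
      have := hderiv (t, w) (hsub ⟨ht, hw⟩)
      simpa only [this.deriv] using this)
  exact key.2

/-! ### Integration by parts and the fundamental lemma -/

theorem integrable_of_continuousOn {U K : Set ℂ} {g : ℂ → ℂ} (hg : ContinuousOn g U)
    (hK : IsCompact K) (hKU : K ⊆ U) (hs : ∀ x ∉ K, g x = 0) : Integrable g := by
  have : IntegrableOn g K := (hg.mono hKU).integrableOn_compact hK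
  exact (integrableOn_iff_integrable_of_support_subset fun x hx => by
    by_contra hxK; exact hx (hs x hxK)).1 this

theorem integral_mul_wirt (ε : ℂ) {U : Set ℂ} (hU : IsOpen U) {A φ : ℂ → ℂ}
    (hA : ContDiffOn ℝ ∞ A U) (hφ : ContDiff ℝ ∞ φ) (hc : HasCompactSupport φ)
    (hs : tsupport φ ⊆ U) : ∫ w, A w * wirt ε φ w = -∫ w, wirt ε A w * φ w := by
  have hφ0 : ∀ x ∉ tsupport φ, φ x = 0 := fun x hx => image_eq_zero_of_notMem_tsupport hx
  have hdφ0 : ∀ v, ∀ x ∉ tsupport φ, fderiv ℝ φ x v = 0 := fun v x hx => by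
    rw [fderiv_of_notMem_tsupport ℝ hx]; rfl
  have cA := hA.continuousOn
  have cφ : ContinuousOn φ U := hφ.continuous.continuousOn
  have cdA : ∀ v, ContinuousOn (fun x => fderiv ℝ A x v) U := fun v =>
    (hA.fderiv_apply_const hU v).continuousOn
  have cdφ : ∀ v, ContinuousOn (fun x => fderiv ℝ φ x v) U := fun v =>
    (hφ.contDiffOn.fderiv_apply_const hU v).continuousOn
  have i1 : ∀ v, Integrable (fun x => fderiv ℝ A x v * φ x) := fun v =>
    integrable_of_continuousOn ((cdA v).mul cφ) hc hs fun x hx => by rw [hφ0 x hx, mul_zero]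
  have i2 : ∀ v, Integrable (fun x => A x * fderiv ℝ φ x v) := fun v =>
    integrable_of_continuousOn (cA.mul (cdφ v)) hc hs fun x hx => by rw [hdφ0 v x hx, mul_zero]
  have i3 : Integrable (fun x => A x * φ x) :=
    integrable_of_continuousOn (cA.mul cφ) hc hs fun x hx => by rw [hφ0 x hx, mul_zero]
  have key : ∀ v, ∫ x, A x * fderiv ℝ φ x v = -∫ x, fderiv ℝ A x v * φ x := fun v =>
    integral_mul_fderiv_eq_neg_fderiv_mul_of_integrable (i1 v) (i2 v) i3
      (fun x hx => hA.differentiableAt_of_isOpen hU (hs hx))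
      (fun x _ => (hφ.differentiable (by simp)) x)
  have e1 : (fun w => A w * wirt ε φ w)
      = fun w => (1 / 2) * (A w * fderiv ℝ φ w 1 + ε * (A w * fderiv ℝ φ w I)) := by
    funext w; simp only [wirt, smul_eq_mul]; ring
  have e2 : (fun w => wirt ε A w * φ w)
      = fun w => (1 / 2) * (fderiv ℝ A w 1 * φ w + ε * (fderiv ℝ A w I * φ w)) := by
    funext w; simp only [wirt, smul_eq_mul]; ring
  rw [e1, e2, integral_const_mul, integral_const_mul,
    integral_add (i2 1) ((i2 I).const_mul ε), integral_add (i1 1) ((i1 I).const_mul ε),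
    integral_const_mul, integral_const_mul, key, key]
  ring

/-- The fundamental lemma of the calculus of variations for the operator `φ ↦ Re (A φ_zz + B φ)`. -/
theorem eq_zero_of_forall_integral {U : Set ℂ} (hU : IsOpen U) {A B : ℂ → ℂ}
    (hA : ContDiffOn ℝ ∞ A U) (hB : ContDiffOn ℝ ∞ B U)
    (hint : ∀ φ : ℂ → ℝ, ContDiff ℝ ∞ φ → HasCompactSupport φ → tsupport φ ⊆ U →
      ∫ w in tsupport φ, (A w * dz (dz (fun x => (φ x : ℂ))) w + B w * φ w).re = 0) :
    ∀ w ∈ U, (dz (dz A) w + B w).re = 0 := by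
  have sA2 := contDiffOn_dz (contDiffOn_dz hA hU) hU
  have scont : ContinuousOn (fun w => (dz (dz A) w + B w).re) U :=
    continuous_re.comp_continuousOn (sA2.add hB).continuousOn
  have hae := hU.ae_eq_zero_of_integral_contDiff_smul_eq_zero (μ := volume)
    (scont.locallyIntegrableOn hU.measurableSet) (by
    intro φ hφ hc hs
    have hΦ : ContDiff ℝ ∞ (fun x => (φ x : ℂ)) := ofRealCLM.contDiff.comp hφ
    have hts : tsupport (fun x => (φ x : ℂ)) = tsupport φ := by
      simp only [tsupport]
      congr 1
      ext x
      simp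
    have hΦc : HasCompactSupport (fun x => (φ x : ℂ)) := by
      rw [HasCompactSupport, hts]; exact hc
    have hdΦ : ContDiff ℝ ∞ (dz (fun x => (φ x : ℂ))) :=
      contDiffOn_univ.1 (contDiffOn_dz hΦ.contDiffOn isOpen_univ)
    have hddΦ : ContDiff ℝ ∞ (dz (dz (fun x => (φ x : ℂ)))) :=
      contDiffOn_univ.1 (contDiffOn_dz hdΦ.contDiffOn isOpen_univ)
    have hsub : ∀ g : ℂ → ℂ, tsupport (dz g) ⊆ tsupport g := fun g =>
      closure_minimal (fun x hx => by
        by_contra hxt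
        exact hx (by rw [dz, fderiv_of_notMem_tsupport ℝ hxt]; simp)) (isClosed_tsupport g)
    have ts1 := hsub (fun x => (φ x : ℂ))
    have ts2 := hsub (dz (fun x => (φ x : ℂ)))
    rw [hts] at ts1
    have hdΦc : HasCompactSupport (dz (fun x => (φ x : ℂ))) :=
      hc.of_isClosed_subset (isClosed_tsupport _) ts1
    have z0 : ∀ x ∉ tsupport φ, (φ x : ℂ) = 0 := fun x hx => by
      rw [image_eq_zero_of_notMem_tsupport hx]; simp
    have z2 : ∀ x ∉ tsupport φ, dz (dz (fun x => (φ x : ℂ))) x = 0 := fun x hx =>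
      image_eq_zero_of_notMem_tsupport fun hx' => hx (ts1 (ts2 hx'))
    have j1 : Integrable (fun w => A w * dz (dz (fun x => (φ x : ℂ))) w) :=
      integrable_of_continuousOn (hA.continuousOn.mul hddΦ.continuous.continuousOn) hc hs
        fun x hx => by rw [z2 x hx, mul_zero]
    have j2 : Integrable (fun w => B w * φ w) :=
      integrable_of_continuousOn (hB.continuousOn.mul hΦ.continuous.continuousOn) hc hs
        fun x hx => by rw [z0 x hx, mul_zero]
    have j3 : Integrable (fun w => dz (dz A) w * φ w) :=
      integrable_of_continuousOn (sA2.continuousOn.mul hΦ.continuous.continuousOn) hc hs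
        fun x hx => by rw [z0 x hx, mul_zero]
    have e1 : ∫ w, A w * dz (dz (fun x => (φ x : ℂ))) w = ∫ w, dz (dz A) w * φ w := by
      have a1 := integral_mul_wirt (-I) hU hA hdΦ hdΦc (ts1.trans hs)
      have a2 := integral_mul_wirt (-I) hU (contDiffOn_dz hA hU) hΦ hΦc (by rwa [hts])
      simp only [← dz_eq_wirt] at a1 a2
      rw [a1, a2, neg_neg]
    have e2 := hint φ hφ hc hs
    rw [setIntegral_eq_integral_of_forall_compl_eq_zero (fun x hx => by
      rw [z0 x hx, z2 x hx]; simp)] at e2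
    have r1 := reCLM.integral_comp_comm (j1.add j2)
    have r2 := reCLM.integral_comp_comm (j3.add j2)
    simp only [Pi.add_apply, reCLM_apply] at r1 r2
    rw [r1, integral_add j1 j2, e1, ← integral_add j3 j2, ← r2] at e2
    rw [← e2]
    congr 1
    funext w
    simp
    ring)
  have := Measure.eqOn_open_of_ae_eq (μ := volume) (U := U)
    (f := fun w => (dz (dz A) w + B w).re) (g := fun _ => 0)
    ((ae_restrict_iff' hU.measurableSet).2 hae) hU scont continuousOn_const
  exact this


/-! ### The first variation of the Willmore functional -/

/-- The Willmore density of a lift with `a = ⟨Y_z, Y_z⟩`, `b = ⟨Y_z, Y_z̄⟩`, `q = ⟨Y_zz, E⟩` and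
`p = ⟨Y_zz̄, E⟩`. -/
def densityForm (a b q p : ℂ) : ℝ :=
  ((8 * b.re * p.re - 8 * (a * (starRingEnd ℂ) q).re) ^ 2 / (4 * (4 * b.re ^ 2 - 4 * normSq a) ^ 2)
    - (4 * p.re ^ 2 - 4 * normSq q) / (4 * b.re ^ 2 - 4 * normSq a))
    * Real.sqrt (4 * b.re ^ 2 - 4 * normSq a)

/-- This is the conformal invariance of (H² - k₁k₂) dA: rescaling the lift by l or changing the
tangent sphere by r leaves it unchanged. The l and r of the initial surface may therefore be kept
along a variation. -/
theorem willmoreDensity_eq {U : Set ℂ} {g : ℂ → EuclideanSpace ℝ (Fin 4)} (h : SpherePatch U g)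
    {w : ℂ} (hw : w ∈ U) (hΔ : 0 < coeffE g w * coeffG g w - coeffF g w ^ 2) {l : ℂ → ℝ}
    (hl : ContDiffOn ℝ ∞ l U) (hl0 : 0 < l w) (r : ℝ) :
    willmoreDensity g w = densityForm
      (lor (dz (fun x => (l x : ℂ) • lightVec (g x)) w)
        (dz (fun x => (l x : ℂ) • lightVec (g x)) w))
      (lor (dz (fun x => (l x : ℂ) • lightVec (g x)) w)
        (dzbar (fun x => (l x : ℂ) • lightVec (g x)) w))
      (lor (embL (unitNormal g w) + (r : ℂ) • lightVec (g w))
        (dz (dz (fun x => (l x : ℂ) • lightVec (g x))) w))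
      (lor (embL (unitNormal g w) + (r : ℂ) • lightVec (g w))
        (dzbar (dz (fun x => (l x : ℂ) • lightVec (g x))) w)) := by
  have hl' := contDiffOn_ofReal hl
  rw [h.lor_dz_lift hw hl', h.lor_dz_dzbar_lift hw hl',
    h.lor_dz_dz_lift_normal hw hl' (inner_unitNormal_self g w) (inner_unitNormal_pu g w)
      (inner_unitNormal_pv g w),
    h.lor_dzbar_dz_lift_normal hw hl' (inner_unitNormal_self g w) (inner_unitNormal_pu g w)
      (inner_unitNormal_pv g w),
    willmoreDensity, meanCurvatureS3, extrinsicCurvatureS3, coeffLS3, coeffMS3, coeffNS3,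
    pairNormalS3_eq, pairNormalS3_eq, pairNormalS3_eq, areaDensity]
  generalize inner ℝ (unitNormal g w) (pu (pu g) w) = L
  generalize inner ℝ (unitNormal g w) (pv (pu g) w) = M
  generalize inner ℝ (unitNormal g w) (pv (pv g) w) = N
  revert hΔ
  generalize coeffE g w = E
  generalize coeffF g w = F
  generalize coeffG g w = G
  intro hΔ
  revert hl0
  generalize l w = l
  intro hl0
  have ea : (l : ℂ) ^ 2 / 4 * (E - G - 2 * I * F)
      = ((l ^ 2 / 4 * (E - G) : ℝ) : ℂ) + ((-(l ^ 2 / 2 * F) : ℝ) : ℂ) * I := by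
    push_cast; ring
  have eb : (l : ℂ) ^ 2 / 4 * (E + G) = ((l ^ 2 / 4 * (E + G) : ℝ) : ℂ) := by
    push_cast; ring
  have eq : (l : ℂ) / 4 * (L - N - 2 * I * M - r * (E - G - 2 * I * F))
      = ((l / 4 * (L - N - r * (E - G)) : ℝ) : ℂ) + ((-(l / 2 * (M - r * F)) : ℝ) : ℂ) * I := by
    push_cast; ring
  have ep : (l : ℂ) / 4 * (L + N - r * (E + G)) = ((l / 4 * (L + N - r * (E + G)) : ℝ) : ℂ) := by
    push_cast; ring
  rw [ea, eb, eq, ep, densityForm]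
  have hre : ∀ x y u v : ℝ, (((x : ℂ) + (y : ℂ) * I)
      * (starRingEnd ℂ) ((u : ℂ) + (v : ℂ) * I)).re = x * u + y * v := by
    intro x y u v; simp
  rw [hre, normSq_add_mul_I, normSq_add_mul_I, ofReal_re, ofReal_re]
  -- Up to powers of l, the three identities give EG - F², the numerator of the mean curvature and
  -- LN - M², the last two after the second form has been shifted by -r times the first.
  have e1 : 4 * (l ^ 2 / 4 * (E + G)) ^ 2
      - 4 * ((l ^ 2 / 4 * (E - G)) ^ 2 + (-(l ^ 2 / 2 * F)) ^ 2)
      = (l ^ 2) ^ 2 * (E * G - F ^ 2) := by ring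
  have e2 : 8 * (l ^ 2 / 4 * (E + G)) * (l / 4 * (L + N - r * (E + G)))
      - 8 * (l ^ 2 / 4 * (E - G) * (l / 4 * (L - N - r * (E - G)))
        + -(l ^ 2 / 2 * F) * -(l / 2 * (M - r * F)))
      = l ^ 3 * (E * N - 2 * F * M + G * L - 2 * r * (E * G - F ^ 2)) := by ring
  have e3 : 4 * (l / 4 * (L + N - r * (E + G))) ^ 2
      - 4 * ((l / 4 * (L - N - r * (E - G))) ^ 2 + (-(l / 2 * (M - r * F))) ^ 2)
      = l ^ 2 * (L * N - M ^ 2 - r * (E * N - 2 * F * M + G * L) + r ^ 2 * (E * G - F ^ 2)) := by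
    ring
  rw [e1, e2, e3, Real.sqrt_mul (by positivity), Real.sqrt_sq (by positivity)]
  generalize E * G - F ^ 2 = Δ at *
  field_simp
  ring

/-- At a = 0, b = ½, p = 0 the mean curvature term is the square of a vanishing quantity, and a and
p enter the rest quadratically, so their first-order changes do not count. What remains is the
derivative of 4|q|²/(2b). -/
theorem hasDerivAt_densityForm {a b q p : ℝ → ℂ} {a' b' q' p' : ℂ} (ha : HasDerivAt a a' 0)
    (hb : HasDerivAt b b' 0) (hq : HasDerivAt q q' 0) (hp : HasDerivAt p p' 0) (ha0 : a 0 = 0)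
    (hb0 : b 0 = 1 / 2) (hp0 : p 0 = 0) :
    HasDerivAt (fun t => densityForm (a t) (b t) (q t) (p t))
      (8 * ((starRingEnd ℂ) (q 0) * q').re - 8 * normSq (q 0) * b'.re) 0 := by
  have re_deriv : ∀ {c : ℝ → ℂ} {c' : ℂ}, HasDerivAt c c' 0 →
      HasDerivAt (fun t => (c t).re) c'.re 0 := fun hc =>
    reCLM.hasFDerivAt.comp_hasDerivAt (0 : ℝ) hc
  have im_deriv : ∀ {c : ℝ → ℂ} {c' : ℂ}, HasDerivAt c c' 0 →
      HasDerivAt (fun t => (c t).im) c'.im 0 := fun hc =>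
    imCLM.hasFDerivAt.comp_hasDerivAt (0 : ℝ) hc
  have a1 := re_deriv ha
  have a2 := im_deriv ha
  have b1 := re_deriv hb
  have q1 := re_deriv hq
  have q2 := im_deriv hq
  have p1 := re_deriv hp
  have hfun : (fun t => densityForm (a t) (b t) (q t) (p t)) = fun t =>
      ((8 * (b t).re * (p t).re - 8 * ((a t).re * (q t).re + (a t).im * (q t).im)) ^ 2
          / (4 * (4 * (b t).re ^ 2 - 4 * ((a t).re * (a t).re + (a t).im * (a t).im)) ^ 2)
        - (4 * (p t).re ^ 2 - 4 * ((q t).re * (q t).re + (q t).im * (q t).im))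
          / (4 * (b t).re ^ 2 - 4 * ((a t).re * (a t).re + (a t).im * (a t).im)))
        * Real.sqrt (4 * (b t).re ^ 2 - 4 * ((a t).re * (a t).re + (a t).im * (a t).im)) := by
    funext t
    simp [densityForm, normSq_apply]
  rw [hfun]
  have dX := ((b1.const_mul 8).mul p1).sub (((a1.mul q1).add (a2.mul q2)).const_mul 8)
  have dΔ := ((b1.pow 2).const_mul 4).sub (((a1.mul a1).add (a2.mul a2)).const_mul 4)
  have dB := ((p1.pow 2).const_mul 4).sub (((q1.mul q1).add (q2.mul q2)).const_mul 4)
  have hΔ0 : 4 * (b 0).re ^ 2 - 4 * ((a 0).re * (a 0).re + (a 0).im * (a 0).im) = 1 := by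
    rw [ha0, hb0]; norm_num
  have h1 := (((dX.pow 2).div ((dΔ.pow 2).const_mul 4) (by
    simp only [Pi.sub_apply, Pi.pow_apply, Pi.add_apply, Pi.mul_apply, hΔ0]; norm_num)).sub
      (dB.div dΔ (by
        simp only [Pi.sub_apply, Pi.pow_apply, Pi.add_apply, Pi.mul_apply, hΔ0]; norm_num))).mul
      (dΔ.sqrt (by
        simp only [Pi.sub_apply, Pi.pow_apply, Pi.add_apply, Pi.mul_apply, hΔ0]; norm_num))
  refine h1.congr_deriv ?_
  simp only [Pi.sub_apply, Pi.pow_apply, Pi.add_apply, Pi.mul_apply, Pi.div_apply, ha0, hb0, hp0,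
    normSq_apply, zero_re, zero_im, mul_re, conj_re, conj_im]
  norm_num
  ring

theorem _root_.HasDerivAt.lor {A B : ℝ → Mink} {A' B' : Mink} {t : ℝ} (hA : HasDerivAt A A' t)
    (hB : HasDerivAt B B' t) :
    HasDerivAt (fun t => lor (A t) (B t)) (lor A' (B t) + lor (A t) B') t := by
  have := (lorL.bilinearRestrictScalars ℝ).hasDerivAt_of_bilinear (fun _ => hA) fun _ => hB
  simp only [ContinuousLinearMap.bilinearRestrictScalars_apply_apply, lorL_apply] at this
  rw [add_comm]
  exact this

namespace ConfFrame

variable {U : Set ℂ} {Y E : ℂ → Mink} (h : ConfFrame U Y E) {w : ℂ} (hw : w ∈ U) {p τ : ℂ → ℂ}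
  (hp : ContDiffOn ℝ ∞ p U) (hτ : ContDiffOn ℝ ∞ τ U)

include h hw hp hτ

/-- E is orthogonal to E_z, Y and Y_z, which removes the first derivatives of p and all derivatives
of τ. The term p⟨E, E_zz⟩ = -p⟨E_z, E_z⟩ vanishes since E_z lies in the isotropic plane of Y and
Y_z̄. -/
theorem lor_normal_dz_dz_variation :
    lor (E w) (dz (dz (fun x => p x • E x + τ x • Y x)) w)
      = dz (dz p) w + τ w * hopf Y E w := by
  have s1 := contDiffOn_dz hp h.isOpen
  have s2 := contDiffOn_dz hτ h.isOpen
  have sE1 := contDiffOn_dz h.smooth_normal h.isOpen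
  have e : ∀ x ∈ U, dz (fun x => p x • E x + τ x • Y x) x
      = (dz p x • E x + p x • dz E x) + (dz τ x • Y x + τ x • dz Y x) := by
    intro x hx
    rw [dz_add ((h.diff hx hp).fun_smul (h.diff hx h.smooth_normal))
      ((h.diff hx hτ).fun_smul (h.diff hx h.smooth)),
      dz_smul (h.diff hx hp) (h.diff hx h.smooth_normal),
      dz_smul (h.diff hx hτ) (h.diff hx h.smooth)]
  have hEE := lor_dz_of_const h.isOpen h.smooth_normal sE1
    (fun x hx => by rw [lor_comm]; exact h.normal_dz_normal hx) hw
  have hE1 : lor (dz E w) (dz E w) = 0 := by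
    rw [h.dz_normal_eq hw]
    simp only [lor_add_left, lor_add_right, lor_smul_left, lor_smul_right, h.lor_self w hw,
      h.self_dzbar hw, h.dzbar_dzbar hw, lor_comm (dzbar Y w) (Y w)]
    ring
  rw [dz_congr h.isOpen e hw,
    dz_add (((h.diff hw s1).fun_smul (h.diff hw h.smooth_normal)).fun_add
      ((h.diff hw hp).fun_smul (h.diff hw sE1)))
      (((h.diff hw s2).fun_smul (h.diff hw h.smooth)).fun_add
      ((h.diff hw hτ).fun_smul (h.diff hw h.smooth_dz))),
    dz_add ((h.diff hw s1).fun_smul (h.diff hw h.smooth_normal))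
      ((h.diff hw hp).fun_smul (h.diff hw sE1)),
    dz_add ((h.diff hw s2).fun_smul (h.diff hw h.smooth))
      ((h.diff hw hτ).fun_smul (h.diff hw h.smooth_dz)),
    dz_smul (h.diff hw s1) (h.diff hw h.smooth_normal),
    dz_smul (h.diff hw hp) (h.diff hw sE1), dz_smul (h.diff hw s2) (h.diff hw h.smooth),
    dz_smul (h.diff hw hτ) (h.diff hw h.smooth_dz)]
  have hE2 : lor (E w) (dz E w) = 0 := by rw [lor_comm]; exact h.normal_dz_normal hw
  have hk : lor (E w) (dz (dz Y) w) = hopf Y E w := lor_comm _ _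
  simp only [lor_add_right, lor_smul_right, h.normal_normal w hw, h.normal_self w hw,
    h.normal_dz w hw, hE2, hk]
  rw [hE1] at hEE
  linear_combination p w * hEE

/-- The p-terms vanish because ⟨E_z, Y_z̄⟩ = -⟨E, Y_zz̄⟩ = 0: to first order, moving along E does
not change the conformal factor of Y. -/
theorem lor_dz_dzbar_variation :
    lor (dz (fun x => p x • E x + τ x • Y x) w) (dzbar Y w)
      + lor (dz Y w) (dzbar (fun x => p x • E x + τ x • Y x) w) = τ w := by
  have dp := h.diff hw hp
  have dτ := h.diff hw hτ
  have dE := h.diff hw h.smooth_normal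
  have dY := h.diff hw h.smooth
  have hE1 : lor (dz Y w) (dzbar E w) = 0 := by
    rw [h.dzbar_normal_eq hw, lor_add_right, lor_smul_right, lor_smul_right, lor_comm,
      h.self_dz hw, h.lor_dz_dz w hw]
    ring
  rw [dz_add (dp.fun_smul dE) (dτ.fun_smul dY), dzbar_add (dp.fun_smul dE) (dτ.fun_smul dY),
    dz_smul dp dE, dz_smul dτ dY, dzbar_smul dp dE, dzbar_smul dτ dY]
  simp only [lor_add_left, lor_add_right, lor_smul_left, lor_smul_right, h.normal_dzbar hw,
    h.dz_normal_dzbar hw, h.self_dzbar hw, h.lor_dz_dzbar w hw, lor_comm (dz Y w) (E w),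
    lor_comm (dz Y w) (Y w), h.normal_dz w hw, h.self_dz hw, hE1]
  ring

end ConfFrame

/-! ### Families of surfaces in the sphere -/

/-- A smooth family of surface patches in the unit sphere. -/
structure SphereFamily (U : Set ℂ) (F : ℝ → ℂ → EuclideanSpace ℝ (Fin 4)) : Prop where
  isOpen : IsOpen U
  smooth : ContDiffOn ℝ ∞ (fun q : ℝ × ℂ => F q.1 q.2) (univ ×ˢ U)
  norm_eq : ∀ t, ∀ w ∈ U, ‖F t w‖ = 1

namespace SphereFamily

variable {U : Set ℂ} {F : ℝ → ℂ → EuclideanSpace ℝ (Fin 4)} (h : SphereFamily U F)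

/-- The parameters at which a family is immersed. -/
def regular (U : Set ℂ) (F : ℝ → ℂ → EuclideanSpace ℝ (Fin 4)) : Set (ℝ × ℂ) :=
  (univ ×ˢ U) ∩ (fun q : ℝ × ℂ => coeffE (F q.1) q.2 * coeffG (F q.1) q.2
    - coeffF (F q.1) q.2 ^ 2) ⁻¹' Ioi 0

include h

theorem patch (t : ℝ) : SpherePatch U (F t) :=
  ⟨⟨h.isOpen, contDiffOn_slice h.smooth t⟩, h.norm_eq t⟩

theorem smooth_pu : ContDiffOn ℝ ∞ (fun q : ℝ × ℂ => pu (F q.1) q.2) (univ ×ˢ U) :=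
  contDiffOn_fderiv_family h.isOpen h.smooth 1

theorem smooth_pv : ContDiffOn ℝ ∞ (fun q : ℝ × ℂ => pv (F q.1) q.2) (univ ×ˢ U) :=
  contDiffOn_fderiv_family h.isOpen h.smooth I

theorem smooth_discr : ContDiffOn ℝ ∞ (fun q : ℝ × ℂ => coeffE (F q.1) q.2 * coeffG (F q.1) q.2
    - coeffF (F q.1) q.2 ^ 2) (univ ×ˢ U) :=
  ((h.smooth_pu.inner ℝ h.smooth_pu).mul (h.smooth_pv.inner ℝ h.smooth_pv)).sub
    ((h.smooth_pu.inner ℝ h.smooth_pv).pow 2)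

theorem isOpen_regular : IsOpen (regular U F) :=
  h.smooth_discr.continuousOn.isOpen_inter_preimage (isOpen_univ_prod h.isOpen) isOpen_Ioi

theorem smooth_areaDensity :
    ContDiffOn ℝ ∞ (fun q : ℝ × ℂ => areaDensity (F q.1) q.2) (regular U F) :=
  (h.smooth_discr.mono inter_subset_left).sqrt fun _ hq => ne_of_gt hq.2

theorem smooth_unitNormal :
    ContDiffOn ℝ ∞ (fun q : ℝ × ℂ => unitNormal (F q.1) q.2) (regular U F) := by
  have hc : ContDiffOn ℝ ∞ (fun q : ℝ × ℂ =>
      cross (F q.1 q.2) (pu (F q.1) q.2) (pv (F q.1) q.2)) (univ ×ˢ U) :=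
    contDiff_cross.comp_contDiffOn (h.smooth.prodMk (h.smooth_pu.prodMk h.smooth_pv))
  exact (h.smooth_areaDensity.inv fun q hq => (Real.sqrt_pos.2 hq.2).ne').smul
    (hc.mono inter_subset_left)

theorem smooth_willmoreDensity :
    ContDiffOn ℝ ∞ (fun q : ℝ × ℂ => willmoreDensity (F q.1) q.2) (regular U F) := by
  have hs : regular U F ⊆ univ ×ˢ U := inter_subset_left
  have sn := h.smooth_unitNormal
  have sE := (h.smooth_pu.inner ℝ h.smooth_pu).mono hs
  have sF := (h.smooth_pu.inner ℝ h.smooth_pv).mono hs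
  have sG := (h.smooth_pv.inner ℝ h.smooth_pv).mono hs
  have sL := sn.inner ℝ ((contDiffOn_fderiv_family (G := fun t x => pu (F t) x) h.isOpen
    h.smooth_pu 1).mono hs)
  have sM := sn.inner ℝ ((contDiffOn_fderiv_family (G := fun t x => pu (F t) x) h.isOpen
    h.smooth_pu I).mono hs)
  have sN := sn.inner ℝ ((contDiffOn_fderiv_family (G := fun t x => pv (F t) x) h.isOpen
    h.smooth_pv I).mono hs)
  have sΔ := (h.smooth_discr).mono hs
  have hΔ : ∀ q ∈ regular U F, coeffE (F q.1) q.2 * coeffG (F q.1) q.2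
      - coeffF (F q.1) q.2 ^ 2 ≠ 0 := fun q hq => ne_of_gt hq.2
  have key := ((((((sE.mul sN).sub ((contDiffOn_const (c := (2 : ℝ))).mul sF |>.mul sM)).add
    (sG.mul sL)).div ((contDiffOn_const (c := (2 : ℝ))).mul sΔ)
      (fun q hq => mul_ne_zero two_ne_zero (hΔ q hq))).pow 2).sub
      (((sL.mul sN).sub (sM.pow 2)).div sΔ hΔ)).mul h.smooth_areaDensity
  refine key.congr fun q _ => ?_
  simp only [willmoreDensity, meanCurvatureS3, extrinsicCurvatureS3, coeffLS3, coeffMS3, coeffNS3,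
    pairNormalS3_eq]
  rfl

end SphereFamily

/-- The first variation of the Willmore density under a normal variation. -/
theorem hasDerivAt_willmoreDensity {U : Set ℂ} {f : ℂ → EuclideanSpace ℝ (Fin 4)}
    (h : ConfPatch U f) {F : ℝ → ℂ → EuclideanSpace ℝ (Fin 4)} (hF : SphereFamily U F)
    (hF0 : F 0 = f) {φ : ℂ → ℝ} (hφ : ContDiffOn ℝ ∞ φ U)
    (hδ : ∀ x ∈ U, HasDerivAt (fun t => F t x) ((φ x / liftFactor f x) • unitNormal f x) 0)
    {w : ℂ} (hw : w ∈ U) :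
    HasDerivAt (fun t => willmoreDensity (F t) w)
      (8 * ((starRingEnd ℂ) (hopf (lift f) (sphereNormal f) w)
        * (dz (dz (fun x => (φ x : ℂ))) w + schwarz (lift f) w / 2 * φ w)).re) 0 := by
  have hc := h.confFrame
  set Y : ℝ → ℂ → Mink := fun t x => (liftFactor f x : ℂ) • lightVec (F t x) with hY
  set E : ℝ → Mink := fun t => embL (unitNormal (F t) w)
    + ((confMean f w : ℝ) : ℂ) • lightVec (F t w) with hE
  have hY0 : Y 0 = lift f := by
    funext x; simp only [hY, hF0]; rfl
  have hE0 : E 0 = sphereNormal f w := by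
    simp only [hE, hF0]; rfl
  have sl : ContDiffOn ℝ ∞ (fun q : ℝ × ℂ => (liftFactor f q.2 : ℂ)) (univ ×ˢ U) :=
    (contDiffOn_ofReal h.smooth_liftFactor).comp contDiff_snd.contDiffOn fun _ hq => hq.2
  have sY : ContDiffOn ℝ ∞ (fun q : ℝ × ℂ => Y q.1 q.2) (univ ×ˢ U) :=
    sl.smul (contDiff_lightVec.comp_contDiffOn hF.smooth)
  -- The lift varies by φ times the embedded unit normal n, and n = E - H(1, f) = E - (H/l)Y with l
  -- the lift factor. This determines τ.
  set τ : ℂ → ℝ := fun x => -(φ x * confMean f x / liftFactor f x) with hτ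
  have sτ : ContDiffOn ℝ ∞ τ U := ((hφ.mul h.smooth_confMean).div h.smooth_liftFactor
    fun x hx => (h.liftFactor_pos hx).ne').neg
  -- the variation of the lift
  have hlv : ∀ x ∈ U, HasDerivAt (fun t => lightVec (F t x))
      (embL ((φ x / liftFactor f x) • unitNormal f x)) 0 := by
    intro x hx
    have : (fun t => lightVec (F t x)) = fun t => lightVec 0 + embL (F t x) :=
      funext fun t => lightVec_eq _
    rw [this]
    exact (embL.hasFDerivAt.comp_hasDerivAt (0 : ℝ) (hδ x hx)).const_add _
  have hdY : ∀ x ∈ U, HasDerivAt (fun t => Y t x)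
      ((φ x : ℂ) • sphereNormal f x + (τ x : ℂ) • lift f x) 0 := by
    intro x hx
    refine ((hlv x hx).const_smul (liftFactor f x : ℂ)).congr_deriv ?_
    have hl0 : (liftFactor f x : ℂ) ≠ 0 := by exact_mod_cast (h.liftFactor_pos hx).ne'
    rw [map_smul, ← Complex.coe_smul, smul_smul, sphereNormal, lift_eq, hτ]
    simp only [smul_add, smul_smul]
    push_cast
    rw [mul_div_cancel₀ _ hl0, neg_mul, div_mul_cancel₀ _ hl0]
    module
  have hder : EqOn (fun x => deriv (fun t => Y t x) 0)
      (fun x => (φ x : ℂ) • sphereNormal f x + (τ x : ℂ) • lift f x) U :=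
    fun x hx => (hdY x hx).deriv
  have hYz := hasDerivAt_wirt_family (-I) hc.isOpen sY 0 hw
  have hYzb := hasDerivAt_wirt_family I hc.isOpen sY 0 hw
  have hYzz := hasDerivAt_wirt_wirt_family (-I) (-I) hc.isOpen sY 0 hw
  have hYzzb := hasDerivAt_wirt_wirt_family I (-I) hc.isOpen sY 0 hw
  simp only [← dz_eq_wirt, ← dzbar_eq_wirt] at hYz hYzb hYzz hYzzb
  rw [dz_congr hc.isOpen hder hw] at hYz
  rw [dzbar_congr hc.isOpen hder hw] at hYzb
  rw [dz_congr hc.isOpen (fun x hx => dz_congr hc.isOpen hder hx) hw] at hYzz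
  -- the variation of the normal
  have hreg : ((0 : ℝ), w) ∈ SphereFamily.regular U F := by
    refine ⟨⟨trivial, hw⟩, ?_⟩
    simp only [mem_preimage, hF0]
    exact h.discr_pos hw
  have hslice : ∀ᶠ t : ℝ in nhds 0, (t, w) ∈ SphereFamily.regular U F :=
    (Continuous.prodMk_left w).continuousAt.eventually (hF.isOpen_regular.mem_nhds hreg)
  have dn : DifferentiableAt ℝ (fun t => unitNormal (F t) w) 0 := by
    have := hF.smooth_unitNormal.differentiableAt_of_isOpen hF.isOpen_regular hreg
    exact DifferentiableAt.comp (f := fun t : ℝ => (t, w)) (0 : ℝ) this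
      (hasFDerivAt_prodMk_left (0 : ℝ) w).differentiableAt
  -- The derivative of the normal is not computed. Since Y_zz is a combination of Y and E, only its
  -- products with these two are needed, and they follow from ⟨E, Y⟩ = 0 and ⟨E, E⟩ = 1 along the
  -- variation.
  obtain ⟨E', hE'⟩ : ∃ E', HasDerivAt E E' 0 :=
    ⟨_, (embL.hasFDerivAt.comp_hasDerivAt (0 : ℝ) dn.hasDerivAt).add
      ((hlv w hw).const_smul ((confMean f w : ℝ) : ℂ))⟩
  have lorEY : ∀ t, lor (E t) (Y t w) = 0 := fun t => by
    simp only [hE, hY, lor_smul_right, lor_add_left, lor_smul_left,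
      (hF.patch t).lightVec_self hw,
      SpherePatch.lor_lightVec_normal (inner_unitNormal_self (F t) w)]
    ring
  have e1 : lor E' (lift f w) = -φ w := by
    have := hE'.lor (hdY w hw)
    simp only [lorEY] at this
    have := this.unique (hasDerivAt_const (0 : ℝ) (0 : ℂ))
    rw [hY0, hE0, lor_add_right, lor_smul_right, lor_smul_right, hc.normal_normal w hw,
      hc.normal_self w hw] at this
    linear_combination this
  have e2 : lor E' (sphereNormal f w) = 0 := by
    have hEE : ∀ᶠ t : ℝ in nhds 0, lor (E t) (E t) = 1 := by
      filter_upwards [hslice] with t ht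
      simp only [hE, lor_smul_right, lor_add_left, lor_add_right, lor_smul_left,
        (hF.patch t).lightVec_self hw, lor_comm (lightVec (F t w)) (embL _),
        SpherePatch.lor_lightVec_normal (inner_unitNormal_self (F t) w), lor_embL_embL,
        (hF.patch t).inner_unitNormal_unitNormal hw ht.2]
      simp
    have := (hE'.lor hE').congr_of_eventuallyEq (hEE.mono fun t ht => ht.symm)
    have := this.unique (hasDerivAt_const (0 : ℝ) (1 : ℂ))
    rw [hE0, lor_comm (sphereNormal f w)] at this
    linear_combination this / 2
  have hq := hE'.lor hYzz
  have hb := hYz.lor hYzb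
  have key := hasDerivAt_densityForm (hYz.lor hYz) hb hq (hE'.lor hYzzb)
    (by rw [hY0]; exact hc.lor_dz_dz w hw) (by rw [hY0]; exact hc.lor_dz_dzbar w hw)
    (by rw [hY0, hE0]; exact hc.normal_dzbar_dz w hw)
  have hdens : (fun t => willmoreDensity (F t) w) =ᶠ[nhds 0] fun t => densityForm
      (lor (dz (Y t) w) (dz (Y t) w)) (lor (dz (Y t) w) (dzbar (Y t) w))
      (lor (E t) (dz (dz (Y t)) w)) (lor (E t) (dzbar (dz (Y t)) w)) := by
    filter_upwards [hslice] with t ht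
    exact willmoreDensity_eq (hF.patch t) hw ht.2 h.smooth_liftFactor (h.liftFactor_pos hw) _
  refine (key.congr_of_eventuallyEq hdens).congr_deriv ?_
  rw [hY0, hE0, hc.lor_normal_dz_dz_variation hw (contDiffOn_ofReal hφ) (contDiffOn_ofReal sτ),
    hc.lor_dz_dzbar_variation hw (contDiffOn_ofReal hφ) (contDiffOn_ofReal sτ),
    lor_comm (sphereNormal f w) (dz (dz (lift f)) w), hc.dz_dz_eq hw]
  simp only [lor_add_right, lor_add_left, lor_smul_right, lor_smul_left, e1, e2,
    lor_comm (lift f w) (sphereNormal f w), hc.normal_normal w hw, hc.normal_self w hw]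
  have hns : ((starRingEnd ℂ) (hopf (lift f) (sphereNormal f) w)
      * hopf (lift f) (sphereNormal f) w) = (normSq (hopf (lift f) (sphereNormal f) w) : ℂ) := by
    rw [mul_comm, mul_conj]
  -- The contribution 8τ|k|² of the second-order product is separated here; it cancels the change
  -- -8τ|k|² of the area factor.
  rw [show ∀ k s a b c : ℂ, (starRingEnd ℂ) (-(s / 2) * 0 + k * 1)
      * (-(s / 2) * -a + k * 0 + (b + c * k))
      = (starRingEnd ℂ) k * (b + s / 2 * a) + ((starRingEnd ℂ) k * k) * c by
    intro k s a b c; simp only [mul_zero, mul_one, zero_add]; ring, hns, add_re,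
    ← ofReal_mul, ofReal_re, ofReal_re]
  simp only [mul_zero, mul_one, zero_add]
  ring


/-! ### The Willmore equation -/

/-- The variation of a surface in the sphere along the geodesics in direction of the unit normal. -/
def normalVariation (f : ℂ → EuclideanSpace ℝ (Fin 4)) (ψ : ℂ → ℝ) (t : ℝ) (w : ℂ) :
    EuclideanSpace ℝ (Fin 4) :=
  Real.cos (t * ψ w) • f w + Real.sin (t * ψ w) • unitNormal f w

theorem normalVariation_of_eq_zero {f : ℂ → EuclideanSpace ℝ (Fin 4)} {ψ : ℂ → ℝ} {w : ℂ}
    (hw : ψ w = 0) (t : ℝ) : normalVariation f ψ t w = f w := by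
  simp [normalVariation, hw]

theorem normalVariation_zero (f : ℂ → EuclideanSpace ℝ (Fin 4)) (ψ : ℂ → ℝ) :
    normalVariation f ψ 0 = f := by
  funext w; simp [normalVariation]

theorem hasDerivAt_normalVariation (f : ℂ → EuclideanSpace ℝ (Fin 4)) (ψ : ℂ → ℝ) (w : ℂ) :
    HasDerivAt (fun t => normalVariation f ψ t w) (ψ w • unitNormal f w) 0 := by
  have h0 : HasDerivAt (fun t : ℝ => t * ψ w) (ψ w) 0 := by
    simpa using (hasDerivAt_id (0 : ℝ)).mul_const (ψ w)
  refine ((h0.cos.smul_const (f w)).fun_add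
    (h0.sin.smul_const (unitNormal f w))).congr_deriv ?_
  simp

theorem ConfPatch.sphereFamily {U : Set ℂ} {f : ℂ → EuclideanSpace ℝ (Fin 4)}
    (h : ConfPatch U f) {ψ : ℂ → ℝ} (hψ : ContDiffOn ℝ ∞ ψ U) :
    SphereFamily U (normalVariation f ψ) where
  isOpen := h.isOpen
  smooth := by
    have hsnd : ContDiffOn ℝ ∞ (fun q : ℝ × ℂ => q.2) ((univ : Set ℝ) ×ˢ U) :=
      contDiff_snd.contDiffOn
    have hm : MapsTo (fun q : ℝ × ℂ => q.2) ((univ : Set ℝ) ×ˢ U) U := fun _ hq => hq.2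
    have ht : ContDiffOn ℝ ∞ (fun q : ℝ × ℂ => q.1 * ψ q.2) ((univ : Set ℝ) ×ˢ U) :=
      contDiff_fst.contDiffOn.mul (hψ.comp hsnd hm)
    exact (ht.cos.smul (h.smooth.comp hsnd hm)).add
      (ht.sin.smul (h.smooth_unitNormal.comp hsnd hm))
  norm_eq t w hw := by
    have h1 := h.inner_self hw
    have h2 := h.inner_unitNormal_unitNormal hw (h.discr_pos hw)
    have h3 := inner_unitNormal_self f w
    have : ‖normalVariation f ψ t w‖ ^ 2 = 1 := by
      rw [← real_inner_self_eq_norm_sq, normalVariation]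
      simp only [inner_add_left, inner_add_right, inner_smul_left, inner_smul_right, h1, h2, h3,
        real_inner_comm (unitNormal f w) (f w), conj_trivial]
      linear_combination Real.sin_sq_add_cos_sq (t * ψ w)
    nlinarith [norm_nonneg (normalVariation f ψ t w)]

/-- The Euler–Lagrange equation of the Willmore functional. -/
theorem ConfPatch.willmore_equation {U : Set ℂ} {f : ℂ → EuclideanSpace ℝ (Fin 4)}
    (h : ConfPatch U f)
    (hcrit : ∀ (C : Set ℂ) (F : ℝ → ℂ → EuclideanSpace ℝ (Fin 4)), IsVariation f U C F →
      HasDerivAt (fun t : ℝ => ∫ w in C, willmoreDensity (F t) w) 0 0) {w : ℂ} (hw : w ∈ U) :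
    dzbar (dzbar (hopf (lift f) (sphereNormal f))) w
      + (starRingEnd ℂ) (schwarz (lift f) w) / 2 * hopf (lift f) (sphereNormal f) w = 0 := by
  have hc := h.confFrame
  set k := hopf (lift f) (sphereNormal f) with hk
  have sA := contDiffOn_conj hc.smooth_hopf
  have sB : ContDiffOn ℝ ∞ (fun x => (starRingEnd ℂ) (k x) * (schwarz (lift f) x / 2)) U :=
    sA.mul (hc.smooth_schwarz.div_const 2)
  have key := eq_zero_of_forall_integral h.isOpen sA sB (by
    intro φ hφ hcs hs
    -- Dividing by the lift factor makes φ itself the E-component of the variation of the lift.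
    have sψ : ContDiffOn ℝ ∞ (fun x => φ x / liftFactor f x) U :=
      hφ.contDiffOn.div h.smooth_liftFactor fun x hx => (h.liftFactor_pos hx).ne'
    have hF := h.sphereFamily sψ
    have hF0 := normalVariation_zero f (fun x => φ x / liftFactor f x)
    have hvar : IsVariation f U (tsupport φ)
        (normalVariation f (fun x => φ x / liftFactor f x)) :=
      { smooth := hF.smooth
        mem_sphere := hF.norm_eq
        start := fun x _ => congrFun hF0 x
        isCompact := hcs
        subset := hs
        fixed := fun t x hx => normalVariation_of_eq_zero
          (by simp [image_eq_zero_of_notMem_tsupport hx.2]) t }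
    have hd := hasDerivAt_integral_of_contDiffOn
      (D := fun t => willmoreDensity (normalVariation f (fun x => φ x / liftFactor f x) t))
      hF.isOpen_regular hF.smooth_willmoreDensity
      hcs.isCompact (fun x hx => ⟨⟨trivial, hs hx⟩, by
        simp only [mem_preimage, hF0]; exact h.discr_pos (hs hx)⟩)
    have h0 := hd.unique (hcrit _ _ hvar)
    rw [setIntegral_congr_fun (g := fun w => 8 * ((starRingEnd ℂ) (k w)
        * dz (dz (fun x => (φ x : ℂ))) w
          + (starRingEnd ℂ) (k w) * (schwarz (lift f) w / 2) * φ w).re)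
      hcs.isCompact.measurableSet (fun x hx => by
        have := (hasDerivAt_willmoreDensity h hF hF0 hφ.contDiffOn
          (fun y _ => hasDerivAt_normalVariation f _ y) (hs hx)).deriv
        simp only [this, mul_add, mul_assoc, ← hk]), integral_const_mul] at h0
    linarith)
  have hWre := key w hw
  have e : dz (dz (fun x => (starRingEnd ℂ) (k x))) w = (starRingEnd ℂ) (dzbar (dzbar k) w) := by
    rw [dz_congr h.isOpen (fun x hx => dz_conj (hc.diff hx hc.smooth_hopf)) hw,
      dz_conj (hc.diff hw hc.smooth_dzbar_hopf)]
  -- The real test functions φ give only the real part of the Willmore equation; by Codazzi the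
  -- imaginary part vanishes identically.
  have hcod := hc.codazzi hw
  rw [← hk] at hcod
  have e2 : dz (dz (fun x => (starRingEnd ℂ) (k x))) w
      + (starRingEnd ℂ) (k w) * (schwarz (lift f) w / 2)
      = dzbar (dzbar k) w + (starRingEnd ℂ) (schwarz (lift f) w) / 2 * k w := by
    rw [e, ← hcod]
    simp only [map_add, map_mul, map_div₀, conj_conj, conj_ofNat]
    ring
  rw [e2] at hWre
  obtain ⟨r, hr⟩ := conj_eq_iff_real.1 hcod
  rw [hr] at hWre ⊢
  rw [ofReal_re] at hWre
  rw [hWre, ofReal_zero]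


/-! ### Smooth maps in holomorphic coordinates -/

section Charts

variable {M : Type*} [TopologicalSpace M] [ChartedSpace ℂ M]

/-- Complex analytic coordinate changes are real smooth. Hence M is a real smooth manifold and each
holomorphic coordinate is one of its real charts. -/
theorem contDiffGroupoid_complex_le_real :
    contDiffGroupoid ω 𝓘(ℂ) ≤ contDiffGroupoid ∞ 𝓘(ℝ, ℂ) := by
  apply groupoid_of_pregroupoid_le
  intro f s hf
  have hf' : ContDiffOn ℂ ω (𝓘(ℂ) ∘ f ∘ (𝓘(ℂ)).symm) ((𝓘(ℂ)).symm ⁻¹' s ∩ range 𝓘(ℂ)) := hf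
  exact (hf'.restrict_scalars ℝ).of_le le_top

variable [IsManifold 𝓘(ℂ) ω M]

variable (M) in
theorem isManifold_real : IsManifold 𝓘(ℝ, ℂ) ∞ M where
  compatible he he' := contDiffGroupoid_complex_le_real (HasGroupoid.compatible he he')

omit [IsManifold 𝓘(ℂ) ω M] in
theorem mem_maximalAtlas_real {φ : OpenPartialHomeomorph M ℂ} (hφ : φ ∈ coords M) :
    φ ∈ IsManifold.maximalAtlas 𝓘(ℝ, ℂ) ∞ M :=
  fun e he => ⟨contDiffGroupoid_complex_le_real (hφ e he).1,
    contDiffGroupoid_complex_le_real (hφ e he).2⟩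

theorem contDiffOn_inChart {V : Type*} [NormedAddCommGroup V] [NormedSpace ℝ V] {g : M → V}
    (hg : ContMDiff 𝓘(ℝ, ℂ) 𝓘(ℝ, V) ∞ g) {φ : OpenPartialHomeomorph M ℂ} (hφ : φ ∈ coords M) :
    ContDiffOn ℝ ∞ (fun w => g (φ.symm w)) φ.target := by
  have := isManifold_real M
  rw [← contMDiffOn_iff_contDiffOn]
  exact hg.comp_contMDiffOn (contMDiffOn_symm_of_mem_maximalAtlas (mem_maximalAtlas_real hφ))

omit [IsManifold 𝓘(ℂ) ω M] in
theorem contDiffOn_chartChange {φ φ' : OpenPartialHomeomorph M ℂ} (hφ : φ ∈ coords M)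
    (hφ' : φ' ∈ coords M) :
    ContDiffOn ℂ ω (fun w => φ (φ'.symm w)) (φ'.target ∩ φ'.symm ⁻¹' φ.source) := by
  have h := contMDiffOn_of_mem_contDiffGroupoid
    ((contDiffGroupoid ω 𝓘(ℂ)).compatible_of_mem_maximalAtlas hφ' hφ)
  exact contMDiffOn_iff_contDiffOn.1 h

end Charts

theorem chart_mem_coords {M : Type*} [TopologicalSpace M] [ChartedSpace ℂ M]
    [IsManifold 𝓘(ℂ) ω M] (p : M) : chartAt ℂ p ∈ coords M :=
  IsManifold.chart_mem_maximalAtlas p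

theorem IsConformalImmersion.confPatch {M : Type*} [TopologicalSpace M] [ChartedSpace ℂ M]
    [IsManifold 𝓘(ℂ) ω M] {y : M → Metric.sphere (0 : EuclideanSpace ℝ (Fin 4)) 1}
    (hy : IsConformalImmersion y) {φ : OpenPartialHomeomorph M ℂ} (hφ : φ ∈ coords M) :
    ConfPatch φ.target (inCoord y φ) where
  isOpen := φ.open_target
  smooth := contDiffOn_inChart hy.1 hφ
  norm_eq w _ := norm_eq_of_mem_sphere (y (φ.symm w))
  pos w hw := (hy.2 φ hφ w hw).1
  coeffE_eq w hw := (hy.2 φ hφ w hw).2.1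
  coeffF_eq w hw := (hy.2 φ hφ w hw).2.2

/-! ### Osculating spheres -/

/-- The vector `A` is orthogonal to the mean curvature sphere of `Z` at `w`. -/
structure Osculates (A : Mink) (Z : ℂ → Mink) (w : ℂ) : Prop where
  lor_self : lor A (Z w) = 0
  lor_dz : lor A (dz Z w) = 0
  lor_dzbar : lor A (dzbar Z w) = 0
  lor_dzbar_dz : lor A (dzbar (dz Z) w) = 0

theorem Osculates.congr {A : Mink} {Z Z' : ℂ → Mink} {U : Set ℂ} (hU : IsOpen U)
    (e : EqOn Z' Z U) {w : ℂ} (hw : w ∈ U) (h : Osculates A Z w) : Osculates A Z' w where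
  lor_self := by rw [e hw, h.lor_self]
  lor_dz := by rw [dz_congr hU e hw, h.lor_dz]
  lor_dzbar := by rw [dzbar_congr hU e hw, h.lor_dzbar]
  lor_dzbar_dz := by
    rw [dzbar_congr hU (fun x hx => dz_congr hU e hx) hw, h.lor_dzbar_dz]

/-- The derivatives of lZ up to the mixed second one are combinations of Z, Z_z, Z_z̄, Z_zz̄, so the
osculating condition depends on the surface and not on its lift. -/
theorem Osculates.smul {A : Mink} {Z : ℂ → Mink} {l : ℂ → ℂ} {U : Set ℂ} (hU : IsOpen U)
    (hZ : ContDiffOn ℝ ∞ Z U) (hl : ContDiffOn ℝ ∞ l U) {w : ℂ} (hw : w ∈ U)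
    (h : Osculates A Z w) : Osculates A (fun x => l x • Z x) w where
  lor_self := by rw [lor_smul_right, h.lor_self, mul_zero]
  lor_dz := by
    rw [dz_smul (hl.differentiableAt_of_isOpen hU hw) (hZ.differentiableAt_of_isOpen hU hw),
      lor_add_right, lor_smul_right, lor_smul_right, h.lor_self, h.lor_dz]
    ring
  lor_dzbar := by
    rw [dzbar_smul (hl.differentiableAt_of_isOpen hU hw) (hZ.differentiableAt_of_isOpen hU hw),
      lor_add_right, lor_smul_right, lor_smul_right, h.lor_self, h.lor_dzbar]
    ring
  lor_dzbar_dz := by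
    have dl := hl.differentiableAt_of_isOpen hU hw
    have dZ := hZ.differentiableAt_of_isOpen hU hw
    have dl' := (contDiffOn_dz hl hU).differentiableAt_of_isOpen hU hw
    have dZ' := (contDiffOn_dz hZ hU).differentiableAt_of_isOpen hU hw
    rw [dzbar_congr hU (fun x hx => dz_smul (hl.differentiableAt_of_isOpen hU hx)
        (hZ.differentiableAt_of_isOpen hU hx)) hw,
      dzbar_add (dl'.fun_smul dZ) (dl.fun_smul dZ'), dzbar_smul dl' dZ, dzbar_smul dl dZ']
    simp only [lor_add_right, lor_smul_right, h.lor_self, h.lor_dz, h.lor_dzbar, h.lor_dzbar_dz]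
    ring

theorem apply_eq_re_im {V : Type*} [NormedAddCommGroup V] [NormedSpace ℂ V] (D : ℂ →L[ℝ] V)
    (v : ℂ) : D v = (v.re : ℂ) • D 1 + (v.im : ℂ) • D I := by
  rw [coe_smul, coe_smul, ← map_smul, ← map_smul, ← map_add]
  congr 1
  simp [re_add_im]

theorem fderiv_comp_holomorphic {V : Type*} [NormedAddCommGroup V] [NormedSpace ℂ V]
    {g : ℂ → V} {ψ : ℂ → ℂ} {a w : ℂ} (hg : DifferentiableAt ℝ g (ψ w)) (hψ : HasDerivAt ψ a w)
    (v : ℂ) : fderiv ℝ (fun x => g (ψ x)) w v = fderiv ℝ g (ψ w) (v * a) := by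
  have e : HasFDerivAt (fun x => g (ψ x)) _ w :=
    hg.hasFDerivAt.comp w (hψ.hasFDerivAt.restrictScalars ℝ)
  rw [e.fderiv]
  simp

/-- The chain rule for `∂_z` and a holomorphic inner map. -/
theorem dz_comp {V : Type*} [NormedAddCommGroup V] [NormedSpace ℂ V] {g : ℂ → V} {ψ : ℂ → ℂ}
    {a w : ℂ} (hg : DifferentiableAt ℝ g (ψ w)) (hψ : HasDerivAt ψ a w) :
    dz (fun x => g (ψ x)) w = a • dz g (ψ w) := by
  rw [dz, dz, fderiv_comp_holomorphic hg hψ, fderiv_comp_holomorphic hg hψ,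
    apply_eq_re_im _ (1 * a), apply_eq_re_im _ (I * a)]
  obtain ⟨p, q, rfl⟩ : ∃ p q : ℝ, a = p + q * I := ⟨a.re, a.im, (re_add_im a).symm⟩
  have hI : I * I = -1 := I_mul_I
  simp only [one_mul, I_mul_re, I_mul_im, add_re, add_im, ofReal_re, ofReal_im, re_ofReal_mul,
    im_ofReal_mul, I_re, I_im, ofReal_neg, mul_zero, mul_one, add_zero, zero_add]
  match_scalars
  · ring
  · linear_combination (1 / 2 * q : ℂ) * hI

/-- The chain rule for `∂_z̄` and a holomorphic inner map. -/
theorem dzbar_comp {V : Type*} [NormedAddCommGroup V] [NormedSpace ℂ V] {g : ℂ → V} {ψ : ℂ → ℂ}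
    {a w : ℂ} (hg : DifferentiableAt ℝ g (ψ w)) (hψ : HasDerivAt ψ a w) :
    dzbar (fun x => g (ψ x)) w = (starRingEnd ℂ) a • dzbar g (ψ w) := by
  rw [dzbar, dzbar, fderiv_comp_holomorphic hg hψ, fderiv_comp_holomorphic hg hψ,
    apply_eq_re_im _ (1 * a), apply_eq_re_im _ (I * a)]
  obtain ⟨p, q, rfl⟩ : ∃ p q : ℝ, a = p + q * I := ⟨a.re, a.im, (re_add_im a).symm⟩
  have hI : I * I = -1 := I_mul_I
  simp only [one_mul, I_mul_re, I_mul_im, add_re, add_im, ofReal_re, ofReal_im, re_ofReal_mul,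
    im_ofReal_mul, I_re, I_im, ofReal_neg, mul_zero, mul_one, add_zero, zero_add, map_add,
    map_mul, conj_ofReal, conj_I]
  match_scalars
  · ring
  · linear_combination (1 / 2 * q : ℂ) * hI

theorem dzbar_of_holomorphic {ψ : ℂ → ℂ} {a w : ℂ} (hψ : HasDerivAt ψ a w) :
    dzbar ψ w = 0 := by
  have e : HasFDerivAt ψ _ w := hψ.hasFDerivAt.restrictScalars ℝ
  rw [dzbar, e.fderiv]
  simp only [ContinuousLinearMap.coe_restrictScalars', ContinuousLinearMap.toSpanSingleton_apply,
    smul_eq_mul]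
  linear_combination (1 / 2 : ℂ) * a * I_mul_I

/-- For holomorphic ψ the mixed derivative of Z∘ψ is |ψ'|² Z_zz̄∘ψ, without a first-order term,
because (ψ')_z̄ = 0. -/
theorem Osculates.comp {A : Mink} {Z : ℂ → Mink} {ψ : ℂ → ℂ} {U W : Set ℂ} (hU : IsOpen U)
    (hW : IsOpen W) (hZ : ContDiffOn ℝ ∞ Z U) (hψ : DifferentiableOn ℂ ψ W) (hm : MapsTo ψ W U)
    {w : ℂ} (hw : w ∈ W) (h : Osculates A Z (ψ w)) : Osculates A (fun x => Z (ψ x)) w := by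
  have hd : ∀ x ∈ W, HasDerivAt ψ (deriv ψ x) x := fun x hx =>
    (hψ.differentiableAt (hW.mem_nhds hx)).hasDerivAt
  have hd2 : HasDerivAt (deriv ψ) (deriv (deriv ψ) w) w :=
    ((hψ.deriv hW).differentiableAt (hW.mem_nhds hw)).hasDerivAt
  have dZ := fun x (hx : x ∈ W) => hZ.differentiableAt_of_isOpen hU (hm hx)
  have dZ' := (contDiffOn_dz hZ hU).differentiableAt_of_isOpen hU (hm hw)
  have d1 : DifferentiableAt ℝ (deriv ψ) w := hd2.differentiableAt.restrictScalars ℝ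
  have d2 : DifferentiableAt ℝ (fun x => dz Z (ψ x)) w :=
    dZ'.comp w ((hd w hw).differentiableAt.restrictScalars ℝ)
  constructor
  · exact h.lor_self
  · rw [dz_comp (dZ w hw) (hd w hw), lor_smul_right, h.lor_dz, mul_zero]
  · rw [dzbar_comp (dZ w hw) (hd w hw), lor_smul_right, h.lor_dzbar, mul_zero]
  · rw [dzbar_congr hW (fun x hx => dz_comp (dZ x hx) (hd x hx)) hw, dzbar_smul d1 d2,
      dzbar_of_holomorphic hd2, dzbar_comp dZ' (hd w hw), zero_smul, zero_add, lor_smul_right,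
      lor_smul_right, h.lor_dzbar_dz]
    ring

namespace ConfFrame

variable {U : Set ℂ} {Y E : ℂ → Mink} (h : ConfFrame U Y E) {w : ℂ} (hw : w ∈ U)

include h hw

theorem osculates : Osculates (E w) Y w :=
  ⟨h.normal_self w hw, h.normal_dz w hw, h.normal_dzbar hw, h.normal_dzbar_dz w hw⟩

/-- N is a combination of Y_zz̄ and Y, so every frame component of A except the one along E is zero.
-/
theorem eq_smul_of_osculates {A : Mink} (hA : Osculates A Y w) : A = lor A (E w) • E w := by
  have hN : lor A (nullN Y w) = 0 := by
    rw [nullN, lor_add_right, lor_smul_right, lor_smul_right, hA.lor_self, hA.lor_dzbar_dz]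
    ring
  have e := h.expand hw A
  rw [hN, hA.lor_self, hA.lor_dz, hA.lor_dzbar] at e
  simpa using e

end ConfFrame

/-- The mean curvature spheres do not depend on the holomorphic coordinate. -/
theorem ConfPatch.sphereNormal_comp {U W : Set ℂ} {f f' : ℂ → EuclideanSpace ℝ (Fin 4)}
    (h : ConfPatch U f) (h' : ConfPatch W f') {ψ : ℂ → ℂ} {S : Set ℂ} (hS : IsOpen S)
    (hSW : S ⊆ W) (hψ : DifferentiableOn ℂ ψ S) (hm : MapsTo ψ S U)
    (e : ∀ x ∈ S, f' x = f (ψ x)) {w : ℂ} (hw : w ∈ S) :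
    ∃ c : ℂ, sphereNormal f (ψ w) = c • sphereNormal f' w := by
  have h1 := h.confFrame.osculates (hm hw)
  have h2 := h1.comp h.isOpen hS h.smooth_lift hψ hm hw
  have s1 : ContDiffOn ℝ ∞ ψ S := (hψ.contDiffOn hS).restrict_scalars ℝ
  -- The canonical lifts in the two coordinates differ by this real factor.
  have sl : ContDiffOn ℝ ∞ (fun x => ((liftFactor f' x / liftFactor f (ψ x) : ℝ) : ℂ)) S :=
    contDiffOn_ofReal ((h'.smooth_liftFactor.mono hSW).div (h.smooth_liftFactor.comp s1 hm)
      fun x hx => (h.liftFactor_pos (hm hx)).ne')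
  have h3 := h2.smul hS (h.smooth_lift.comp s1 hm) sl hw
  have h4 : Osculates (sphereNormal f (ψ w)) (lift f') w := by
    refine h3.congr hS (fun x hx => ?_) hw
    have hne : (liftFactor f (ψ x) : ℂ) ≠ 0 := by exact_mod_cast (h.liftFactor_pos (hm hx)).ne'
    simp only [lift_eq, e x hx, Function.comp_apply, smul_smul]
    congr 1
    push_cast
    field_simp
  exact ⟨_, h'.confFrame.eq_smul_of_osculates (hSW hw) h4⟩

/-! ### The pole of a surface whose dual surface is constant -/

theorem fderiv_eq_zero_of_dz {V : Type*} [NormedAddCommGroup V] [NormedSpace ℂ V] {g : ℂ → V}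
    {w : ℂ} (h1 : dz g w = 0) (h2 : dzbar g w = 0) : fderiv ℝ g w = 0 := by
  have e1 : fderiv ℝ g w 1 = dz g w + dzbar g w := by
    rw [dz, dzbar]; module
  have e2 : fderiv ℝ g w I = I • (dz g w - dzbar g w) := by
    rw [dz, dzbar]
    match_scalars
    · linear_combination I_mul_I
    · ring
  ext v
  rw [apply_eq_re_im, e1, e2, h1, h2]
  simp

theorem exists_eq_lightVec {c : Mink} (hc : conjM c = c) (hcc : lor c c = 0) (h0 : c 0 = 1) :
    ∃ v : EuclideanSpace ℝ (Fin 4), ‖v‖ = 1 ∧ c = lightVec v := by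
  have hr : ∀ i, ((c i).re : ℂ) = c i := fun i => conj_eq_iff_re.1 (congrFun hc i)
  have e : c = lightVec (WithLp.toLp 2 fun i : Fin 4 => (c i.succ).re) := by
    funext i
    refine Fin.cases ?_ (fun j => ?_) i
    · rw [h0, lightVec_zero_coord]
    · rw [lightVec_succ, hr]
  refine ⟨_, ?_, e⟩
  rw [e, lor_lightVec_lightVec, real_inner_self_eq_norm_sq, sub_eq_zero] at hcc
  norm_cast at hcc
  exact (pow_eq_one_iff_of_nonneg (norm_nonneg _) two_ne_zero).1 hcc

/-- A real null vector with time coordinate 0 is zero, since the Lorentz form is positive definite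
on that hyperplane. -/
theorem coord_zero_ne_zero {c A : Mink} (hc : conjM c = c) (hcc : lor c c = 0)
    (hA : lor c A ≠ 0) : c 0 ≠ 0 := by
  intro h0
  have hr : ∀ i, ((c i).re : ℂ) = c i := fun i => conj_eq_iff_re.1 (congrFun hc i)
  have hs : ∑ i : Fin 4, (c i.succ).re ^ 2 = 0 := by
    rw [lor, h0] at hcc
    have : ((∑ i : Fin 4, (c i.succ).re ^ 2 : ℝ) : ℂ) = 0 := by
      push_cast
      simp only [hr]
      simpa [sq] using hcc
    exact_mod_cast this
  apply hA
  have hz : ∀ i : Fin 4, c i.succ = 0 := by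
    intro i
    have := (Finset.sum_eq_zero_iff_of_nonneg (fun i _ => sq_nonneg _)).1 hs i (Finset.mem_univ i)
    rw [← hr, pow_eq_zero_iff two_ne_zero |>.1 this, ofReal_zero]
  simp [lor, h0, hz]

/-- Near `w` all mean curvature spheres of `f` pass through `v`, and `f` avoids `v`. -/
def IsPole (f : ℂ → EuclideanSpace ℝ (Fin 4)) (v : EuclideanSpace ℝ (Fin 4)) (w : ℂ) : Prop :=
  ∀ᶠ x in nhds w, lor (lightVec v) (sphereNormal f x) = 0
    ∧ lor (lightVec v) (lightVec (f x)) ≠ 0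

namespace ConfPatch

variable {U : Set ℂ} {f : ℂ → EuclideanSpace ℝ (Fin 4)} (h : ConfPatch U f)

include h

theorem mono {V : Set ℂ} (hV : IsOpen V) (hVU : V ⊆ U) : ConfPatch V f where
  isOpen := hV
  smooth := h.smooth.mono hVU
  norm_eq w hw := h.norm_eq w (hVU hw)
  pos w hw := h.pos w (hVU hw)
  coeffE_eq w hw := h.coeffE_eq w (hVU hw)
  coeffF_eq w hw := h.coeffF_eq w (hVU hw)

theorem lor_lift_ne_zero {c : Mink} {w : ℂ} (hw : w ∈ U) :
    lor c (lift f w) ≠ 0 ↔ lor c (lightVec (f w)) ≠ 0 := by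
  have := (h.liftFactor_pos hw).ne'
  rw [lift_eq, lor_smul_right, mul_ne_zero_iff]
  simp [this]

variable (hk : ∀ w ∈ U, hopf (lift f) (sphereNormal f) w ≠ 0)

include hk

/-- Ŷ_z is a multiple of Ŷ, so scaling Ŷ to time coordinate 1 makes it a locally constant real null
vector (1, v). It lies in all mean curvature spheres since ⟨Ŷ, E⟩ = 0, and the surface avoids v
since ⟨Ŷ, Y⟩ = -1. -/
theorem exists_isPole
    (hW : ∀ w ∈ U, dzbar (dzbar (hopf (lift f) (sphereNormal f))) w
      + (starRingEnd ℂ) (schwarz (lift f) w) / 2 * hopf (lift f) (sphereNormal f) w = 0)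
    (hρ : ∀ w ∈ U, frameRho (lift f) (sphereNormal f) w = 0) {w : ℂ} (hw : w ∈ U) :
    ∃ v, ‖v‖ = 1 ∧ IsPole f v w := by
  have hc := h.confFrame
  set D := dualSurface (lift f) (sphereNormal f) with hD
  set m := frameMuBar (lift f) (sphereNormal f)
  have sD : ContDiffOn ℝ ∞ D U := hc.smooth_dualSurface hk
  have sD0 : ContDiffOn ℝ ∞ (fun x => D x 0) U := contDiffOn_pi.1 sD 0
  have hD0 : ∀ x ∈ U, D x 0 ≠ 0 := fun x hx =>
    coord_zero_ne_zero (A := lift f x) (hc.conj_dualSurface hx) (hc.dualSurface_null hx)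
      (by rw [hc.dualSurface_self hx]; norm_num)
  have sI : ContDiffOn ℝ ∞ (fun x => (D x 0)⁻¹) U := sD0.inv hD0
  have sq : ContDiffOn ℝ ∞ (fun x => (D x 0)⁻¹ • D x) U := sI.smul sD
  have hq : ∀ x ∈ U, conjM ((D x 0)⁻¹ • D x) = (D x 0)⁻¹ • D x := by
    intro x hx
    have e := hc.conj_dualSurface hx
    have e0 : (starRingEnd ℂ) (D x 0) = D x 0 := congrFun e 0
    rw [conjM_smul, map_inv₀, e0, e]
  have dq : ∀ x ∈ U, dz (fun x => (D x 0)⁻¹ • D x) x = 0 := by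
    intro x hx
    have d1 := h.diff hx sI
    have d0 := h.diff hx sD0
    have dD := h.diff hx sD
    have e := hc.dz_dualSurface hk hx (hW x hx) (hρ x hx)
    have e0 : dz (fun x => D x 0) x = (starRingEnd ℂ) (m x) / 2 * D x 0 := by
      rw [← dz_apply dD, e]; rfl
    have a := dz_congr h.isOpen (f := fun x => (D x 0)⁻¹ * D x 0) (g := fun _ => (1 : ℂ))
      (fun x hx => inv_mul_cancel₀ (hD0 x hx)) hx
    rw [dz_const, dz_mul d1 d0, e0] at a
    have hne := hD0 x hx
    have a' : dz (fun x => (D x 0)⁻¹) x = -((starRingEnd ℂ) (m x) / 2) * (D x 0)⁻¹ := by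
      field_simp at a ⊢
      linear_combination a
    rw [dz_smul d1 dD, a', e]
    module
  have dqb : ∀ x ∈ U, dzbar (fun x => (D x 0)⁻¹ • D x) x = 0 := by
    intro x hx
    have a := dzbar_conjM (h.diff hx sq)
    rw [dq x hx, dzbar_congr h.isOpen (fun x hx => hq x hx) hx] at a
    rw [a]
    funext i
    simp [conjM]
  -- The coordinate domain may be disconnected, so constancy is concluded on a ball.
  obtain ⟨r, hr, hB⟩ := Metric.isOpen_iff.1 h.isOpen w hw
  obtain ⟨c, hcq⟩ := Metric.isOpen_ball.exists_is_const_of_fderiv_eq_zero (𝕜 := ℝ)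
    (convex_ball w r).isPreconnected (f := fun x => (D x 0)⁻¹ • D x)
    (fun x hx => (h.diff (hB hx) sq).differentiableWithinAt)
    (fun x hx => fderiv_eq_zero_of_dz (dq x (hB hx)) (dqb x (hB hx)))
  have hww := hcq w (Metric.mem_ball_self hr)
  obtain ⟨v, hv1, hv⟩ := exists_eq_lightVec (c := c) (by rw [← hww]; exact hq w hw)
    (by rw [← hww, lor_smul_left, lor_smul_right, hc.dualSurface_null hw]; simp)
    (by rw [← hww]; exact inv_mul_cancel₀ (hD0 w hw))
  refine ⟨v, hv1, Filter.mem_of_superset (Metric.ball_mem_nhds w hr) fun x hx => ?_⟩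
  have hxU := hB hx
  have hx' : (D x 0)⁻¹ • D x = lightVec v := (hcq x hx).trans hv
  constructor
  · rw [← hx', lor_smul_left, hc.dualSurface_normal hxU, mul_zero]
  · rw [← h.lor_lift_ne_zero hxU, ← hx', lor_smul_left, hc.dualSurface_self hxU]
    simpa using hD0 x hxU

/-- Both null vectors are multiples of Ŷ at w, and the time coordinate 1 fixes the multiple. The
pole condition has to hold near w, because `ConfFrame.eq_dualSurface` differentiates it. -/
theorem isPole_unique {v v' : EuclideanSpace ℝ (Fin 4)} (hv : ‖v‖ = 1) (hv' : ‖v'‖ = 1) {w : ℂ}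
    (hw : w ∈ U) (p : IsPole f v w) (p' : IsPole f v' w) : v = v' := by
  obtain ⟨V, hV, hVo, hwV⟩ := eventually_nhds_iff.1 (p.and (p'.and (h.isOpen.mem_nhds hw)))
  have h' := h.mono hVo fun x hx => (hV x hx).2.2
  have key : ∀ a : EuclideanSpace ℝ (Fin 4), ‖a‖ = 1 →
      (∀ x ∈ V, lor (lightVec a) (sphereNormal f x) = 0) →
      lor (lightVec a) (lightVec (f w)) ≠ 0 →
      ∃ r : ℂ, lightVec a = r • dualSurface (lift f) (sphereNormal f) w := by
    intro a ha h1 h2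
    refine ⟨_, h'.confFrame.eq_dualSurface (fun x hx => hk x (hV x hx).2.2) hwV h1
      (conjM_lightVec a) ?_ ((h'.lor_lift_ne_zero hwV).2 h2)⟩
    rw [lor_lightVec_lightVec, real_inner_self_eq_norm_sq, ha]
    simp
  obtain ⟨r, hr⟩ := key v hv (fun x hx => (hV x hx).1.1) (hV w hwV).1.2
  obtain ⟨r', hr'⟩ := key v' hv' (fun x hx => (hV x hx).2.1.1) (hV w hwV).2.1.2
  have e : lightVec v = lightVec v' := by
    have a := congrFun hr 0
    have a' := congrFun hr' 0
    rw [lightVec_zero_coord, Pi.smul_apply, smul_eq_mul] at a a'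
    have hD : dualSurface (lift f) (sphereNormal f) w 0 ≠ 0 := by
      intro e; rw [e, mul_zero] at a; exact one_ne_zero a
    rw [hr, hr', mul_right_cancel₀ hD (a.symm.trans a')]
  ext i
  have := congrFun e i.succ
  rw [lightVec_succ, lightVec_succ] at this
  exact_mod_cast this

omit hk in
-- At corresponding points the sphere normals in the two coordinates are proportional, with nonzero
-- factor since both are unit vectors; hence they are orthogonal to the same vectors.
theorem isPole_comp {W : Set ℂ} {f' : ℂ → EuclideanSpace ℝ (Fin 4)}
    (h' : ConfPatch W f') {ψ : ℂ → ℂ} {S : Set ℂ} (hS : IsOpen S)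
    (hSW : S ⊆ W) (hψ : DifferentiableOn ℂ ψ S) (hm : MapsTo ψ S U)
    (e : ∀ x ∈ S, f' x = f (ψ x)) {w : ℂ} (hw : w ∈ S) {v : EuclideanSpace ℝ (Fin 4)}
    (p : IsPole f v (ψ w)) : IsPole f' v w := by
  have hcont : ContinuousAt ψ w := (hψ.differentiableAt (hS.mem_nhds hw)).continuousAt
  filter_upwards [hS.mem_nhds hw, hcont.eventually p] with x hx hp
  refine ⟨?_, by rw [e x hx]; exact hp.2⟩
  obtain ⟨c, hc⟩ := h.sphereNormal_comp h' hS hSW hψ hm e hx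
  have hc0 : c ≠ 0 := by
    rintro rfl
    have := h.confFrame.normal_normal _ (hm hx)
    rw [hc, zero_smul, lor_zero_left] at this
    exact zero_ne_one this
  have := hp.1
  rw [hc, lor_smul_right] at this
  exact (mul_eq_zero.1 this).resolve_left hc0

end ConfPatch

/-- A surface with local poles has one pole. -/
theorem exists_pole {M : Type*} [TopologicalSpace M] [ConnectedSpace M]
    [ChartedSpace ℂ M] [IsManifold 𝓘(ℂ) ω M]
    {y : M → Metric.sphere (0 : EuclideanSpace ℝ (Fin 4)) 1} (hy : IsConformalImmersion y)
    (hk : ∀ φ ∈ coords M, ∀ w ∈ φ.target,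
      hopf (lift (inCoord y φ)) (sphereNormal (inCoord y φ)) w ≠ 0)
    (hp : ∀ φ ∈ coords M, ∀ w ∈ φ.target, ∃ v, ‖v‖ = 1 ∧ IsPole (inCoord y φ) v w) :
    ∃ v, ‖v‖ = 1 ∧ ∀ φ ∈ coords M, ∀ w ∈ φ.target, IsPole (inCoord y φ) v w := by
  have hchange : ∀ φ ∈ coords M, ∀ φ' ∈ coords M, ∀ p ∈ φ.source, p ∈ φ'.source → ∀ v,
      IsPole (inCoord y φ) v (φ p) → IsPole (inCoord y φ') v (φ' p) := by
    intro φ hφ φ' hφ' p hp hp' v hv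
    refine (hy.confPatch hφ).isPole_comp (hy.confPatch hφ')
      (ψ := fun w => φ (φ'.symm w)) (S := φ'.target ∩ φ'.symm ⁻¹' φ.source)
      (φ'.isOpen_inter_preimage_symm φ.open_source) inter_subset_left
      ((contDiffOn_chartChange hφ hφ').differentiableOn (by simp))
      (fun x hx => φ.map_source hx.2) (fun x hx => ?_) ⟨φ'.map_source hp', ?_⟩ ?_
    · simp only [inCoord, φ.left_inv hx.2]
    · simpa [φ'.left_inv hp'] using hp
    · simpa [φ'.left_inv hp'] using hv
  have hp' : ∀ p : M, ∃ v, ‖v‖ = 1 ∧ IsPole (inCoord y (chartAt ℂ p)) v (chartAt ℂ p p) :=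
    fun p => hp _ (chart_mem_coords p) _ (mem_chart_target ℂ p)
  choose v hv1 hv using hp'
  -- Near p the point v p remains a pole. At a nearby q the pole v q, transported to the chart of p,
  -- is a pole at the same place, so the two coincide.
  have hloc : IsLocallyConstant v := by
    rw [IsLocallyConstant.iff_eventually_eq]
    intro p
    have hφ := chart_mem_coords p
    have hcont := (chartAt ℂ p).continuousAt (mem_chart_source ℂ p)
    filter_upwards [(chartAt ℂ p).open_source.mem_nhds (mem_chart_source ℂ p),
      hcont.eventually (eventually_eventually_nhds.2 (hv p))] with q hq hqp
    exact (hy.confPatch hφ).isPole_unique (hk _ hφ) (hv1 q) (hv1 p)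
      ((chartAt ℂ p).map_source hq)
      (hchange _ (chart_mem_coords q) _ hφ q (mem_chart_source ℂ q) hq _ (hv q)) hqp
  obtain ⟨p₀⟩ : Nonempty M := inferInstance
  refine ⟨v p₀, hv1 p₀, fun φ hφ w hw => ?_⟩
  have hs := φ.map_target hw
  have := hchange _ (chart_mem_coords (φ.symm w)) φ hφ _ (mem_chart_source ℂ _) hs _
    (hv (φ.symm w))
  rwa [φ.right_inv hw, hloc.apply_eq_of_preconnectedSpace _ p₀] at this

/-! ### Stereographic projection -/

/-- The inverse of the stereographic projection from `v`, where `J` identifies `ℝ³` with `v^⊥`. -/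
def stereoMap (J : EuclideanSpace ℝ (Fin 3) →ₗᵢ[ℝ] EuclideanSpace ℝ (Fin 4))
    (v : EuclideanSpace ℝ (Fin 4)) (a : EuclideanSpace ℝ (Fin 3)) : EuclideanSpace ℝ (Fin 4) :=
  (‖a‖ ^ 2 + 4)⁻¹ • ((4 : ℝ) • J a + (‖a‖ ^ 2 - 4) • v)

/-- The lift of `ℝ³` to the light cone that is isometric. -/
def stereoLift (J : EuclideanSpace ℝ (Fin 3) →ₗᵢ[ℝ] EuclideanSpace ℝ (Fin 4))
    (v : EuclideanSpace ℝ (Fin 4)) (a : EuclideanSpace ℝ (Fin 3)) : Mink :=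
  lightVec (J a) + ((‖a‖ ^ 2 / 4 : ℝ) : ℂ) • lightVec v + embL (-v)

/-- The factor is the time coordinate 1 + |a|²/4 of `stereoLift`. The isometric lift of ℝ³ is thus a
lift of the inverse stereographic projection, which is how the geometries of ℝ³ and of the sphere
are compared. -/
theorem stereoLift_eq (J : EuclideanSpace ℝ (Fin 3) →ₗᵢ[ℝ] EuclideanSpace ℝ (Fin 4))
    (v : EuclideanSpace ℝ (Fin 4)) (a : EuclideanSpace ℝ (Fin 3)) :
    stereoLift J v a = (((‖a‖ ^ 2 + 4) / 4 : ℝ) : ℂ) • lightVec (stereoMap J v a) := by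
  have h : (‖a‖ : ℂ) ^ 2 + 4 ≠ 0 := by
    have : ‖a‖ ^ 2 + 4 ≠ 0 := by positivity
    exact_mod_cast this
  funext i
  refine Fin.cases ?_ (fun j => ?_) i
  · simp [stereoLift, lightVec_zero_coord, embL_zero_coord]
    ring
  · simp [stereoLift, lightVec_succ, embL_succ, stereoMap]
    field_simp
    ring

/-- The normal component of the Laplacian decides whether a conformal surface is minimal. -/
theorem meanCurvatureR3_eq_zero_iff {X : ℂ → EuclideanSpace ℝ (Fin 3)} {w : ℂ}
    (h0 : 0 < coeffE X w) (hE : coeffE X w = coeffG X w) (hF : coeffF X w = 0) :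
    meanCurvatureR3 X w = 0 ↔ ∃ e : EuclideanSpace ℝ (Fin 3), e ≠ 0 ∧ inner ℝ e (pu X w) = (0 : ℝ)
      ∧ inner ℝ e (pv X w) = (0 : ℝ)
      ∧ inner ℝ e (pu (pu X) w + pv (pv X) w) = (0 : ℝ) := by
  have hs : areaDensity X w = coeffE X w := by
    rw [areaDensity, ← hE, hF, show coeffE X w * coeffE X w - 0 ^ 2 = coeffE X w ^ 2 by ring,
      Real.sqrt_sq h0.le]
  have hdet : meanCurvatureR3 X w = 0 ↔ Matrix.det (Matrix.of fun i j : Fin 3 =>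
      (![pu X w, pv X w, pu (pu X) w + pv (pv X) w] i) j) = 0 := by
    have hd : ∀ a b c : EuclideanSpace ℝ (Fin 3), Matrix.det (fun i j : Fin 3 => (![a, b, c] i) j)
        = a 0 * b 1 * c 2 - a 0 * b 2 * c 1 - a 1 * b 0 * c 2 + a 1 * b 2 * c 0
          + a 2 * b 0 * c 1 - a 2 * b 1 * c 0 := by
      intro a b c
      change Matrix.det (Matrix.of fun i j : Fin 3 => (![a, b, c] i) j) = _
      rw [Matrix.det_fin_three]
      rfl
    -- Conformality collapses the mean curvature to a single determinant, so it vanishes exactly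
    -- when X_u, X_v and the Laplacian of X have a common nonzero orthogonal vector.
    have e : Matrix.det (fun i j : Fin 3 => (![pu X w, pv X w, pu (pu X) w + pv (pv X) w] i) j)
        = 2 * coeffE X w ^ 2 * meanCurvatureR3 X w := by
      rw [meanCurvatureR3, pairNormalR3, pairNormalR3, pairNormalR3, hs, ← hE, hF, hd, hd, hd, hd]
      field_simp
      simp only [PiLp.add_apply]
      ring
    change _ ↔ Matrix.det (fun i j : Fin 3 => (![pu X w, pv X w, pu (pu X) w + pv (pv X) w] i) j)
      = 0
    rw [e]
    simp [h0.ne']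
  rw [hdet, ← Matrix.exists_mulVec_eq_zero_iff]
  have hinner : ∀ a b : EuclideanSpace ℝ (Fin 3), (inner ℝ a b : ℝ)
      = b 0 * a 0 + b 1 * a 1 + b 2 * a 2 := by
    intro a b
    simp [PiLp.inner_apply, Fin.sum_univ_three]
  constructor
  · rintro ⟨e, he, h⟩
    refine ⟨WithLp.toLp 2 e, fun h' => he (by simpa using h'), ?_, ?_, ?_⟩
    · have := congrFun h 0
      simpa [Matrix.mulVec, dotProduct, Fin.sum_univ_three, hinner] using this
    · have := congrFun h 1
      simpa [Matrix.mulVec, dotProduct, Fin.sum_univ_three, hinner] using this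
    · have := congrFun h 2
      rw [hinner]
      simpa [Matrix.mulVec, dotProduct, Fin.sum_univ_three] using this
  · rintro ⟨e, he, h1, h2, h3⟩
    rw [hinner] at h1 h2 h3
    refine ⟨e.ofLp, fun h' => he (by ext i; exact congrFun h' i), ?_⟩
    funext i
    fin_cases i
    · simpa [Matrix.mulVec, dotProduct, Fin.sum_univ_three] using h1
    · simpa [Matrix.mulVec, dotProduct, Fin.sum_univ_three] using h2
    · simpa [Matrix.mulVec, dotProduct, Fin.sum_univ_three] using h3

/-- A surface patch in `ℝ³`, together with an identification of `ℝ³` with `v^⊥`. -/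
structure StereoPatch (U : Set ℂ) (X : ℂ → EuclideanSpace ℝ (Fin 3))
    (J : EuclideanSpace ℝ (Fin 3) →ₗᵢ[ℝ] EuclideanSpace ℝ (Fin 4))
    (v : EuclideanSpace ℝ (Fin 4)) : Prop where
  isOpen : IsOpen U
  smooth : ContDiffOn ℝ ∞ X U
  norm_pole : ‖v‖ = 1
  inner_pole : ∀ a, inner ℝ (J a) v = (0 : ℝ)
  exists_eq : ∀ s, inner ℝ s v = (0 : ℝ) → ∃ a, J a = s

namespace StereoPatch

variable {U : Set ℂ} {X : ℂ → EuclideanSpace ℝ (Fin 3)}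
  {J : EuclideanSpace ℝ (Fin 3) →ₗᵢ[ℝ] EuclideanSpace ℝ (Fin 4)} {v : EuclideanSpace ℝ (Fin 4)}
  (h : StereoPatch U X J v)

include h

theorem smoothPatch : SmoothPatch U (fun w => J (X w)) :=
  ⟨h.isOpen, J.toContinuousLinearMap.contDiff.comp_contDiffOn h.smooth⟩

theorem fderiv_comp {g : ℂ → EuclideanSpace ℝ (Fin 3)} (hg : ContDiffOn ℝ ∞ g U) {w : ℂ}
    (hw : w ∈ U) (a : ℂ) : fderiv ℝ (fun x => J (g x)) w a = J (fderiv ℝ g w a) := by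
  have : HasFDerivAt (fun x => J (g x)) (J.toContinuousLinearMap.comp (fderiv ℝ g w)) w :=
    J.toContinuousLinearMap.hasFDerivAt.comp w
      (hg.differentiableAt_of_isOpen h.isOpen hw).hasFDerivAt
  rw [this.fderiv]
  rfl

theorem smooth_coeff : ContDiffOn ℝ ∞ (fun w => ((‖X w‖ ^ 2 / 4 : ℝ) : ℂ)) U :=
  contDiffOn_ofReal ((h.smooth.norm_sq ℝ).div_const 4)

theorem smooth_stereoLift : ContDiffOn ℝ ∞ (fun w => stereoLift J v (X w)) U :=
  (h.smoothPatch.smooth_lightVec.add (h.smooth_coeff.smul contDiffOn_const)).add contDiffOn_const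

theorem lor_pole_pole : lor (lightVec v) (lightVec v) = 0 := by
  rw [lor_lightVec_lightVec, real_inner_self_eq_norm_sq, h.norm_pole]
  simp

theorem lor_pole_embL (a : EuclideanSpace ℝ (Fin 3)) : lor (lightVec v) (embL (J a)) = 0 := by
  rw [lor_lightVec_embL, real_inner_comm, h.inner_pole, ofReal_zero]

theorem lor_pole_stereoLift (a : EuclideanSpace ℝ (Fin 3)) :
    lor (lightVec v) (stereoLift J v a) = -2 := by
  rw [stereoLift, lor_add_right, lor_add_right, lor_smul_right, h.lor_pole_pole,
    lor_lightVec_lightVec, lor_lightVec_embL, real_inner_comm, h.inner_pole, inner_neg_right,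
    real_inner_self_eq_norm_sq, h.norm_pole]
  norm_num

variable {w : ℂ} (hw : w ∈ U)

include hw

theorem diff {V : Type*} [NormedAddCommGroup V] [NormedSpace ℝ V] {g : ℂ → V}
    (hg : ContDiffOn ℝ ∞ g U) : DifferentiableAt ℝ g w := hg.differentiableAt_of_isOpen h.isOpen hw

theorem pu_comp : pu (fun x => J (X x)) w = J (pu X w) := h.fderiv_comp h.smooth hw 1

theorem pv_comp : pv (fun x => J (X x)) w = J (pv X w) := h.fderiv_comp h.smooth hw I

theorem pu_pu_comp : pu (pu (fun x => J (X x))) w = J (pu (pu X) w) := by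
  rw [pu, fderiv_congr_of_isOpen h.isOpen (fun x hx => h.pu_comp hx) hw]
  exact h.fderiv_comp (h.smooth.fderiv_apply_const h.isOpen 1) hw 1

theorem pv_pv_comp : pv (pv (fun x => J (X x))) w = J (pv (pv X) w) := by
  rw [pv, fderiv_congr_of_isOpen h.isOpen (fun x hx => h.pv_comp hx) hw]
  exact h.fderiv_comp (h.smooth.fderiv_apply_const h.isOpen I) hw I

theorem dz_stereoLift : dz (fun x => stereoLift J v (X x)) w
    = dz (fun x => lightVec (J (X x))) w
      + dz (fun x => ((‖X x‖ ^ 2 / 4 : ℝ) : ℂ)) w • lightVec v := by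
  have d1 := h.diff hw h.smoothPatch.smooth_lightVec
  have d2 := h.diff hw h.smooth_coeff
  simp only [stereoLift]
  rw [dz_add (d1.fun_add (d2.fun_smul (differentiableAt_const _))) (differentiableAt_const _),
    dz_add d1 (d2.fun_smul (differentiableAt_const _)), dz_smul d2 (differentiableAt_const _),
    dz_const, dz_const]
  simp

theorem dzbar_stereoLift : dzbar (fun x => stereoLift J v (X x)) w
    = dzbar (fun x => lightVec (J (X x))) w
      + dzbar (fun x => ((‖X x‖ ^ 2 / 4 : ℝ) : ℂ)) w • lightVec v := by
  have d1 := h.diff hw h.smoothPatch.smooth_lightVec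
  have d2 := h.diff hw h.smooth_coeff
  simp only [stereoLift]
  rw [dzbar_add (d1.fun_add (d2.fun_smul (differentiableAt_const _))) (differentiableAt_const _),
    dzbar_add d1 (d2.fun_smul (differentiableAt_const _)),
    dzbar_smul d2 (differentiableAt_const _), dzbar_const, dzbar_const]
  simp

theorem dzbar_dz_stereoLift : dzbar (dz (fun x => stereoLift J v (X x))) w
    = dzbar (dz (fun x => lightVec (J (X x)))) w
      + dzbar (dz (fun x => ((‖X x‖ ^ 2 / 4 : ℝ) : ℂ))) w • lightVec v := by
  have d1 := h.diff hw (contDiffOn_dz h.smoothPatch.smooth_lightVec h.isOpen)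
  have d2 := h.diff hw (contDiffOn_dz h.smooth_coeff h.isOpen)
  rw [dzbar_congr h.isOpen (fun x hx => h.dz_stereoLift hx) hw,
    dzbar_add d1 (d2.fun_smul (differentiableAt_const _)),
    dzbar_smul d2 (differentiableAt_const _), dzbar_const]
  simp

theorem lor_pole_dz : lor (lightVec v) (dz (fun x => lightVec (J (X x))) w) = 0 := by
  rw [h.smoothPatch.dz_lightVec hw, h.pu_comp hw, h.pv_comp hw]
  simp only [lor_smul_right, lor_sub_right, h.lor_pole_embL]
  ring

theorem lor_pole_dzbar : lor (lightVec v) (dzbar (fun x => lightVec (J (X x))) w) = 0 := by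
  rw [h.smoothPatch.dzbar_lightVec hw, h.pu_comp hw, h.pv_comp hw]
  simp only [lor_smul_right, lor_add_right, h.lor_pole_embL]
  ring

/-- The fundamental form of `X` is that of the isometric lift. -/
theorem lor_dz_stereoLift_dz : lor (dz (fun x => stereoLift J v (X x)) w)
    (dz (fun x => stereoLift J v (X x)) w)
    = 1 / 4 * (coeffE X w - coeffG X w - 2 * I * coeffF X w) := by
  have e := h.smoothPatch.lor_dz_lightVec_dz hw
  simp only [coeffE, coeffF, coeffG, h.pu_comp hw, h.pv_comp hw, J.inner_map_map] at e ⊢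
  rw [h.dz_stereoLift hw]
  simp only [lor_add_left, lor_add_right, lor_smul_left, lor_smul_right, h.lor_pole_pole,
    h.lor_pole_dz hw, lor_comm _ (lightVec v), e]
  ring

theorem lor_dz_stereoLift_dzbar : lor (dz (fun x => stereoLift J v (X x)) w)
    (dzbar (fun x => stereoLift J v (X x)) w) = 1 / 4 * (coeffE X w + coeffG X w) := by
  have e := h.smoothPatch.lor_dz_lightVec_dzbar hw
  simp only [coeffE, coeffG, h.pu_comp hw, h.pv_comp hw, J.inner_map_map] at e ⊢
  rw [h.dz_stereoLift hw, h.dzbar_stereoLift hw]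
  simp only [lor_add_left, lor_add_right, lor_smul_left, lor_smul_right, h.lor_pole_pole,
    h.lor_pole_dz hw, h.lor_pole_dzbar hw, lor_comm _ (lightVec v), e]
  ring

/-- A sphere through the pole osculates when the plane of `ℝ³` that it represents is tangent to
`X` and its normal is orthogonal to the Laplacian of `X`. -/
theorem osculates_iff {s : EuclideanSpace ℝ (Fin 4)} {r : ℝ}
    (hs : lor (lightVec v) (embL s + (r : ℂ) • lightVec 0) = 0) :
    Osculates (embL s + (r : ℂ) • lightVec 0) (fun x => stereoLift J v (X x)) w
      ↔ lor (embL s + (r : ℂ) • lightVec 0) (stereoLift J v (X w)) = 0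
        ∧ inner ℝ s (J (pu X w)) = (0 : ℝ) ∧ inner ℝ s (J (pv X w)) = (0 : ℝ)
        ∧ inner ℝ s (J (pu (pu X) w + pv (pv X) w)) = (0 : ℝ) := by
  have key : ∀ a : EuclideanSpace ℝ (Fin 4), lor (embL s + (r : ℂ) • lightVec 0) (embL a)
      = ((inner ℝ s a : ℝ) : ℂ) := by
    intro a
    rw [lor_add_left, lor_smul_left, lor_embL_embL, lor_lightVec_embL, inner_zero_left]
    simp
  rw [lor_comm] at hs
  have e1 : lor (embL s + (r : ℂ) • lightVec 0) (dz (fun x => stereoLift J v (X x)) w)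
      = 1 / 2 * ((inner ℝ s (J (pu X w)) : ℝ) - I * (inner ℝ s (J (pv X w)) : ℝ)) := by
    rw [h.dz_stereoLift hw, h.smoothPatch.dz_lightVec hw, lor_add_right, lor_smul_right,
      lor_smul_right, hs, lor_sub_right, lor_smul_right, key, key, h.pu_comp hw, h.pv_comp hw]
    ring
  have e2 : lor (embL s + (r : ℂ) • lightVec 0) (dzbar (fun x => stereoLift J v (X x)) w)
      = 1 / 2 * ((inner ℝ s (J (pu X w)) : ℝ) + I * (inner ℝ s (J (pv X w)) : ℝ)) := by
    rw [h.dzbar_stereoLift hw, h.smoothPatch.dzbar_lightVec hw, lor_add_right, lor_smul_right,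
      lor_smul_right, hs, lor_add_right, lor_smul_right, key, key, h.pu_comp hw, h.pv_comp hw]
    ring
  have e3 : lor (embL s + (r : ℂ) • lightVec 0) (dzbar (dz (fun x => stereoLift J v (X x))) w)
      = 1 / 4 * ((inner ℝ s (J (pu (pu X) w + pv (pv X) w)) : ℝ) : ℂ) := by
    rw [h.dzbar_dz_stereoLift hw, h.smoothPatch.dzbar_dz_lightVec hw, lor_add_right,
      lor_smul_right, lor_smul_right, hs, lor_add_right, key, key, h.pu_pu_comp hw,
      h.pv_pv_comp hw, map_add, inner_add_right]
    push_cast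
    ring
  constructor
  · rintro ⟨h0, h1, -, h3⟩
    rw [e1] at h1
    rw [e3] at h3
    have h1r := congrArg re h1
    have h1i := congrArg im h1
    refine ⟨h0, ?_, ?_, ?_⟩
    · simpa using h1r
    · simpa using h1i
    · simpa using h3
  · rintro ⟨h0, h1, h2, h3⟩
    exact ⟨h0, by rw [e1, h1, h2]; simp, by rw [e2, h1, h2]; simp, by rw [e3, h3]; simp⟩

omit hw in
theorem smooth_factor : ContDiffOn ℝ ∞ (fun x => (‖X x‖ ^ 2 + 4) / 4) U :=
  ((h.smooth.norm_sq ℝ).add contDiffOn_const).div_const 4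

variable {f : ℂ → EuclideanSpace ℝ (Fin 4)} (hf : ConfPatch U f)
  (e : ∀ x ∈ U, f x = stereoMap J v (X x))

include e

omit h hw in
theorem stereoLift_eqOn : EqOn (fun x => stereoLift J v (X x))
    (fun x => (((‖X x‖ ^ 2 + 4) / 4 : ℝ) : ℂ) • lightVec (f x)) U := fun x hx => by
  simp only [stereoLift_eq, e x hx]

theorem lor_pole_ne_zero : lor (lightVec v) (lightVec (f w)) ≠ 0 := by
  have := h.lor_pole_stereoLift (X w)
  rw [stereoLift_eq, ← e w hw, lor_smul_right] at this
  intro h0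
  rw [h0, mul_zero] at this
  norm_num at this

include hf

/-- `stereoLift` is a positive real multiple of (1, f) and induces the metric of X, so that metric
is a positive multiple of the conformal metric of f. -/
theorem coeffs : 0 < coeffE X w ∧ coeffE X w = coeffG X w ∧ coeffF X w = 0 := by
  have e1 := h.lor_dz_stereoLift_dz hw
  have e2 := h.lor_dz_stereoLift_dzbar hw
  have sl := contDiffOn_ofReal h.smooth_factor
  rw [dz_congr h.isOpen (stereoLift_eqOn e) hw, hf.lor_dz_lift hw sl, ← hf.coeffE_eq w hw,
    hf.coeffF_eq w hw] at e1
  rw [dz_congr h.isOpen (stereoLift_eqOn e) hw, dzbar_congr h.isOpen (stereoLift_eqOn e) hw,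
    hf.lor_dz_dzbar_lift hw sl, ← hf.coeffE_eq w hw] at e2
  have hpos := hf.pos w hw
  have ht : 0 < (‖X w‖ ^ 2 + 4) / 4 := by positivity
  set t := (‖X w‖ ^ 2 + 4) / 4
  have e1' : ((coeffE X w : ℝ) : ℂ) - coeffG X w - 2 * I * coeffF X w = 0 := by
    rw [ofReal_zero] at e1
    linear_combination -4 * e1
  have e1r := congrArg re e1'
  have e1i := congrArg im e1'
  simp at e1r e1i
  have e2' : t ^ 2 * (2 * coeffE f w) = coeffE X w + coeffG X w := by
    have : (t : ℂ) ^ 2 * (2 * coeffE f w) = coeffE X w + coeffG X w := by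
      linear_combination 4 * e2
    exact_mod_cast this
  have : 0 < t ^ 2 * (2 * coeffE f w) := by positivity
  exact ⟨by linarith, by linarith, e1i⟩

theorem osculates_stereoLift {A : Mink} (hA : Osculates A (lift f) w) :
    Osculates A (fun x => stereoLift J v (X x)) w := by
  have sl := contDiffOn_ofReal (h.smooth_factor.mul
    (hf.smooth_liftFactor.inv fun x hx => (hf.liftFactor_pos hx).ne'))
  refine (hA.smul h.isOpen hf.smooth_lift sl hw).congr h.isOpen (fun x hx => ?_) hw
  have hne : (liftFactor f x : ℂ) ≠ 0 := by exact_mod_cast (hf.liftFactor_pos hx).ne'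
  simp only [stereoLift_eq, ← e x hx, lift_eq, smul_smul, Pi.inv_apply]
  congr 1
  push_cast
  field_simp

theorem osculates_lift {A : Mink} (hA : Osculates A (fun x => stereoLift J v (X x)) w) :
    Osculates A (lift f) w := by
  have hpos : ∀ x, (‖X x‖ ^ 2 + 4) / 4 ≠ 0 := fun x => by positivity
  have sl := contDiffOn_ofReal (hf.smooth_liftFactor.mul
    (h.smooth_factor.inv fun x _ => hpos x))
  refine (hA.smul h.isOpen h.smooth_stereoLift sl hw).congr h.isOpen (fun x hx => ?_) hw
  have hne : (((‖X x‖ ^ 2 + 4) / 4 : ℝ) : ℂ) ≠ 0 := by exact_mod_cast hpos x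
  simp only [stereoLift_eq, ← e x hx, lift_eq, smul_smul]
  congr 1
  rw [Pi.inv_apply, ofReal_mul, ofReal_inv, inv_mul_cancel_right₀ hne]

/-- The mean curvature of `X` vanishes where the mean curvature sphere passes through the pole. -/
theorem lor_pole_sphereNormal_iff :
    lor (lightVec v) (sphereNormal f w) = 0 ↔ meanCurvatureR3 X w = 0 := by
  obtain ⟨h0, hE, hF⟩ := h.coeffs hw hf e
  have hfr := hf.confFrame
  rw [meanCurvatureR3_eq_zero_iff h0 hE hF]
  have hcs : ∀ (s : EuclideanSpace ℝ (Fin 4)) (r : ℝ),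
      lor (lightVec v) (embL s + (r : ℂ) • lightVec 0) = ((inner ℝ v s - r : ℝ) : ℂ) := by
    intro s r
    rw [lor_add_right, lor_smul_right, lor_lightVec_embL, lor_lightVec_lightVec, inner_zero_right]
    push_cast
    ring
  have hss : ∀ (s : EuclideanSpace ℝ (Fin 4)) (r : ℝ),
      lor (embL s + (r : ℂ) • lightVec 0) (embL s + (r : ℂ) • lightVec 0)
        = ((inner ℝ s s - r ^ 2 : ℝ) : ℂ) := by
    intro s r
    simp only [lor_add_left, lor_add_right, lor_smul_left, lor_smul_right, lor_embL_embL,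
      lor_comm (embL s) (lightVec 0), lor_lightVec_embL, lor_lightVec_lightVec, inner_zero_left]
    push_cast
    ring
  constructor
  · intro hv
    -- The sphere normal is split into its spatial part s and its time coordinate r. Orthogonality
    -- to (1, v) then reads ⟨v, s⟩ = r, and the unit length reads ⟨s, s⟩ - r² = 1.
    set r := confMean f w
    set s := unitNormal f w + r • f w with hs
    have hN : sphereNormal f w = embL s + (r : ℂ) • lightVec 0 := by
      rw [sphereNormal, lightVec_eq (f w), hs, map_add, map_smul, ← coe_smul]
      module
    have hosc := h.osculates_stereoLift hw hf e (hfr.osculates hw)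
    have hnn := hfr.normal_normal w hw
    rw [hN] at hv hosc hnn
    obtain ⟨-, h1, h2, h3⟩ := (h.osculates_iff hw hv).1 hosc
    rw [hcs] at hv
    rw [hss] at hnn
    have hv' : inner ℝ v s - r = 0 := by exact_mod_cast hv
    have hnn' : inner ℝ s s - r ^ 2 = 1 := by exact_mod_cast hnn
    have hadj : ∀ a, inner ℝ (J.toContinuousLinearMap.adjoint s) a = inner ℝ s (J a) :=
      fun a => ContinuousLinearMap.adjoint_inner_left _ _ _
    refine ⟨J.toContinuousLinearMap.adjoint s, ?_, by rw [hadj, h1], by rw [hadj, h2],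
      by rw [hadj, h3]⟩
    -- If s had no component in v^⊥, then s = rv because ⟨v, s⟩ = r, so ⟨s, s⟩ = r², against ⟨s, s⟩
    -- - r² = 1.
    intro hz
    obtain ⟨a, ha⟩ := h.exists_eq (s - r • v) (by
      rw [inner_sub_left, inner_smul_left, real_inner_self_eq_norm_sq, h.norm_pole,
        real_inner_comm]
      simp
      linarith)
    have h4 := hadj a
    rw [hz, inner_zero_left, ha, inner_sub_right, inner_smul_right, real_inner_comm v s] at h4
    have : inner ℝ v s = r := by linarith
    rw [this] at h4
    nlinarith
  · rintro ⟨n, hn, h1, h2, h3⟩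
    -- The tangent plane with normal n corresponds to A = (γ, Jn + γv) in time and space components.
    -- Equal γ's make A orthogonal to (1, v), and the product of A with the lift of X is ⟨n, X⟩ -
    -- 2γ.
    set γ := inner ℝ n (X w) / 2 with hγ
    have hnv := h.inner_pole n
    have hA0 : lor (lightVec v) (embL (J n + γ • v) + (γ : ℂ) • lightVec 0) = 0 := by
      rw [hcs, inner_add_right, inner_smul_right, real_inner_self_eq_norm_sq, h.norm_pole,
        real_inner_comm, hnv]
      simp
    have hJ : ∀ a, inner ℝ (J n + γ • v) (J a) = inner ℝ n a := by
      intro a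
      rw [inner_add_left, inner_smul_left, real_inner_comm (J a) v, h.inner_pole, J.inner_map_map]
      simp
    have hosc := h.osculates_lift hw hf e ((h.osculates_iff hw hA0).2
      ⟨?_, by rw [hJ, h1], by rw [hJ, h2], by rw [hJ, h3]⟩)
    · have hA := hfr.eq_smul_of_osculates hw hosc
      rw [hA, lor_smul_right] at hA0
      -- A is a multiple of the sphere normal, and the multiple is nonzero because ⟨A, A⟩ = |n|².
      refine (mul_eq_zero.1 hA0).resolve_left fun hz => ?_
      rw [hz, zero_smul] at hA
      have hAA := hss (J n + γ • v) γ
      rw [hA, lor_zero_left, inner_add_right, hJ, inner_smul_right, inner_add_left, hnv,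
        inner_smul_left, real_inner_self_eq_norm_sq v, h.norm_pole] at hAA
      have hAA' : (0 : ℝ) = inner ℝ n n + γ * (0 + γ * 1 ^ 2) - γ ^ 2 := by exact_mod_cast hAA
      apply hn
      rw [← inner_self_eq_zero (𝕜 := ℝ)]
      linarith
    · have hv0 : lor (embL (J n + γ • v) + (γ : ℂ) • lightVec 0) (lightVec v) = 0 := by
        rw [lor_comm, hA0]
      rw [stereoLift, lor_add_right, lor_add_right, lor_smul_right, hv0, lightVec_eq (J (X w)),
        lor_add_right]
      simp only [lor_add_left, lor_smul_left, lor_comm (embL (J n + γ • v)) (lightVec 0),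
        lor_lightVec_embL, lor_embL_embL, lor_lightVec_lightVec, hJ, inner_zero_left,
        inner_neg_right, inner_add_left, inner_smul_left, hnv, real_inner_self_eq_norm_sq,
        h.norm_pole]
      have : (inner ℝ n (X w) : ℝ) = 2 * γ := by rw [hγ]; ring
      rw [this]
      simp
      ring

end StereoPatch

theorem exists_stereoMap_eq (v : Metric.sphere (0 : EuclideanSpace ℝ (Fin 4)) 1) :
    ∃ J : EuclideanSpace ℝ (Fin 3) →ₗᵢ[ℝ] EuclideanSpace ℝ (Fin 4),
      (∀ a, inner ℝ (J a) v.1 = (0 : ℝ)) ∧ (∀ s, inner ℝ s v.1 = (0 : ℝ) → ∃ a, J a = s)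
      ∧ ∀ a, (invStereo v a).1 = stereoMap J v.1 a := by
  have : Fact (Module.finrank ℝ (EuclideanSpace ℝ (Fin 4)) = 3 + 1) := ⟨by simp⟩
  set T := (OrthonormalBasis.fromOrthogonalSpanSingleton (𝕜 := ℝ) 3 (ne_zero_of_mem_unit_sphere v)).repr
    with hT
  refine ⟨(ℝ ∙ v.1)ᗮ.subtypeₗᵢ.comp T.symm.toLinearIsometry, fun a => ?_, fun s hs => ?_,
    fun a => ?_⟩
  · rw [real_inner_comm]
    exact Submodule.mem_orthogonal_singleton_iff_inner_right.1 (T.symm a).2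
  · rw [real_inner_comm] at hs
    refine ⟨T ⟨s, Submodule.mem_orthogonal_singleton_iff_inner_right.2 hs⟩, ?_⟩
    simp
  · have e := stereographic'_symm_apply (n := 3) v a
    rw [invStereo, e, stereoMap]
    simp only [LinearIsometry.coe_comp, Function.comp_apply, Submodule.coe_subtypeₗᵢ,
      Submodule.coe_subtype, LinearIsometryEquiv.coe_toLinearIsometry, ← hT]
    have hn : ‖((T.symm a : (ℝ ∙ v.1)ᗮ) : EuclideanSpace ℝ (Fin 4))‖ = ‖a‖ := by
      rw [← Submodule.coe_norm, T.symm.norm_map]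
    rw [hn, smul_add]

/-- The projection is taken on an open subset of ℝ⁴ instead of the sphere, so smoothness of σ∘y
follows from that of y as an ℝ⁴-valued map. -/
theorem exists_invStereo_inverse (v : Metric.sphere (0 : EuclideanSpace ℝ (Fin 4)) 1) :
    ∃ σ : EuclideanSpace ℝ (Fin 4) → EuclideanSpace ℝ (Fin 3),
      ContDiffOn ℝ ∞ σ {a | (inner ℝ v.1 a : ℝ) ≠ 1}
      ∧ ∀ q : Metric.sphere (0 : EuclideanSpace ℝ (Fin 4)) 1, q ≠ v →
        invStereo v (σ q.1) = q := by
  have : Fact (Module.finrank ℝ (EuclideanSpace ℝ (Fin 4)) = 3 + 1) := ⟨by simp⟩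
  refine ⟨fun a => (OrthonormalBasis.fromOrthogonalSpanSingleton (𝕜 := ℝ) 3
    (ne_zero_of_mem_unit_sphere v)).repr (stereoToFun v.1 a), ?_, fun q hq => ?_⟩
  · exact (LinearIsometryEquiv.contDiff _).comp_contDiffOn contDiffOn_stereoToFun
  · have hq' : q ∈ (stereographic' 3 v).source := by
      rw [stereographic'_source]; exact hq
    exact (stereographic' 3 v).left_inv hq'

theorem fderiv_injective_of_coeffs {n : ℕ} {X : ℂ → EuclideanSpace ℝ (Fin n)} {w : ℂ}
    (h0 : 0 < coeffE X w) (hE : coeffE X w = coeffG X w) (hF : coeffF X w = 0) :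
    Function.Injective (fderiv ℝ X w) := by
  rw [injective_iff_map_eq_zero]
  intro a ha
  have e : a = a.re • (1 : ℂ) + a.im • I := by simp [re_add_im]
  rw [e, map_add, map_smul, map_smul] at ha
  have h1 := congrArg (fun b => inner ℝ b (pu X w)) ha
  have h2 := congrArg (fun b => inner ℝ b (pv X w)) ha
  have hF' : inner ℝ (pv X w) (pu X w) = (0 : ℝ) := by rw [real_inner_comm]; exact hF
  have g1 : a.re * coeffE X w + a.im * inner ℝ (pv X w) (pu X w) = 0 := by
    simpa [inner_add_left, inner_smul_left, coeffE, pu, pv] using h1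
  have g2 : a.re * coeffF X w + a.im * coeffG X w = 0 := by
    simpa [inner_add_left, inner_smul_left, coeffF, coeffG, pu, pv] using h2
  rw [hF', mul_zero, add_zero] at g1
  rw [hF, mul_zero, zero_add, ← hE] at g2
  apply Complex.ext
  · exact (mul_eq_zero.1 g1).resolve_right h0.ne'
  · exact (mul_eq_zero.1 g2).resolve_right h0.ne'

/-! ### The implications between the three conditions on the Riemann surface. -/

section Equivalence

variable {M : Type*} [TopologicalSpace M] [ChartedSpace ℂ M] [IsManifold 𝓘(ℂ) ω M]
  {y : M → Metric.sphere (0 : EuclideanSpace ℝ (Fin 4)) 1}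

theorem hopf_inCoord_ne_zero (hy : IsConformalImmersion y) (humb : UmbilicFree y)
    {φ : OpenPartialHomeomorph M ℂ} (hφ : φ ∈ coords M) {w : ℂ} (hw : w ∈ φ.target) :
    hopf (lift (inCoord y φ)) (sphereNormal (inCoord y φ)) w ≠ 0 :=
  (hy.confPatch hφ).hopf_ne_zero hw (humb φ hφ w hw)

/-- Minimality places the constant null vector (1, v) in every mean curvature sphere, and
`ConfFrame.rho_eq_zero_of_normal` applies to it. -/
theorem invP_eq_zero_of_minimal (hy : IsConformalImmersion y) (humb : UmbilicFree y)
    {v : Metric.sphere (0 : EuclideanSpace ℝ (Fin 4)) 1} {x : M → EuclideanSpace ℝ (Fin 3)}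
    (hx : IsMinimal x) (hyx : ∀ p, y p = invStereo v (x p)) {φ : OpenPartialHomeomorph M ℂ}
    (hφ : φ ∈ coords M) {w : ℂ} (hw : w ∈ φ.target) : invP (inCoord y φ) w = 0 := by
  obtain ⟨J, hJ1, hJ2, hJ3⟩ := exists_stereoMap_eq v
  have hc := hy.confPatch hφ
  have hk := fun w (hw : w ∈ φ.target) => hopf_inCoord_ne_zero hy humb hφ hw
  have hs : StereoPatch φ.target (fun w => x (φ.symm w)) J v.1 :=
    ⟨φ.open_target, contDiffOn_inChart hx.1 hφ, norm_eq_of_mem_sphere v, hJ1, hJ2⟩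
  have e : ∀ w ∈ φ.target, inCoord y φ w = stereoMap J v.1 (x (φ.symm w)) := fun w _ => by
    rw [inCoord, hyx, hJ3]
  rw [hc.confFrame.invP_eq_zero_iff hw hk]
  exact hc.confFrame.rho_eq_zero_of_normal hk hw
    (fun w hw => (hs.lor_pole_sphereNormal_iff hw hc e).2 (hx.2 φ hφ w hw).2)
    (conjM_lightVec _) hs.lor_pole_pole ((hc.lor_lift_ne_zero hw).2 (hs.lor_pole_ne_zero hw e))

theorem exists_minimal_of_invP_eq_zero [ConnectedSpace M] (hy : IsWillmore y)
    (humb : UmbilicFree y) (hP : ∀ φ ∈ coords M, ∀ w ∈ φ.target, invP (inCoord y φ) w = 0) :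
    ∃ (v : Metric.sphere (0 : EuclideanSpace ℝ (Fin 4)) 1) (x : M → EuclideanSpace ℝ (Fin 3)),
      IsMinimal x ∧ ∀ p, y p = invStereo v (x p) := by
  have hk := fun φ (hφ : φ ∈ coords M) w (hw : w ∈ φ.target) =>
    hopf_inCoord_ne_zero hy.1 humb hφ hw
  obtain ⟨v, hv, hpole⟩ := exists_pole hy.1 hk fun φ hφ w hw => by
    have hc := hy.1.confPatch hφ
    exact hc.exists_isPole (hk φ hφ) (fun w hw => hc.willmore_equation (hy.2 φ hφ) hw)
      (fun w hw => (hc.confFrame.invP_eq_zero_iff hw (hk φ hφ)).1 (hP φ hφ w hw)) hw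
  have hpole' := fun φ hφ w hw => (hpole φ hφ w hw).self_of_nhds
  set V : Metric.sphere (0 : EuclideanSpace ℝ (Fin 4)) 1 := ⟨v, by simp [hv]⟩ with hV
  -- The surface misses the pole: ⟨v, y⟩ - 1 is the Lorentz product of (1, v) and (1, y), which a
  -- pole keeps nonzero.
  have hne : ∀ p, (inner ℝ v (y p).1 : ℝ) ≠ 1 := by
    intro p hp
    have := (hpole' _ (chart_mem_coords p) _ (mem_chart_target ℂ p)).2
    rw [lor_lightVec_lightVec, inCoord, (chartAt ℂ p).left_inv (mem_chart_source ℂ p), hp] at this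
    simp at this
  obtain ⟨J, hJ1, hJ2, hJ3⟩ := exists_stereoMap_eq V
  obtain ⟨σ, hσ, hσ'⟩ := exists_invStereo_inverse V
  have hyx : ∀ p, y p = invStereo V (σ (y p).1) := fun p => by
    refine (hσ' (y p) fun h => hne p ?_).symm
    rw [h, hV, real_inner_self_eq_norm_sq, hv, one_pow]
  have hx : ContMDiff 𝓘(ℝ, ℂ) 𝓘(ℝ, EuclideanSpace ℝ (Fin 3)) ∞ (fun p => σ (y p).1) :=
    hσ.contMDiffOn.comp_contMDiff hy.1.1 hne
  refine ⟨V, fun p => σ (y p).1, ⟨hx, fun φ hφ w hw => ?_⟩, hyx⟩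
  have hc := hy.1.confPatch hφ
  have hs : StereoPatch φ.target (fun w => σ (y (φ.symm w)).1) J V.1 :=
    ⟨φ.open_target, contDiffOn_inChart hx hφ, hv, hJ1, hJ2⟩
  have e : ∀ w ∈ φ.target, inCoord y φ w = stereoMap J V.1 (σ (y (φ.symm w)).1) := fun w _ => by
    rw [← hJ3, ← hyx, inCoord]
  obtain ⟨h0, hE, hF⟩ := hs.coeffs hw hc e
  exact ⟨fderiv_injective_of_coeffs h0 hE hF,
    (hs.lor_pole_sphereNormal_iff hw hc e).1 (hpole' φ hφ w hw).1⟩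

theorem mobiusK_eq_one_of_invP_eq_zero (hy : IsConformalImmersion y) (humb : UmbilicFree y)
    {φ : OpenPartialHomeomorph M ℂ} (hφ : φ ∈ coords M) {w : ℂ} (hw : w ∈ φ.target)
    (hP : invP (inCoord y φ) w = 0) : mobiusK (inCoord y φ) w = 1 := by
  have hc := (hy.confPatch hφ).confFrame
  have hk := fun w (hw : w ∈ φ.target) => hopf_inCoord_ne_zero hy humb hφ hw
  rw [hc.mobiusK_eq_one_iff hw hk, (hc.invP_eq_zero_iff hw hk).1 hP]
  simp

theorem invP_eq_zero_of_mobiusK_eq_one (hy : IsWillmore y) (humb : UmbilicFree y)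
    {φ : OpenPartialHomeomorph M ℂ} (hφ : φ ∈ coords M)
    (hK : ∀ w ∈ φ.target, mobiusK (inCoord y φ) w = 1) {w : ℂ} (hw : w ∈ φ.target) :
    invP (inCoord y φ) w = 0 := by
  have hp := hy.1.confPatch hφ
  have hc := hp.confFrame
  have hk := fun w (hw : w ∈ φ.target) => hopf_inCoord_ne_zero hy.1 humb hφ hw
  rw [hc.invP_eq_zero_iff hw hk]
  exact hc.rho_eq_zero_of_imaginary hk hw (fun w hw => hp.willmore_equation (hy.2 φ hφ) hw)
    fun w hw => (hc.mobiusK_eq_one_iff hw hk).1 (hK w hw)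

end Equivalence

end MobiusSurface

end

theorem mainTheorem9 {M : Type*} [TopologicalSpace M] [T2Space M] [ConnectedSpace M]
    [ChartedSpace ℂ M] [IsManifold 𝓘(ℂ) ω M]
    (y : M → Metric.sphere (0 : EuclideanSpace ℝ (Fin 4)) 1)
    (hy : MobiusSurface.IsWillmore y) (humb : MobiusSurface.UmbilicFree y) :
    List.TFAE [
      ∀ φ ∈ MobiusSurface.coords M, ∀ w ∈ φ.target,
        MobiusSurface.invP (MobiusSurface.inCoord y φ) w = 0,
      ∀ φ ∈ MobiusSurface.coords M, ∀ w ∈ φ.target,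
        MobiusSurface.mobiusK (MobiusSurface.inCoord y φ) w = 1,
      ∃ (v : Metric.sphere (0 : EuclideanSpace ℝ (Fin 4)) 1) (x : M → EuclideanSpace ℝ (Fin 3)),
        MobiusSurface.IsMinimal x ∧ ∀ p, y p = MobiusSurface.invStereo v (x p)] := by
  tfae_have 1 → 2 := fun h φ hφ w hw =>
    MobiusSurface.mobiusK_eq_one_of_invP_eq_zero hy.1 humb hφ hw (h φ hφ w hw)
  tfae_have 2 → 1 := fun h φ hφ w hw =>
    MobiusSurface.invP_eq_zero_of_mobiusK_eq_one hy humb hφ (h φ hφ) hw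
  tfae_have 1 → 3 := MobiusSurface.exists_minimal_of_invP_eq_zero hy humb
  tfae_have 3 → 1 := fun ⟨_, _, hx, hyx⟩ _ hφ _ hw =>
    MobiusSurface.invP_eq_zero_of_minimal hy.1 humb hx hyx hφ hw
  tfae_finish
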